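/- Let $k$ be a field, $Q$ a finite quiver with set of vertices $Q_0$ and set of arrows $Q_1$ (paths are written from right to left, $s$ and $t$ denote source and target), $I$ a two-sided ideal of the path algebra $kQ$ with $I\subseteq kQ_{\ge 2}$ (the span of the paths of length at least $2$), $A=kQ/I$, and $\pi:kQ\to A$ the projection. Fix an admissible well-order on the set of paths of $Q$. Suppose that $I$ has a finite reduced Gröbner basis $\mathcal G$ for this order; let $\mathrm{Tip}(g)$ be the largest path in the support of $g$, $\mathrm{Tip}(\mathcal G)=\{\mathrm{Tip}(g): g\in\mathcal G\}$, and let $\mathcal B$ be the set of paths that are not the tip of a nonzero element of $I$; the classes of the paths in $\mathcal B$ form a $k$-basis of $A$. For sets $X,Y$ of paths, let $k(X/\!/Y)$ be the vector space with basis the pairs $(x,y)\in X\times Y$ of parallel paths; for $a=\sum_i\lambda_i\pi(b_i)\in A$ with $b_i\in\mathcal B$ parallel to $x$, put $(x,a)=\sum_i\lambda_i(x,b_i)\in k(X/\!/\mathcal B)$. For a path $p$, an arrow $\alpha$ and a path $\gamma$ parallel to $\alpha$, let $p^{(\alpha,\gamma)}\in kQ$ be the sum of the paths obtained by replacing one occurrence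 of $\alpha$ in $p$ by $\gamma$ (a sum over the occurrences, zero if there is none). Write $g=\sum_{p\in\mathrm{Supp}(g)}c_g(p)\,p$. Define linear maps $$\psi_0:k(Q_0/\!/\mathcal B)\to k(Q_1/\!/\mathcal B),\qquad (e,\gamma)\mapsto\sum_{\alpha\in Q_1,\ s(\alpha)=e}(\alpha,\pi(\alpha\gamma))-\sum_{\beta\in Q_1,\ t(\beta)=e}(\beta,\pi(\gamma\beta)),$$ $$\psi_1:k(Q_1/\!/\mathcal B)\to k(\mathrm{Tip}(\mathcal G)/\!/\mathcal B),\qquad (\alpha,\gamma)\mapsto\sum_{g\in\mathcal G}\ \sum_{p\in\mathrm{Supp}(g)}c_g(p)\,\bigl(\mathrm{Tip}(g),\pi(p^{(\alpha,\gamma)})\bigr).$$ Let $A^e=A\otimes_kA^{op}$, and let $B^{\mathcal M}(A)$ be the two-sided Anick resolution of $A$: the Morse complex of the reduced bar resolution of $A$ (relative to the subalgebra $kQ_0$) with respect to the matching $\mathcal M$ given by the Anick chains of $\mathrm{Tip}(\mathcal G)$, with differential given by the sums of the weights of zigzag paths. Then the generators (critical cells) of $B^{\mathcal M}(A)$ in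 degrees $0,1,2$ correspond, through the product of their entries, to the elements of $Q_0$, $Q_1$, $\mathrm{Tip}(\mathcal G)$ respectively. The beginning of the cochain complex $\mathrm{Hom}_{A^e}(B^{\mathcal M}(A),A)$ is isomorphic to $$0\to k(Q_0/\!/\mathcal B)\xrightarrow{\ \psi_0\ }k(Q_1/\!/\mathcal B)\xrightarrow{\ \psi_1\ }k(\mathrm{Tip}(\mathcal G)/\!/\mathcal B),$$ through the linear isomorphisms that send a cochain $f$ to $\sum_x (x,f([x]))$, where $x$ runs over $Q_0$, $Q_1$, $\mathrm{Tip}(\mathcal G)$ respectively and $[x]$ is the generator corresponding to $x$. In particular $\psi_1\psi_0=0$. Moreover there are isomorphisms of $k$-vector spaces $\mathrm{HH}^0(A)\cong\operatorname{Ker}\psi_0$ and $\mathrm{HH}^1(A)\cong\operatorname{Ker}\psi_1/\operatorname{Im}\psi_0$, where $\mathrm{HH}^n(A)$ is the Hochschild cohomology of $A$ with coefficients in $A$. -/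

import Mathlib

noncomputable section

open scoped TensorProduct

namespace QuiverHH

universe w u v

/-! ### Paths of a quiver -/

/-- A path of the quiver `Q`, bundled with its source and its target.  The constructor
`Quiver.Path.cons p a` appends the arrow `a` at the target of `p`; in the right-to-left notation
for paths it is the path `a p`. -/
structure QPath (Q : Type u) [Quiver.{v} Q] where
  source : Q
  target : Q
  path : Quiver.Path source target

namespace QPath

variable {Q : Type u} [Quiver.{v} Q]

/-- The length of a path. -/
def length (p : QPath Q) : ℕ := p.path.length

/-- The trivial path at a vertex. -/
def vertex (e : Q) : QPath Q := ⟨e, e, Quiver.Path.nil⟩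

/-- An arrow, seen as a path of length one. -/
def arrow {a b : Q} (x : a ⟶ b) : QPath Q := ⟨a, b, x.toPath⟩

open Classical in
/-- The product `p q` of two paths, written from right to left (first `q`, then `p`).  The value
is `none` if the target of `q` is not the source of `p`, i.e. if the product in the path algebra
is zero. -/
def mul? (p q : QPath Q) : Option (QPath Q) :=
  if h : q.target = p.source then some ⟨q.source, p.target, (q.path.cast rfl h).comp p.path⟩
  else none

/-- `p` divides `q`: there are paths `a`, `b` with `q = a p b`. -/
def Divides (p q : QPath Q) : Prop :=
  ∃ a b c : QPath Q, mul? a p = some c ∧ mul? c b = some q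

theorem mul?_assoc (p q r : QPath Q) :
    (mul? p q).bind (fun x => mul? x r) = (mul? q r).bind (fun x => mul? p x) := by
  obtain ⟨a, b, p⟩ := p
  obtain ⟨c, d, q⟩ := q
  obtain ⟨e, f, r⟩ := r
  by_cases h1 : d = a
  · subst h1
    by_cases h2 : f = c
    · subst h2
      simp [mul?]
    · simp [mul?, h2]
  · by_cases h2 : f = c
    · subst h2
      simp [mul?, h1]
    · simp [mul?, h1, h2]

open Classical in
theorem mul?_vertex (p : QPath Q) (e : Q) :
    mul? p (vertex e) = if p.source = e then some p else none := by
  classical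
  obtain ⟨a, b, p⟩ := p
  by_cases h : e = a
  · subst h
    simp [mul?, vertex]
  · simp [mul?, vertex, h, Ne.symm h]

open Classical in
theorem vertex_mul? (p : QPath Q) (e : Q) :
    mul? (vertex e) p = if p.target = e then some p else none := by
  classical
  obtain ⟨a, b, p⟩ := p
  by_cases h : b = e
  · subst h
    simp [mul?, vertex]
  · simp [mul?, vertex, h]

end QPath

/-! ### The path algebra -/

/-- The underlying vector space of the path algebra `kQ`: formal finite linear combinations of
paths. -/
def PathAlgebra (k : Type w) [Field k] (Q : Type u) [Quiver.{v} Q] : Type (max u v w) :=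
  QPath Q →₀ k

namespace PathAlgebra

variable {k : Type w} [Field k] {Q : Type u} [Quiver.{v} Q]

instance : AddCommGroup (PathAlgebra k Q) := inferInstanceAs (AddCommGroup (QPath Q →₀ k))

instance : Module k (PathAlgebra k Q) := inferInstanceAs (Module k (QPath Q →₀ k))

/-- The coefficients of an element of the path algebra. -/
def coeff : PathAlgebra k Q ≃ₗ[k] (QPath Q →₀ k) := LinearEquiv.refl k (QPath Q →₀ k)

/-- A path, as an element of the path algebra. -/
def of (p : QPath Q) : PathAlgebra k Q := coeff.symm (Finsupp.single p 1)

/-- A path, or zero for `none`, as an element of the path algebra. -/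
def ofOption : Option (QPath Q) → PathAlgebra k Q
  | some p => of p
  | none => 0

/-- The multiplication of the path algebra, as a bilinear map. -/
def mulₗ : PathAlgebra k Q →ₗ[k] PathAlgebra k Q →ₗ[k] PathAlgebra k Q :=
  (Finsupp.linearCombination k fun p =>
    (Finsupp.linearCombination k fun q => ofOption (QPath.mul? p q)) ∘ₗ coeff.toLinearMap)
    ∘ₗ coeff.toLinearMap

instance : Mul (PathAlgebra k Q) := ⟨fun f g => mulₗ f g⟩

theorem mul_def (f g : PathAlgebra k Q) : f * g = mulₗ f g := rfl

theorem of_mul_of (p q : QPath Q) :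
    (of p * of q : PathAlgebra k Q) = ofOption (QPath.mul? p q) := by
  simp [mul_def, mulₗ, of]

/-- Linear maps out of the path algebra that agree on paths are equal. -/
theorem linearMap_ext {M : Type*} [AddCommMonoid M] [Module k M]
    {f g : PathAlgebra k Q →ₗ[k] M} (h : ∀ p : QPath Q, f (of p) = g (of p)) : f = g :=
  Finsupp.lhom_ext' fun p => LinearMap.ext_ring (h p)

/-- The unit of the path algebra of a finite quiver: the sum of all trivial paths. -/
instance [Fintype Q] : One (PathAlgebra k Q) := ⟨∑ e : Q, of (QPath.vertex e)⟩

theorem one_def [Fintype Q] : (1 : PathAlgebra k Q) = ∑ e : Q, of (QPath.vertex e) := rfl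

protected theorem mul_assoc (f g h : PathAlgebra k Q) : f * g * h = f * (g * h) := by
  have key : (mulₗ (k := k) (Q := Q)).compr₂ mulₗ =
      (LinearMap.lcomp k _ mulₗ).comp ((LinearMap.llcomp k (PathAlgebra k Q) (PathAlgebra k Q)
        (PathAlgebra k Q)).comp mulₗ) := by
    refine linearMap_ext fun p => linearMap_ext fun q => linearMap_ext fun r => ?_
    have e1 : ∀ x : Option (QPath Q), mulₗ (ofOption (k := k) x) (of r) =
        ofOption (x.bind fun y => QPath.mul? y r) := by
      rintro (_ | x)
      · simp [ofOption]
      · exact of_mul_of x r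
    have e2 : ∀ x : Option (QPath Q), mulₗ (of p) (ofOption (k := k) x) =
        ofOption (x.bind fun y => QPath.mul? p y) := by
      rintro (_ | x)
      · simp [ofOption]
      · exact of_mul_of p x
    have h1 : mulₗ (mulₗ (of (k := k) p) (of q)) (of r) =
        mulₗ (of p) (mulₗ (of q) (of r)) := by
      have a1 : mulₗ (of (k := k) p) (of q) = ofOption (QPath.mul? p q) := of_mul_of p q
      have a2 : mulₗ (of (k := k) q) (of r) = ofOption (QPath.mul? q r) := of_mul_of q r
      rw [a1, a2, e1, e2, QPath.mul?_assoc]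
    exact h1
  exact congrArg (fun F => F f g h) key

instance [Fintype Q] : Ring (PathAlgebra k Q) :=
  { (inferInstance : AddCommGroup (PathAlgebra k Q)),
    (inferInstance : Mul (PathAlgebra k Q)),
    (inferInstance : One (PathAlgebra k Q)) with
    left_distrib := fun f g h => by simp [mul_def]
    right_distrib := fun f g h => by simp [mul_def]
    zero_mul := fun f => by simp [mul_def]
    mul_zero := fun f => by simp [mul_def]
    mul_assoc := PathAlgebra.mul_assoc
    one_mul := fun f => by
      have : mulₗ (1 : PathAlgebra k Q) = LinearMap.id := linearMap_ext fun p => by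
        classical
        have h : ∀ e : Q, mulₗ (of (k := k) (QPath.vertex e)) (of p) =
            if p.target = e then of p else 0 := fun e => by
          refine (of_mul_of _ _).trans ?_
          rw [QPath.vertex_mul?]
          split_ifs <;> rfl
        simp [one_def, h]
      exact congrArg (fun F => F f) this
    mul_one := fun f => by
      have : mulₗ.flip (1 : PathAlgebra k Q) = LinearMap.id := linearMap_ext fun p => by
        classical
        have h : ∀ e : Q, mulₗ (of (k := k) p) (of (QPath.vertex e)) =
            if p.source = e then of p else 0 := fun e => by
          refine (of_mul_of _ _).trans ?_
          rw [QPath.mul?_vertex]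
          split_ifs <;> rfl
        simp [one_def, h]
      exact congrArg (fun F => F f) this }

instance [Fintype Q] : Algebra k (PathAlgebra k Q) :=
  Algebra.ofModule (fun r f g => by simp [mul_def]) (fun r f g => by simp [mul_def])

end PathAlgebra

open PathAlgebra

/-! ### Admissible orders, tips, Gröbner bases -/

/-- The given linear order on the set of paths is an admissible order (the well-foundedness is
the separate type class `WellFoundedLT`). -/
structure IsAdmissibleOrder (Q : Type u) [Quiver.{v} Q] [LinearOrder (QPath Q)] : Prop where
  mul_right : ∀ p q r p' q' : QPath Q, p < q →
    QPath.mul? p r = some p' → QPath.mul? q r = some q' → p' < q'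
  mul_left : ∀ p q s p' q' : QPath Q, p < q →
    QPath.mul? s p = some p' → QPath.mul? s q = some q' → p' < q'
  factor_le : ∀ p q r : QPath Q, QPath.mul? q r = some p → q ≤ p ∧ r ≤ p

section Groebner

variable {k : Type w} [Field k] {Q : Type u} [Quiver.{v} Q] [LinearOrder (QPath Q)]

/-- The tip of a nonzero element of the path algebra: the largest path of its support. -/
def tip (f : PathAlgebra k Q) (hf : f ≠ 0) : QPath Q :=
  (coeff f).support.max'
    (Finsupp.support_nonempty_iff.2 fun h => hf (coeff.map_eq_zero_iff.1 h))

/-- The set of tips of the nonzero elements of a set `S`. -/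
def tipSet (S : Set (PathAlgebra k Q)) : Set (QPath Q) :=
  {p | ∃ f ∈ S, ∃ hf : f ≠ 0, tip f hf = p}

/-- The paths that are not a tip of an element of `S`. -/
def nonTip (S : Set (PathAlgebra k Q)) : Set (QPath Q) := (tipSet S)ᶜ

variable [Fintype Q]

/-- The two-sided ideal of the path algebra generated by the tips of the elements of `S`. -/
def tipIdeal (S : Set (PathAlgebra k Q)) : TwoSidedIdeal (PathAlgebra k Q) :=
  TwoSidedIdeal.span (of '' tipSet S)

/-- `G` is a reduced Gröbner basis of the ideal `I`. -/
structure IsReducedGroebnerBasis (I : Ideal (PathAlgebra k Q)) (G : Set (PathAlgebra k Q)) :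
    Prop where
  subset : G ⊆ I
  tipIdeal_eq : tipIdeal (I : Set (PathAlgebra k Q)) = tipIdeal G
  /-- Every element of `G` is (nonzero and) monic. -/
  monic : ∀ g ∈ G, ∃ hg : g ≠ 0, coeff g (tip g hg) = 1
  tip_reduced : ∀ g ∈ G, ∀ h ∈ G, g ≠ h → ∀ (hg : g ≠ 0) (hh : h ≠ 0),
    ¬ (tip g hg).Divides (tip h hh)
  reduced : ∀ g ∈ G, ∀ hg : g ≠ 0,
    g - of (tip g hg) ∈ Submodule.span k (of '' nonTip (I : Set (PathAlgebra k Q)))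

variable (I : Ideal (PathAlgebra k Q)) [I.IsTwoSided]

theorem le_tip {f : PathAlgebra k Q} (hf : f ≠ 0) {p : QPath Q} (hp : coeff f p ≠ 0) :
    p ≤ tip f hf :=
  Finset.le_max' _ _ (Finsupp.mem_support_iff.2 hp)

theorem coeff_tip_ne_zero {f : PathAlgebra k Q} (hf : f ≠ 0) : coeff f (tip f hf) ≠ 0 :=
  Finsupp.mem_support_iff.1 (Finset.max'_mem _ _)

theorem linearIndependent_nonTip :
    LinearIndependent k (fun p : nonTip (I : Set (PathAlgebra k Q)) =>
      Ideal.Quotient.mkₐ k I (of p.1)) := by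
  rw [linearIndependent_iff]
  intro l hl
  by_contra hne
  set f : PathAlgebra k Q := coeff.symm (l.mapDomain Subtype.val) with hfdef
  have hcf : coeff f = l.mapDomain Subtype.val := by simp [hfdef]
  have hf0 : f ≠ 0 := by
    intro h0
    apply hne
    apply Finsupp.mapDomain_injective Subtype.val_injective
    rw [← hcf, h0]; simp
  have hfI : f ∈ I := by
    rw [← Ideal.Quotient.eq_zero_iff_mem]
    have : f = Finsupp.linearCombination k (fun p : nonTip (I : Set (PathAlgebra k Q)) =>
        (of p.1 : PathAlgebra k Q)) l := by
      rw [hfdef, Finsupp.mapDomain, Finsupp.linearCombination_apply, Finsupp.sum, Finsupp.sum,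
        map_sum]
      refine Finset.sum_congr rfl fun p _ => ?_
      rw [of, ← map_smul]; simp
    rw [this]
    have h2 := Finsupp.apply_linearCombination k (Ideal.Quotient.mkₐ k I).toLinearMap
      (fun p : nonTip (I : Set (PathAlgebra k Q)) => (of p.1 : PathAlgebra k Q)) l
    exact h2.trans hl
  have ht := coeff_tip_ne_zero hf0
  have : tip f hf0 ∈ nonTip (I : Set (PathAlgebra k Q)) := by
    by_contra hnot
    apply ht
    rw [hcf]
    apply Finsupp.mapDomain_of_notMem_range
    rintro ⟨x, hx⟩
    exact hnot (hx ▸ x.2)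
  exact this ⟨f, hfI, hf0, rfl⟩

theorem span_nonTip [WellFoundedLT (QPath Q)] :
    ⊤ ≤ Submodule.span k (Set.range (fun p : nonTip (I : Set (PathAlgebra k Q)) =>
      Ideal.Quotient.mkₐ k I (of p.1))) := by
  set S := Submodule.span k (Set.range (fun p : nonTip (I : Set (PathAlgebra k Q)) =>
      Ideal.Quotient.mkₐ k I (of p.1))) with hS
  have expand : ∀ f : PathAlgebra k Q, f = ∑ q ∈ (coeff f).support, coeff f q • of q := by
    intro f
    apply coeff.injective
    rw [map_sum]
    conv_lhs => rw [← Finsupp.sum_single (coeff f)]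
    refine Finset.sum_congr rfl fun p _ => ?_
    rw [map_smul, of]; simp
  have hp : ∀ p : QPath Q, Ideal.Quotient.mkₐ k I (of p) ∈ S := by
    intro p
    induction p using WellFoundedLT.induction with
    | ind p ih =>
      by_cases hn : p ∈ nonTip (I : Set (PathAlgebra k Q))
      · exact Submodule.subset_span ⟨⟨p, hn⟩, rfl⟩
      · have : p ∈ tipSet (I : Set (PathAlgebra k Q)) := by
          simpa [nonTip] using hn
        obtain ⟨f, hfI, hf0, rfl⟩ := this
        have hc := coeff_tip_ne_zero hf0
        have h0 : Ideal.Quotient.mkₐ k I f = 0 := Ideal.Quotient.eq_zero_iff_mem.2 hfI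
        rw [expand f, map_sum, ← Finset.add_sum_erase _ _ (Finsupp.mem_support_iff.2 hc),
          map_smul] at h0
        have h1 : coeff f (tip f hf0) • Ideal.Quotient.mkₐ k I (of (tip f hf0)) ∈ S := by
          rw [eq_neg_of_add_eq_zero_left h0]
          refine S.neg_mem (S.sum_mem fun q hq => ?_)
          rw [Finset.mem_erase, Finsupp.mem_support_iff] at hq
          rw [map_smul]
          exact S.smul_mem _ (ih q (lt_of_le_of_ne (le_tip hf0 hq.2) hq.1))
        simpa [smul_smul, inv_mul_cancel₀ hc] using S.smul_mem (coeff f (tip f hf0))⁻¹ h1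
  intro a _
  obtain ⟨f, rfl⟩ := Ideal.Quotient.mkₐ_surjective k I a
  rw [expand f, map_sum]
  refine S.sum_mem fun q _ => ?_
  rw [map_smul]
  exact S.smul_mem _ (hp q)

/-- The monomial basis of `kQ / I`, given by the classes of the paths in `nonTip I`. -/
def monomialBasis [WellFoundedLT (QPath Q)] :
    Module.Basis (nonTip (I : Set (PathAlgebra k Q))) k (PathAlgebra k Q ⧸ I) :=
  Module.Basis.mk (linearIndependent_nonTip I) (span_nonTip I)

end Groebner

/-! ### Subquotients of vector spaces -/

section Subquotient

variable {k : Type*} [Field k] {V : Type*} [AddCommGroup V] [Module k V]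

/-- The subquotient `Z / (B ∩ Z)` of a vector space, which is `Z / B` if `B ≤ Z`. -/
def Subquotient (Z B : Submodule k V) : Type _ := Z ⧸ B.submoduleOf Z

instance (Z B : Submodule k V) : AddCommGroup (Subquotient Z B) :=
  inferInstanceAs (AddCommGroup (Z ⧸ B.submoduleOf Z))

instance (Z B : Submodule k V) : Module k (Subquotient Z B) :=
  inferInstanceAs (Module k (Z ⧸ B.submoduleOf Z))

end Subquotient

/-! ### Hochschild cohomology of an algebra over a field -/

section Hochschild

variable (k : Type w) [Field k] (A : Type u) [Ring A] [Algebra k A]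

/-- Hochschild `n`-cochains of `A` with coefficients in `A`. -/
abbrev HochschildCochain (n : ℕ) : Type u := MultilinearMap k (fun _ : Fin n => A) A

variable {k A}

theorem contractNth_update {n : ℕ} (r : Fin n) (i : Fin (n + 1)) :
    ∀ a : Fin (n + 1) → A, ∃ (s : Fin n) (φ : A →ₗ[k] A), ∀ x : A,
      Fin.contractNth r.castSucc (· * ·) (Function.update a i x) =
        Function.update (Fin.contractNth r.castSucc (· * ·) a) s (φ x) := by
  intro a
  rcases lt_trichotomy i.val r.val with h | h | h
  · refine ⟨⟨i.val, by omega⟩, LinearMap.id, fun x => ?_⟩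
    funext t
    simp only [Fin.contractNth, Function.update_apply, Fin.ext_iff, Fin.val_castSucc,
      Fin.val_succ, LinearMap.id_apply]
    split_ifs <;> first | rfl | omega
  · refine ⟨r, LinearMap.mulRight k (a r.succ), fun x => ?_⟩
    funext t
    rcases eq_or_ne t r with rfl | ht
    · simp [Fin.contractNth, Function.update_apply, Fin.ext_iff, h]
    · have ht' : t.val ≠ r.val := fun h' => ht (Fin.ext h')
      simp only [Fin.contractNth, Function.update_apply, Fin.ext_iff, Fin.val_castSucc,
        Fin.val_succ]
      split_ifs <;> first | rfl | omega
  · rcases eq_or_ne i.val (r.val + 1) with h' | h'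
    · refine ⟨r, LinearMap.mulLeft k (a r.castSucc), fun x => ?_⟩
      funext t
      rcases eq_or_ne t r with rfl | ht
      · simp [Fin.contractNth, Function.update_apply, Fin.ext_iff, h']
      · have ht' : t.val ≠ r.val := fun h' => ht (Fin.ext h')
        simp only [Fin.contractNth, Function.update_apply, Fin.ext_iff, Fin.val_castSucc,
          Fin.val_succ]
        split_ifs <;> first | rfl | omega
    · refine ⟨⟨i.val - 1, by omega⟩, LinearMap.id, fun x => ?_⟩
      funext t
      simp only [Fin.contractNth, Function.update_apply, Fin.ext_iff, Fin.val_castSucc,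
        Fin.val_succ, LinearMap.id_apply]
      split_ifs <;> first | rfl | omega

/-- The linear map sending a cochain `f` to `(a₀, …, aₙ) ↦ f (a₀, …, aᵣ aᵣ₊₁, …, aₙ)`. -/
def HochschildCochain.contract {n : ℕ} (r : Fin n) :
    HochschildCochain k A n →ₗ[k] HochschildCochain k A (n + 1) where
  toFun (f : MultilinearMap k (fun _ : Fin n => A) A) :=
    (MultilinearMap.mk' (fun a => f (Fin.contractNth r.castSucc (· * ·) a))
      (fun a i x y => by
        obtain ⟨s, φ, h⟩ := contractNth_update (k := k) r i a
        simp only [h, map_add, MultilinearMap.map_update_add])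
      (fun a i c x => by
        obtain ⟨s, φ, h⟩ := contractNth_update (k := k) r i a
        simp only [h, map_smul, MultilinearMap.map_update_smul]) :
      MultilinearMap k (fun _ : Fin (n + 1) => A) A)
  map_add' _ _ := rfl
  map_smul' _ _ := rfl

/-- The linear map sending a cochain `f` to `(a₀, …, aₙ) ↦ a₀ f (a₁, …, aₙ)`. -/
def HochschildCochain.mulLeft {n : ℕ} :
    HochschildCochain k A n →ₗ[k] HochschildCochain k A (n + 1) where
  toFun (f : MultilinearMap k (fun _ : Fin n => A) A) :=
    (MultilinearMap.mk' (fun a => a 0 * f (Fin.tail a))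
      (fun a i x y => by cases i using Fin.cases <;> simp [Ne.symm, add_mul, mul_add])
      (fun a i c x => by cases i using Fin.cases <;> simp [Ne.symm]) :
      MultilinearMap k (fun _ : Fin (n + 1) => A) A)
  map_add' _ _ := MultilinearMap.ext fun _ => mul_add _ _ _
  map_smul' _ _ := MultilinearMap.ext fun _ => mul_smul_comm _ _ _

/-- The linear map sending a cochain `f` to `(a₀, …, aₙ) ↦ f (a₀, …, aₙ₋₁) aₙ`. -/
def HochschildCochain.mulRight {n : ℕ} :
    HochschildCochain k A n →ₗ[k] HochschildCochain k A (n + 1) where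
  toFun (f : MultilinearMap k (fun _ : Fin n => A) A) :=
    (MultilinearMap.mk' (fun a => f (Fin.init a) * a (Fin.last n))
      (fun a i x y => by cases i using Fin.lastCases <;> simp [Ne.symm, add_mul, mul_add])
      (fun a i c x => by cases i using Fin.lastCases <;> simp [Ne.symm]) :
      MultilinearMap k (fun _ : Fin (n + 1) => A) A)
  map_add' _ _ := MultilinearMap.ext fun _ => add_mul _ _ _
  map_smul' _ _ := MultilinearMap.ext fun _ => smul_mul_assoc _ _ _

variable (k A)

/-- The Hochschild coboundary. -/
def hochschildD (n : ℕ) : HochschildCochain k A n →ₗ[k] HochschildCochain k A (n + 1) :=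
  HochschildCochain.mulLeft
    + ∑ r : Fin n, (-1 : k) ^ (r.val + 1) • HochschildCochain.contract r
    + (-1 : k) ^ (n + 1) • HochschildCochain.mulRight

/-- Hochschild `n`-coboundaries. -/
def hochschildB : ∀ n : ℕ, Submodule k (HochschildCochain k A n)
  | 0 => ⊥
  | n + 1 => LinearMap.range (hochschildD k A n)

/-- The `n`-th Hochschild cohomology `HHⁿ(A) = HHⁿ(A, A)`: cocycles modulo coboundaries. -/
abbrev HH (n : ℕ) : Type _ :=
  Subquotient (LinearMap.ker (hochschildD k A n)) (hochschildB k A n)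

end Hochschild

/-! ### The enveloping algebra -/

section Enveloping

open MulOpposite

variable (k : Type w) [Field k] (A : Type u) [Ring A] [Algebra k A]

/-- The enveloping algebra `A ⊗ Aᵒᵖ` of `A`. -/
def Env : Type u := A ⊗[k] Aᵐᵒᵖ

instance : Ring (Env k A) := inferInstanceAs (Ring (A ⊗[k] Aᵐᵒᵖ))

instance : Algebra k (Env k A) := inferInstanceAs (Algebra k (A ⊗[k] Aᵐᵒᵖ))

variable {A}

/-- The element `a ⊗ b` of the enveloping algebra. -/
def Env.tmul (a b : A) : Env k A := (a ⊗ₜ[k] op b : A ⊗[k] Aᵐᵒᵖ)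

variable {k}

/-- `A` as a module over its enveloping algebra: `(a ⊗ b) x = a x b`. -/
instance envModule : Module (Env k A) A :=
  (TensorProduct.Algebra.module : Module (A ⊗[k] Aᵐᵒᵖ) A)

theorem Env.tmul_smul (a b x : A) : Env.tmul k a b • x = a * x * b :=
  (TensorProduct.Algebra.smul_def a (op b) x).trans (mul_assoc a x b).symm

instance envSMulComm : SMulCommClass (Env k A) k A where
  smul_comm s c x := by
    refine TensorProduct.induction_on (motive := fun s : A ⊗[k] Aᵐᵒᵖ =>
      (show Env k A from s) • c • x = c • (show Env k A from s) • x) s ?_ ?_ ?_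
    · exact (zero_smul (Env k A) (c • x)).trans
        ((congrArg (c • ·) (zero_smul (Env k A) x)).trans (smul_zero c)).symm
    · intro a b
      have h := Env.tmul_smul (k := k) a b.unop
      exact (h (c • x)).trans (((by simp : a * c • x * b.unop = c • (a * x * b.unop))).trans
        (congrArg (c • ·) (h x)).symm)
    · intro s t hs ht
      exact (add_smul (R := Env k A) s t (c • x)).trans ((congrArg₂ (· + ·) hs ht).trans
        ((smul_add c _ _).symm.trans (congrArg (c • ·) (add_smul (R := Env k A) s t x).symm)))

end Enveloping

/-! ### Algebraic Morse theory -/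

section Morse

variable {R : Type*} [Ring R] {ι : ℕ → Type*} {C : ∀ n, ι n → Type*}
  [∀ n i, AddCommGroup (C n i)] [∀ n i, Module R (C n i)]
  (d : ∀ n (i : ι (n + 1)) (j : ι n), C (n + 1) i →ₗ[R] C n j)
  (M : ∀ n, ι (n + 1) → ι n → Prop)

/-! Here `C n i` are the summands of a chain complex in degree `n`, `d n i j` is the component of
the differential from the summand `i` to the summand `j`, and `M n i j` says that the arrow from
`(n + 1, i)` to `(n, j)` of the weighted quiver belongs to the matching `M`. -/

/-- A vertex is critical if it does not lie in an arrow of the matching. -/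
def IsCritical : ∀ n, ι n → Prop
  | 0, i => ∀ i', ¬ M 0 i' i
  | n + 1, i => (∀ i', ¬ M (n + 1) i' i) ∧ ∀ j, ¬ M n i j

/-- The thick arrows: the arrows of the weighted quiver that are not in the matching. -/
def IsThick (n : ℕ) (i : ι (n + 1)) (j : ι n) : Prop := d n i j ≠ 0 ∧ ¬ M n i j

/-- Zigzag paths from a vertex `i` of degree `n + 1` to a vertex `j` of degree `n`.  Thick arrows
(which lower the degree by one) and dotted arrows (reversed arrows of `M`, which raise the degree
by one) alternate, so such a path starts and ends with a thick arrow. -/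
inductive ZigZag (n : ℕ) : ι (n + 1) → ι n → Type _
  | thick (i : ι (n + 1)) (j : ι n) (h : IsThick d M n i j) : ZigZag n i j
  | cons (i : ι (n + 1)) (u : ι n) (i' : ι (n + 1)) (j : ι n) (h : IsThick d M n i u)
      (hm : M n i' u) (p : ZigZag n i' j) : ZigZag n i j

open Classical in
/-- The inverse of a linear map if it is bijective (and zero otherwise). -/
def inverseOrZero {X Y : Type*} [AddCommGroup X] [AddCommGroup Y] [Module R X] [Module R Y]
    (f : X →ₗ[R] Y) : Y →ₗ[R] X :=
  if h : Function.Bijective f then (LinearEquiv.ofBijective f h).symm.toLinearMap else 0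

/-- The weight of a zigzag path: the composition of the weights of its arrows, a dotted arrow
having as weight the negative inverse of the weight of the original arrow. -/
def ZigZag.weight {n : ℕ} : ∀ {i : ι (n + 1)} {j : ι n}, ZigZag d M n i j →
    (C (n + 1) i →ₗ[R] C n j)
  | _, _, .thick i j _ => d n i j
  | _, _, .cons i u i' _ _ _ p => p.weight ∘ₗ (-(inverseOrZero (d n i' u))) ∘ₗ d n i u

/-- The critical vertices of degree `n`. -/
abbrev Critical (n : ℕ) := {i : ι n // IsCritical M n i}

variable (C)

/-- The `n`-th term of the Morse complex. -/
abbrev MorseModule (n : ℕ) := DirectSum (Critical M n) fun i => C n i.1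

variable {C}

open Classical in
/-- The differential of the Morse complex: on the summand of a critical vertex `i` it is the sum,
over all critical vertices `j` one degree lower and all zigzag paths from `i` to `j`, of the
weights of these paths. -/
def morseD (n : ℕ) : MorseModule C M (n + 1) →ₗ[R] MorseModule C M n :=
  DirectSum.toModule R _ _ fun i =>
    ∑ᶠ p : (Σ j : Critical M n, ZigZag d M n i.1 j.1),
      DirectSum.lof R (Critical M n) (fun j => C n j.1) p.1 ∘ₗ p.2.weight

end Morse

/-! ### The reduced bar resolution and the two-sided Anick resolution -/

section Anick

variable {k : Type w} [Field k] {Q : Type u} [Quiver.{v} Q] [Fintype Q]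
  (I : Ideal (PathAlgebra k Q)) [I.IsTwoSided]

/-- The class of a path in `A`. -/
abbrev cls (p : QPath Q) : PathAlgebra k Q ⧸ I := Ideal.Quotient.mkₐ k I (of p)

variable [LinearOrder (QPath Q)]

/-- The indices `[w₁|⋯|wₙ]` of the summands of the `n`-th term of the reduced bar resolution:
each `wᵣ` is a path of positive length in `nonTip I`, and `w₁ ⋯ wₙ` is a path of the quiver (from
right to left).  The vertices passed are recorded as `v`; for `n = 0` an index is just a vertex. -/
@[ext] structure Cell (n : ℕ) where
  v : Fin (n + 1) → Q
  w : Fin n → QPath Q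
  target_eq : ∀ r, (w r).target = v r.castSucc
  source_eq : ∀ r, (w r).source = v r.succ
  mem : ∀ r, w r ∈ nonTip (I : Set (PathAlgebra k Q))
  pos : ∀ r, 0 < (w r).length

namespace Cell

variable {I} {n : ℕ}

/-- The idempotent `t(w₁) ⊗ s(wₙ)` of the enveloping algebra. -/
def idem (c : Cell I n) : Env k (PathAlgebra k Q ⧸ I) :=
  Env.tmul k (cls I (.vertex (c.v 0))) (cls I (.vertex (c.v (Fin.last n))))

/-- The summand `A [w₁|⋯|wₙ] A = A t(w₁) ⊗ s(wₙ) A` of the reduced bar resolution, realized as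
the left ideal of the enveloping algebra generated by the idempotent `t(w₁) ⊗ s(wₙ)`. -/
abbrev Summand (c : Cell I n) : Type _ := Submodule.span (Env k (PathAlgebra k Q ⧸ I)) ({c.idem} : Set (Env k (PathAlgebra k Q ⧸ I)))

/-- The generator `[w₁|⋯|wₙ]` of the summand. -/
def gen (c : Cell I n) : c.Summand := ⟨c.idem, Submodule.mem_span_singleton_self _⟩

/-- The product `w₁ ⋯ wₙ` in the path algebra. -/
def total (c : Cell I n) : PathAlgebra k Q :=
  of (.vertex (c.v 0)) * (List.ofFn fun r => (of (c.w r) : PathAlgebra k Q)).prod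

/-- The linear map between two summands that sends the generator `[c]` to `x [c']`, where `x` is
an element of the enveloping algebra (multiplied by the idempotents of both summands). -/
def mapTo {m : ℕ} (c : Cell I n) (c' : Cell I m) (x : Env k (PathAlgebra k Q ⧸ I)) : c.Summand →ₗ[Env k (PathAlgebra k Q ⧸ I)] c'.Summand where
  toFun y := ⟨y.1 * x * c'.idem, Submodule.mem_span_singleton.2 ⟨y.1 * x, rfl⟩⟩
  map_add' y z := by ext; simp [add_mul]
  map_smul' a y := by ext; simp [mul_assoc]

end Cell

variable [WellFoundedLT (QPath Q)]

open Classical in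
/-- The coefficient (in the enveloping algebra) of `[c']` in the differential
`a₁[a₂|⋯|aₙ₊₁] + ∑ (-1)ʳ [a₁|⋯|aᵣaᵣ₊₁|⋯|aₙ₊₁] + (-1)ⁿ⁺¹ [a₁|⋯|aₙ]aₙ₊₁` of the generator
`c = [a₁|⋯|aₙ₊₁]` of the reduced bar resolution; the products `aᵣaᵣ₊₁` in `A` are expanded in the
monomial basis. -/
def barCoeff (n : ℕ) (c : Cell I (n + 1)) (c' : Cell I n) : Env k (PathAlgebra k Q ⧸ I) :=
  (if c'.v = Fin.tail c.v ∧ c'.w = Fin.tail c.w then Env.tmul k (cls I (c.w 0)) 1 else 0)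
  + ∑ r : Fin n, (-1 : k) ^ (r.val + 1) •
      ((monomialBasis I).repr (cls I (c.w r.castSucc) * cls I (c.w r.succ))).sum (fun b x =>
        if c'.w = Fin.contractNth r.castSucc (fun _ _ => b.1) c.w then x • (1 : Env k (PathAlgebra k Q ⧸ I)) else 0)
  + (-1 : k) ^ (n + 1) •
    (if c'.v = Fin.init c.v ∧ c'.w = Fin.init c.w then
      Env.tmul k 1 (cls I (c.w (Fin.last n))) else 0)

/-- The components of the differential of the reduced bar resolution. -/
def barD (n : ℕ) (c : Cell I (n + 1)) (c' : Cell I n) : c.Summand →ₗ[Env k (PathAlgebra k Q ⧸ I)] c'.Summand :=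
  c.mapTo c' (barCoeff I n c c')

variable (G : Set (PathAlgebra k Q))

/-- The vertices of the Ufnarovskii graph: vertices and arrows of the quiver, and proper right
factors of tips of elements of `G`. -/
def UfVertex (u : QPath Q) : Prop :=
  u.length = 0 ∨ u.length = 1 ∨
    ∃ t ∈ tipSet G, ∃ q : QPath Q, 0 < q.length ∧ QPath.mul? q u = some t

/-- The arrows of the Ufnarovskii graph. -/
def UfEdge (x y : QPath Q) : Prop :=
  UfVertex G x ∧ UfVertex G y ∧
    ((x.length = 0 ∧ y.length = 1 ∧ QPath.mul? x y = some y) ∨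
      ∃ z, QPath.mul? x y = some z ∧ of z ∈ tipIdeal G ∧
        ∀ a p, QPath.mul? a p = some z → 1 ≤ p.length → of a ∉ tipIdeal G)

/-- The first `m` entries of `[w₁|⋯|wₙ]` form an `(m - 1)`-chain: `e → w₁ → ⋯ → wₘ` is a path in
the Ufnarovskii graph. -/
def Cell.IsChain {n : ℕ} (c : Cell I n) (m : ℕ) : Prop :=
  (∀ h : 0 < n, 0 < m → UfEdge G (.vertex (c.v 0)) (c.w ⟨0, h⟩)) ∧
  ∀ (r : ℕ) (h : r + 1 < n), r + 1 < m → UfEdge G (c.w ⟨r, by omega⟩) (c.w ⟨r + 1, h⟩)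

/-- The first `m` entries form an `(m - 1)`-chain but the first `m + 1` entries do not form an
`m`-chain. -/
def Cell.InV {n : ℕ} (c : Cell I n) (m : ℕ) : Prop :=
  m < n ∧ c.IsChain I G m ∧ ¬ c.IsChain I G (m + 1)

/-- The matching on the reduced bar resolution: `[w₁|⋯|w'|w''|⋯|wₙ]` is matched with
`[w₁|⋯|w'w''|⋯|wₙ]`, where `w'` and `w''` are the entries number `m + 1` and `m + 2`, if the first
one has the first `m + 1` entries as its longest initial chain, and the second one the first `m`. -/
def anickMatching (n : ℕ) (c : Cell I (n + 1)) (c' : Cell I n) : Prop :=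
  ∃ m : Fin n, c.InV I G (m.val + 1) ∧ c'.InV I G m.val ∧
    ∃ b, QPath.mul? (c.w m.castSucc) (c.w m.succ) = some b ∧
      c'.w = Fin.contractNth m.castSucc (fun _ _ => b) c.w

/-- The critical cells of degree `n`, which index the summands of the `n`-th term of the two-sided
Anick resolution. -/
abbrev AnickCell (n : ℕ) : Type _ := Critical (anickMatching I G) n

/-- The `n`-th term of the two-sided Anick resolution of `A`: the Morse complex of the reduced bar
resolution with respect to the matching above. -/
abbrev AnickModule (n : ℕ) : Type _ :=
  MorseModule (fun m (c : Cell I m) => c.Summand) (anickMatching I G) n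

/-- The differential of the two-sided Anick resolution of `A`. -/
def anickD (n : ℕ) : AnickModule I G (n + 1) →ₗ[Env k (PathAlgebra k Q ⧸ I)] AnickModule I G n :=
  morseD (barD I) (anickMatching I G) n

open Classical in
/-- The generator of the two-sided Anick resolution that belongs to a critical cell. -/
def anickGen (n : ℕ) (c : AnickCell I G n) : AnickModule I G n :=
  DirectSum.lof (Env k (PathAlgebra k Q ⧸ I)) (AnickCell I G n) (fun c => c.1.Summand) c c.1.gen

/-- The `n`-th term of the cochain complex obtained by applying `Hom(-, A)` over the enveloping
algebra to the two-sided Anick resolution. -/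
abbrev AnickCochain (n : ℕ) : Type _ := AnickModule I G n →ₗ[Env k (PathAlgebra k Q ⧸ I)] (PathAlgebra k Q ⧸ I)

/-- The coboundary of this cochain complex. -/
def anickDelta (n : ℕ) : AnickCochain I G n →ₗ[k] AnickCochain I G (n + 1) where
  toFun f := f ∘ₗ anickD I G n
  map_add' _ _ := LinearMap.add_comp _ _ _
  map_smul' _ _ := LinearMap.smul_comp _ _ _

end Anick

/-! ### Parallel paths and the maps `ψ₀`, `ψ₁` -/

section ParallelPaths

variable {k : Type w} [Field k] {Q : Type u} [Quiver.{v} Q]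

/-- The set `X // Y` of pairs of parallel paths. -/
def parallel (X Y : Set (QPath Q)) : Set (QPath Q × QPath Q) :=
  {x | x.1 ∈ X ∧ x.2 ∈ Y ∧ x.1.source = x.2.source ∧ x.1.target = x.2.target}

/-- The set of paths of length `n`. -/
def pathsOfLength (Q : Type u) [Quiver.{v} Q] (n : ℕ) : Set (QPath Q) := {p | p.length = n}

variable (k)

/-- The vector space `k(X // Y)`. -/
abbrev ParallelSpace (X Y : Set (QPath Q)) : Type _ := parallel X Y →₀ k

variable {k}

open Classical in
/-- `p^(α, γ)`: the sum of all paths obtained by replacing one appearance of the arrow `α` in the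
path `p` by the path `γ`. -/
def substPath (α γ : QPath Q) : ∀ {a b : Q}, Quiver.Path a b → PathAlgebra k Q
  | _, _, .nil => 0
  | _, _, .cons p x =>
      of (.arrow x) * substPath α γ p + if QPath.arrow x = α then of γ * of ⟨_, _, p⟩ else 0

variable [Fintype Q] [LinearOrder (QPath Q)] [WellFoundedLT (QPath Q)]
  (I : Ideal (PathAlgebra k Q)) [I.IsTwoSided]

/-- The set `𝓑` of paths that represent the monomial basis of `A`. -/
abbrev basisPaths : Set (QPath Q) := nonTip (I : Set (PathAlgebra k Q))

open Classical in
/-- The element `(x, a)` of `k(X // 𝓑)`, where `x` is a path in `X` and `a = ∑ λᵢ bᵢ` is a linear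
combination of elements of the basis parallel to `x`: it is `∑ λᵢ (x, bᵢ)`. -/
def pairing (X : Set (QPath Q)) (x : QPath Q) (a : PathAlgebra k Q ⧸ I) :
    ParallelSpace k X (basisPaths I) :=
  ((monomialBasis I).repr a).sum fun b c =>
    if h : (x, b.1) ∈ parallel X (basisPaths I) then Finsupp.single ⟨(x, b.1), h⟩ c else 0

variable [∀ a b : Q, Fintype (a ⟶ b)]

/-- `ψ₀ (e, γ) = ∑_{α ∈ Q₁e} (α, π(αγ)) - ∑_{β ∈ eQ₁} (β, π(γβ))`. -/
def psi0 : ParallelSpace k (pathsOfLength Q 0) (basisPaths I) →ₗ[k]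
    ParallelSpace k (pathsOfLength Q 1) (basisPaths I) :=
  Finsupp.linearCombination k fun x =>
    (∑ b : Q, ∑ α : (x.1.1.source ⟶ b), pairing I (pathsOfLength Q 1) (.arrow α)
      (Ideal.Quotient.mkₐ k I (of (.arrow α) * of x.1.2)))
    - ∑ a : Q, ∑ β : (a ⟶ x.1.1.source), pairing I (pathsOfLength Q 1) (.arrow β)
      (Ideal.Quotient.mkₐ k I (of x.1.2 * of (.arrow β)))

open Classical in
/-- `ψ₁ (α, γ) = ∑_{g ∈ G} ∑_{p ∈ Supp g} c_g(p) (Tip g, π(p^(α, γ)))`, where `c_g(p)` is the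
coefficient of `p` in `g`. -/
def psi1 (G : Finset (PathAlgebra k Q)) :
    ParallelSpace k (pathsOfLength Q 1) (basisPaths I) →ₗ[k]
      ParallelSpace k (tipSet (G : Set (PathAlgebra k Q))) (basisPaths I) :=
  Finsupp.linearCombination k fun x =>
    ∑ g ∈ G, if hg : g ≠ 0 then
      ∑ p ∈ (coeff g).support, coeff g p •
        pairing I (tipSet (G : Set (PathAlgebra k Q))) (tip g hg)
          (Ideal.Quotient.mkₐ k I (substPath x.1.1 x.1.2 p.path))
    else 0

end ParallelPaths

end QuiverHH

end

/-!
Both halves of the statement come from the same observation: an element of `k(Q₁ // 𝓑)` is a family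
`θ` of elements `θ(α) ∈ t(α) A s(α)`, one for each arrow `α`, and such a family is the same as a
derivation `D : kQ → A` that vanishes on the vertices (`pathDeriv`).  In this language (`family`
translates an element of `k(X // 𝓑)` into a family of elements of `A`):

* `ψ₀` sends a diagonal element `z = ∑ₑ xₑ`, `xₑ ∈ e A e`, to the inner derivation
  `a ↦ a z - z a` (`family_psi0_eq_inner`);
* the component of `ψ₁ θ` at `Tip(g)` is `D(g)` (`family_psi1`); no information is lost here because
  the elements of a reduced Gröbner basis are uniform (`IsReducedGroebnerBasis.parallel_tip`).

Hence `ψ₁ ψ₀ = 0`, since an inner derivation vanishes on the ideal.  The kernel of `ψ₁` consists of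
the derivations that vanish on the Gröbner basis, so on `I` (`pathDeriv_eq_zero_of_mem`), that is, of
the derivations of `A` that vanish on vertices.  Every derivation of `A` becomes one of these after
an inner derivation is subtracted (`exists_derivationCochain_sub_mem`), which gives `HH¹`; and `HH⁰`
is the centre of `A`, which consists of diagonal elements.

For the Anick resolution, the critical cells of degree two are the `[a|p]` with `a` an arrow and
`a p ∈ Tip(G)` (`isCritical_two_iff`), and the cells of degree one are matched by
`[a|p] ↦ [a p]` (`anickMatching_one_iff`).  A zigzag path that arrives at a cell `[a₁ ⋯ aₙ]` goes back
to `[a₁|a₂ ⋯ aₙ]`, and then on to `[a₁]`, where it ends, or to `[a₂ ⋯ aₙ]`.  By induction on `n` the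
zigzag paths that arrive at `[a₁ ⋯ aₙ]` contribute `∑ᵢ a₁ ⋯ aᵢ₋₁ [aᵢ] aᵢ₊₁ ⋯ aₙ`, and a cochain with
values `θ(α)` on the arrows sends this to `D(a₁ ⋯ aₙ)` (`hasZigZagSum_of_matching`).  Since the normal
form of `Tip(g)` is `Tip(g) - g`, the value of the coboundary at the generator of `Tip(g)` is
`D(Tip(g)) - D(Tip(g) - g) = D(g)` (`anickDelta_one_apply`).
-/

set_option linter.unusedSectionVars false

noncomputable section

open scoped TensorProduct

namespace QuiverHH

/-! ### Paths and their factorizations -/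

namespace QPath

variable {Q : Type*} [Quiver Q]

@[simp] theorem mul?_mk {a b c : Q} (p : Quiver.Path b c) (q : Quiver.Path a b) :
    mul? ⟨b, c, p⟩ ⟨a, b, q⟩ = some ⟨a, c, q.comp p⟩ := by
  simp [mul?]

theorem mul?_eq_some {p q r : QPath Q} (h : mul? p q = some r) :
    ∃ (a b c : Q) (x : Quiver.Path b c) (y : Quiver.Path a b),
      p = ⟨b, c, x⟩ ∧ q = ⟨a, b, y⟩ ∧ r = ⟨a, c, y.comp x⟩ := by
  obtain ⟨b, c, x⟩ := p
  obtain ⟨a, b', y⟩ := q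
  by_cases hb : b' = b
  · subst hb
    rw [mul?_mk] at h
    exact ⟨a, b', c, x, y, rfl, rfl, (Option.some.inj h).symm⟩
  · simp [mul?, hb] at h

theorem exists_mul? {p q : QPath Q} (h : q.target = p.source) : ∃ r, mul? p q = some r :=
  ⟨_, dif_pos h⟩

theorem length_mul? {p q r : QPath Q} (h : mul? p q = some r) :
    r.length = p.length + q.length := by
  obtain ⟨a, b, c, x, y, rfl, rfl, rfl⟩ := mul?_eq_some h
  simp [length, add_comm]

theorem source_mul? {p q r : QPath Q} (h : mul? p q = some r) : r.source = q.source := by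
  obtain ⟨a, b, c, x, y, rfl, rfl, rfl⟩ := mul?_eq_some h
  rfl

theorem target_mul? {p q r : QPath Q} (h : mul? p q = some r) : r.target = p.target := by
  obtain ⟨a, b, c, x, y, rfl, rfl, rfl⟩ := mul?_eq_some h
  rfl

theorem mul?_match {p q r : QPath Q} (h : mul? p q = some r) : q.target = p.source := by
  obtain ⟨a, b, c, x, y, rfl, rfl, rfl⟩ := mul?_eq_some h
  rfl

/-- Two factorizations of the same path with left factors of the same length agree. -/
theorem mul?_unique {p q p' q' r : QPath Q} (h : mul? p q = some r) (h' : mul? p' q' = some r)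
    (hl : p.length = p'.length) : p = p' ∧ q = q' := by
  have e1 := length_mul? h
  have e2 := length_mul? h'
  obtain ⟨a, b, c, x, y, rfl, rfl, rfl⟩ := mul?_eq_some h
  obtain ⟨a', b', c', x', y', rfl, rfl, hr⟩ := mul?_eq_some h'
  have ha : a = a' := congrArg source hr
  have hc : c = c' := congrArg target hr
  subst ha hc
  have hp : y.comp x = y'.comp x' := by simpa using hr
  have hy : y.length = y'.length := by
    simp only [length] at hl e1 e2
    omega
  have hbb : b = b' := by
    clear hl e1 e2 hr h h'
    induction x with
    | nil =>
      have : x'.length = 0 := by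
        have := congrArg Quiver.Path.length hp
        simp only [Quiver.Path.length_comp, Quiver.Path.length_nil] at this
        omega
      exact (Quiver.Path.eq_of_length_zero _ this).symm
    | cons x e ih =>
      cases x' with
      | nil =>
        have := congrArg Quiver.Path.length hp
        simp only [Quiver.Path.length_comp, Quiver.Path.length_nil,
          Quiver.Path.length_cons] at this
        omega
      | cons x' e' =>
        have h1 := Quiver.Path.obj_eq_of_cons_eq_cons hp
        subst h1
        exact ih x' (eq_of_heq (Quiver.Path.heq_of_cons_eq_cons hp))
  subst hbb
  obtain ⟨rfl, rfl⟩ := (Quiver.Path.comp_inj' hy).1 hp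
  exact ⟨rfl, rfl⟩

theorem mul?_left_cancel {p q q' r : QPath Q} (h : mul? p q = some r) (h' : mul? p q' = some r) :
    q = q' :=
  (mul?_unique h h' rfl).2

theorem mul?_right_cancel {p p' q r : QPath Q} (h : mul? p q = some r)
    (h' : mul? p' q = some r) : p = p' := by
  refine (mul?_unique h h' ?_).1
  have := length_mul? h
  have := length_mul? h'
  omega

theorem assoc_right {p q r pq x : QPath Q} (h : mul? p q = some pq) (h' : mul? pq r = some x) :
    ∃ qr, mul? q r = some qr ∧ mul? p qr = some x := by
  have := mul?_assoc p q r
  rw [h] at this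
  simp only [Option.bind_some, h'] at this
  exact Option.bind_eq_some_iff.1 this.symm

theorem assoc_left {p q r qr x : QPath Q} (h : mul? q r = some qr) (h' : mul? p qr = some x) :
    ∃ pq, mul? p q = some pq ∧ mul? pq r = some x := by
  have := mul?_assoc p q r
  rw [h] at this
  simp only [Option.bind_some, h'] at this
  exact Option.bind_eq_some_iff.1 this

theorem exists_split (r : QPath Q) (n : ℕ) (h : n ≤ r.length) :
    ∃ p q, mul? p q = some r ∧ p.length = n := by
  obtain ⟨a, c, x⟩ := r
  induction x generalizing n with
  | nil =>
    have : n = 0 := by simpa [length] using h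
    exact ⟨vertex a, vertex a, by simp [vertex], by simp [this, vertex, length]⟩
  | @cons b c x e ih =>
    rcases n with _ | n
    · exact ⟨vertex c, ⟨a, c, x.cons e⟩, by simp [vertex], by simp [vertex, length]⟩
    · obtain ⟨p, q, hpq, hl⟩ := ih n (by simpa [length] using h)
      obtain ⟨a', b', c', u, v, rfl, rfl, hx⟩ := mul?_eq_some hpq
      cases hx
      refine ⟨⟨b', c, u.cons e⟩, ⟨a, b', v⟩, by simp, ?_⟩
      simpa [length] using hl

/-- Of two left factors of a path the shorter one is a left factor of the longer one. -/
theorem left_factor_of_le {a b a' b' r : QPath Q} (h : mul? a b = some r)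
    (h' : mul? a' b' = some r) (hl : a.length ≤ a'.length) :
    ∃ c, mul? a c = some a' ∧ mul? c b' = some b := by
  obtain ⟨a₁, c, hc, hl'⟩ := exists_split a' a.length hl
  obtain ⟨d, hd, hd'⟩ := assoc_right hc h'
  obtain ⟨rfl, rfl⟩ := mul?_unique hd' h hl'
  exact ⟨c, hc, hd⟩

theorem vertex_target_mul? (p : QPath Q) : mul? (vertex p.target) p = some p := by
  simp [vertex_mul?]

theorem mul?_vertex_source (p : QPath Q) : mul? p (vertex p.source) = some p := by
  simp [mul?_vertex]

theorem exists_vertex_of_length_zero {p : QPath Q} (h : p.length = 0) : p = vertex p.source := by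
  obtain ⟨a, b, x⟩ := p
  cases x with
  | nil => rfl
  | cons x e => simp [length] at h

theorem exists_arrow_of_length_one {p : QPath Q} (h : p.length = 1) :
    ∃ (a b : Q) (x : a ⟶ b), p = arrow x := by
  obtain ⟨a, b, x⟩ := p
  cases x with
  | nil => simp [length] at h
  | cons x e =>
    have : x.length = 0 := by simpa [length] using h
    cases x with
    | nil => exact ⟨_, _, e, rfl⟩
    | cons => simp at this

theorem divides_refl (p : QPath Q) : p.Divides p :=
  ⟨vertex p.target, vertex p.source, p, vertex_target_mul? p, mul?_vertex_source p⟩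

theorem divides_of_mul?_left {p q r : QPath Q} (h : mul? p q = some r) : q.Divides r :=
  ⟨p, vertex r.source, r, h, mul?_vertex_source r⟩

theorem divides_of_mul?_right {p q r : QPath Q} (h : mul? p q = some r) : p.Divides r :=
  ⟨vertex p.target, q, p, vertex_target_mul? p, h⟩

theorem Divides.trans {p q r : QPath Q} (h : p.Divides q) (h' : q.Divides r) : p.Divides r := by
  obtain ⟨a, b, c, hc, hq⟩ := h
  obtain ⟨a', b', c', hc', hr⟩ := h'
  obtain ⟨x, hx, hx'⟩ := assoc_left hq hc'
  obtain ⟨y, hy, hy'⟩ := assoc_right hx' hr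
  obtain ⟨z, hz, hz'⟩ := assoc_left hc hx
  exact ⟨z, y, x, hz', hy'⟩

theorem Divides.length_le {p q : QPath Q} (h : p.Divides q) : p.length ≤ q.length := by
  obtain ⟨a, b, c, hc, hq⟩ := h
  have := length_mul? hc
  have := length_mul? hq
  omega

end QPath

/-! ### Coefficients of products and tips -/

namespace PathAlgebra

variable {k : Type*} [Field k] {Q : Type*} [Quiver Q]

theorem coeff_of (p : QPath Q) : coeff (of p : PathAlgebra k Q) = Finsupp.single p 1 := by
  simp [of]

theorem of_mul_of_some {p q r : QPath Q} (h : QPath.mul? p q = some r) :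
    (of p * of q : PathAlgebra k Q) = of r := by
  rw [of_mul_of, h, ofOption]

theorem of_mul_of_none {p q : QPath Q} (h : q.target ≠ p.source) :
    (of p * of q : PathAlgebra k Q) = 0 := by
  rw [of_mul_of, QPath.mul?, dif_neg h, ofOption]

theorem eq_sum_coeff (f : PathAlgebra k Q) : f = ∑ q ∈ (coeff f).support, coeff f q • of q := by
  apply coeff.injective
  rw [map_sum]
  conv_lhs => rw [← Finsupp.sum_single (coeff f)]
  refine Finset.sum_congr rfl fun p _ => ?_
  rw [map_smul, of]
  simp

theorem exists_of_coeff_mul_ne_zero {f g : PathAlgebra k Q} {r : QPath Q}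
    (h : coeff (f * g) r ≠ 0) :
    ∃ p q, coeff f p ≠ 0 ∧ coeff g q ≠ 0 ∧ QPath.mul? p q = some r := by
  by_contra! hcon
  apply h
  have hs : f * g = ∑ p ∈ (coeff f).support, ∑ q ∈ (coeff g).support,
      (coeff f p * coeff g q) • (of p * of q) := by
    rw [mul_def]
    conv_lhs => rw [eq_sum_coeff f, eq_sum_coeff g]
    simp only [map_sum, map_smul, LinearMap.sum_apply, LinearMap.smul_apply, Finset.smul_sum,
      smul_smul, mul_def]
    rw [Finset.sum_comm]
    exact Finset.sum_congr rfl fun p _ => Finset.sum_congr rfl fun q _ => by rw [mul_comm]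
  rw [hs, map_sum, Finsupp.finsetSum_apply]
  refine Finset.sum_eq_zero fun p hp => ?_
  rw [map_sum, Finsupp.finsetSum_apply]
  refine Finset.sum_eq_zero fun q hq => ?_
  have := hcon p q (Finsupp.mem_support_iff.1 hp) (Finsupp.mem_support_iff.1 hq)
  rw [map_smul, of_mul_of]
  rcases hm : QPath.mul? p q with _ | s
  · simp [ofOption]
  · have : s ≠ r := fun e => this (by rw [hm, e])
    simp [ofOption, coeff_of, this]

theorem coeff_of_mul {a p q : QPath Q} (h : QPath.mul? a p = some q) (f : PathAlgebra k Q) :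
    coeff (of a * f) q = coeff f p := by
  have : (Finsupp.lapply q ∘ₗ coeff.toLinearMap ∘ₗ mulₗ (of a) : PathAlgebra k Q →ₗ[k] k) =
      Finsupp.lapply p ∘ₗ coeff.toLinearMap := by
    refine linearMap_ext fun r => ?_
    change coeff (of a * of r) q = coeff (of r) p
    rw [of_mul_of, coeff_of]
    rcases hm : QPath.mul? a r with _ | s
    · have : r ≠ p := by rintro rfl; simp [h] at hm
      simp [ofOption, this]
    · by_cases hr : r = p
      · subst hr
        rw [h] at hm
        cases hm
        simp [ofOption, coeff_of]
      · have : s ≠ q := by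
          rintro rfl
          exact hr (QPath.mul?_left_cancel hm h)
        simp [ofOption, coeff_of, this, hr]
  exact congrArg (fun F => F f) this

theorem coeff_mul_of {b p q : QPath Q} (h : QPath.mul? p b = some q) (f : PathAlgebra k Q) :
    coeff (f * of b) q = coeff f p := by
  have : (Finsupp.lapply q ∘ₗ coeff.toLinearMap ∘ₗ mulₗ.flip (of b) : PathAlgebra k Q →ₗ[k] k) =
      Finsupp.lapply p ∘ₗ coeff.toLinearMap := by
    refine linearMap_ext fun r => ?_
    change coeff (of r * of b) q = coeff (of r) p
    rw [of_mul_of, coeff_of]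
    rcases hm : QPath.mul? r b with _ | s
    · have : r ≠ p := by rintro rfl; simp [h] at hm
      simp [ofOption, this]
    · by_cases hr : r = p
      · subst hr
        rw [h] at hm
        cases hm
        simp [ofOption, coeff_of]
      · have : s ≠ q := by
          rintro rfl
          exact hr (QPath.mul?_right_cancel hm h)
        simp [ofOption, coeff_of, this, hr]
  exact congrArg (fun F => F f) this

end PathAlgebra

open PathAlgebra

section Tips

variable {k : Type*} [Field k] {Q : Type*} [Quiver Q] [LinearOrder (QPath Q)]
  [Fintype Q]

theorem tip_eq {f : PathAlgebra k Q} (hf : f ≠ 0) {p : QPath Q} (h : coeff f p ≠ 0)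
    (h' : ∀ q, coeff f q ≠ 0 → q ≤ p) : tip f hf = p :=
  le_antisymm (h' _ (coeff_tip_ne_zero hf)) (le_tip hf h)

/-- The tip of `a f b`, for paths `a` and `b`, is `a Tip(f) b` if this is a path. -/
theorem exists_tip_mul (hadm : IsAdmissibleOrder Q) {f : PathAlgebra k Q} (hf : f ≠ 0)
    {a b c p : QPath Q} (hc : QPath.mul? a (tip f hf) = some c) (hp : QPath.mul? c b = some p) :
    ∃ h : of a * f * of b ≠ 0, tip (of a * f * of b) h = p := by
  have h1 : coeff (of a * f * of b) p = coeff f (tip f hf) := by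
    rw [coeff_mul_of hp, coeff_of_mul hc]
  have h2 : coeff (of a * f * of b) p ≠ 0 := by
    rw [h1]
    exact coeff_tip_ne_zero hf
  refine ⟨fun h0 => h2 (by rw [h0]; simp), tip_eq _ h2 fun q hq => ?_⟩
  obtain ⟨x, y, hx, hy, hxy⟩ := exists_of_coeff_mul_ne_zero hq
  obtain ⟨u, v, hu, hv, huv⟩ := exists_of_coeff_mul_ne_zero hx
  have : u = a := by
    by_contra hne
    exact hu (by rw [coeff_of, Finsupp.single_eq_of_ne hne])
  subst this
  have : y = b := by
    by_contra hne
    exact hy (by rw [coeff_of, Finsupp.single_eq_of_ne hne])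
  subst this
  rcases (le_tip hf hv).lt_or_eq with h | h
  · exact (hadm.mul_right _ _ _ _ _ (hadm.mul_left _ _ _ _ _ h huv hc) hxy hp).le
  · subst h
    rw [hc] at huv
    cases huv
    rw [hp] at hxy
    cases hxy
    exact le_rfl

theorem tipSet_of_divides (hadm : IsAdmissibleOrder Q) {I : Ideal (PathAlgebra k Q)}
    [I.IsTwoSided] {p q : QPath Q} (hp : p ∈ tipSet (I : Set (PathAlgebra k Q)))
    (h : p.Divides q) : q ∈ tipSet (I : Set (PathAlgebra k Q)) := by
  obtain ⟨f, hfI, hf, rfl⟩ := hp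
  obtain ⟨a, b, c, hc, hq⟩ := h
  obtain ⟨h0, ht⟩ := exists_tip_mul hadm hf hc hq
  exact ⟨_, I.mul_mem_right _ (I.mul_mem_left _ hfI), h0, ht⟩

theorem of_mem_tipIdeal {S : Set (PathAlgebra k Q)} {p : QPath Q} :
    of p ∈ tipIdeal S ↔ ∃ t ∈ tipSet S, t.Divides p := by
  constructor
  · intro h
    have key : ∀ f ∈ tipIdeal S, ∀ q, coeff f q ≠ 0 → ∃ t ∈ tipSet S, t.Divides q := by
      intro f hf
      refine TwoSidedIdeal.span_induction (p := fun f _ => ∀ q, coeff f q ≠ 0 →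
        ∃ t ∈ tipSet S, t.Divides q) ?_ ?_ ?_ ?_ ?_ ?_ hf
      · rintro _ ⟨t, ht, rfl⟩ q hq
        have : q = t := by
          by_contra hne
          exact hq (by rw [coeff_of, Finsupp.single_eq_of_ne hne])
        exact ⟨t, ht, this ▸ QPath.divides_refl t⟩
      · intro q hq
        simp at hq
      · intro f g _ _ hf hg q hq
        by_cases h1 : coeff f q = 0
        · exact hg q fun h2 => hq (by simp [h1, h2])
        · exact hf q h1
      · intro f _ hf q hq
        exact hf q (by simpa using hq)
      · intro a f _ hf q hq
        obtain ⟨u, v, hu, hv, huv⟩ := exists_of_coeff_mul_ne_zero hq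
        obtain ⟨t, ht, hd⟩ := hf v hv
        exact ⟨t, ht, hd.trans (QPath.divides_of_mul?_left huv)⟩
      · intro f b _ hf q hq
        obtain ⟨u, v, hu, hv, huv⟩ := exists_of_coeff_mul_ne_zero hq
        obtain ⟨t, ht, hd⟩ := hf u hu
        exact ⟨t, ht, hd.trans (QPath.divides_of_mul?_right huv)⟩
    exact key _ h p (by simp [coeff_of])
  · rintro ⟨t, ht, a, b, c, hc, hp⟩
    rw [← of_mul_of_some hp, ← of_mul_of_some hc]
    exact TwoSidedIdeal.mul_mem_right _ _ _ (TwoSidedIdeal.mul_mem_left _ _ _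
      (TwoSidedIdeal.subset_span ⟨t, ht, rfl⟩))

end Tips

/-! ### Reduced Gröbner bases -/

namespace IsReducedGroebnerBasis

variable {k : Type*} [Field k] {Q : Type*} [Quiver Q] [LinearOrder (QPath Q)] [Fintype Q]
  {I : Ideal (PathAlgebra k Q)} [I.IsTwoSided] {G : Set (PathAlgebra k Q)}

theorem mem_tipIdeal_iff (hG : IsReducedGroebnerBasis I G) (hadm : IsAdmissibleOrder Q)
    {p : QPath Q} : of p ∈ tipIdeal G ↔ p ∈ tipSet (I : Set (PathAlgebra k Q)) := by
  rw [← hG.tipIdeal_eq, of_mem_tipIdeal]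
  exact ⟨fun ⟨t, ht, hd⟩ => tipSet_of_divides hadm ht hd,
    fun h => ⟨p, h, QPath.divides_refl p⟩⟩

theorem exists_tip_divides (hG : IsReducedGroebnerBasis I G) {p : QPath Q}
    (hp : p ∈ tipSet (I : Set (PathAlgebra k Q))) : ∃ t ∈ tipSet G, t.Divides p := by
  rw [← of_mem_tipIdeal, ← hG.tipIdeal_eq, of_mem_tipIdeal]
  exact ⟨p, hp, QPath.divides_refl p⟩

theorem tipSet_subset (hG : IsReducedGroebnerBasis I G) :
    tipSet G ⊆ tipSet (I : Set (PathAlgebra k Q)) :=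
  fun _ ⟨f, hf, h⟩ => ⟨f, hG.subset hf, h⟩

theorem eq_of_divides (hG : IsReducedGroebnerBasis I G) {s t : QPath Q} (hs : s ∈ tipSet G)
    (ht : t ∈ tipSet G) (h : s.Divides t) : s = t := by
  obtain ⟨f, hf, hf0, rfl⟩ := hs
  obtain ⟨g, hg, hg0, rfl⟩ := ht
  by_cases hfg : f = g
  · subst hfg
    rfl
  · exact absurd h (hG.tip_reduced f hf g hg hfg hf0 hg0)

theorem eq_of_tip_eq (hG : IsReducedGroebnerBasis I G) {f g : PathAlgebra k Q} (hf : f ∈ G)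
    (hg : g ∈ G) (hf0 : f ≠ 0) (hg0 : g ≠ 0) (h : tip f hf0 = tip g hg0) : f = g := by
  by_contra hfg
  exact hG.tip_reduced f hf g hg hfg hf0 hg0 (h ▸ QPath.divides_refl _)

theorem ne_zero (hG : IsReducedGroebnerBasis I G) {g : PathAlgebra k Q} (hg : g ∈ G) : g ≠ 0 :=
  (hG.monic g hg).1

/-- Proper divisors of the tips of a reduced Gröbner basis are not tips of elements of the
ideal. -/
theorem nonTip_of_divides (hG : IsReducedGroebnerBasis I G) {p t : QPath Q} (ht : t ∈ tipSet G)
    (h : p.Divides t) (hl : p.length < t.length) : p ∈ nonTip (I : Set (PathAlgebra k Q)) := by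
  intro hp
  obtain ⟨s, hs, hd⟩ := hG.exists_tip_divides hp
  have := hG.eq_of_divides hs ht (hd.trans h)
  subst this
  exact absurd hd.length_le (by omega)

theorem mem_nonTip_of_coeff (hG : IsReducedGroebnerBasis I G) {g : PathAlgebra k Q} (hg : g ∈ G)
    {p : QPath Q} (hp : coeff g p ≠ 0) (hne : p ≠ tip g (hG.ne_zero hg)) :
    p ∈ nonTip (I : Set (PathAlgebra k Q)) := by
  have h := hG.reduced g hg (hG.ne_zero hg)
  have key : ∀ f ∈ Submodule.span k ((of : _ → PathAlgebra k Q) '' nonTip (I : Set (PathAlgebra k Q))),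
      ∀ q, coeff f q ≠ 0 → q ∈ nonTip (I : Set (PathAlgebra k Q)) := by
    intro f hf
    refine Submodule.span_induction (p := fun f _ => ∀ q, coeff f q ≠ 0 →
      q ∈ nonTip (I : Set (PathAlgebra k Q))) ?_ ?_ ?_ ?_ hf
    · rintro _ ⟨t, ht, rfl⟩ q hq
      have : q = t := by
        by_contra hne
        exact hq (by rw [coeff_of, Finsupp.single_eq_of_ne hne])
      exact this ▸ ht
    · intro q hq
      simp at hq
    · intro f g _ _ hf hg q hq
      by_cases h1 : coeff f q = 0
      · exact hg q fun h2 => hq (by simp [h1, h2])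
      · exact hf q h1
    · intro c f _ hf q hq
      exact hf q fun h0 => hq (by simp [h0])
  refine key _ h p ?_
  rw [map_sub, coeff_of, Finsupp.sub_apply, Finsupp.single_eq_of_ne hne, sub_zero]
  exact hp

/-- The elements of a reduced Gröbner basis are uniform: all paths of the support are parallel to
the tip.  Otherwise `g - e g f`, with `e` and `f` the vertices at the ends of the tip of `g`, is a
nonzero element of the ideal without any tip in its support. -/
theorem parallel_tip (hG : IsReducedGroebnerBasis I G) {g : PathAlgebra k Q} (hg : g ∈ G)
    {p : QPath Q} (hp : coeff g p ≠ 0) :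
    p.source = (tip g (hG.ne_zero hg)).source ∧ p.target = (tip g (hG.ne_zero hg)).target := by
  set t := tip g (hG.ne_zero hg) with ht
  set h : PathAlgebra k Q := g - of (.vertex t.target) * g * of (.vertex t.source) with hh
  have hI : h ∈ I := I.sub_mem (hG.subset hg)
    (I.mul_mem_right _ (I.mul_mem_left _ (hG.subset hg)))
  have hpar : ∀ q : QPath Q, q.source = t.source → q.target = t.target → coeff h q = 0 := by
    intro q hs htt
    have e1 : QPath.mul? (.vertex t.target) q = some q := by
      rw [← htt]
      exact q.vertex_target_mul?
    have e2 : QPath.mul? q (.vertex t.source) = some q := by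
      rw [← hs]
      exact q.mul?_vertex_source
    rw [hh, map_sub, Finsupp.sub_apply, coeff_mul_of e2, coeff_of_mul e1, sub_self]
  have hnpar : ∀ q : QPath Q, ¬ (q.source = t.source ∧ q.target = t.target) →
      coeff h q = coeff g q := by
    intro q hq
    rw [hh, map_sub, Finsupp.sub_apply, sub_eq_self]
    by_contra hne
    obtain ⟨x, y, hx, hy, hxy⟩ := exists_of_coeff_mul_ne_zero hne
    obtain ⟨u, v, hu, hv, huv⟩ := exists_of_coeff_mul_ne_zero hx
    have h1 : u = .vertex t.target := by
      by_contra hne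
      exact hu (by rw [coeff_of, Finsupp.single_eq_of_ne hne])
    have h2 : y = .vertex t.source := by
      by_contra hne
      exact hy (by rw [coeff_of, Finsupp.single_eq_of_ne hne])
    refine hq ⟨?_, ?_⟩
    · rw [QPath.source_mul? hxy, h2]
      rfl
    · rw [QPath.target_mul? hxy, QPath.target_mul? huv, h1]
      rfl
  have h0 : h = 0 := by
    by_contra hne
    have hc := coeff_tip_ne_zero hne
    have hn : ¬ ((tip h hne).source = t.source ∧ (tip h hne).target = t.target) :=
      fun hn => hc (hpar _ hn.1 hn.2)
    rw [hnpar _ hn] at hc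
    have := hG.mem_nonTip_of_coeff hg hc (fun e => hn ⟨by rw [e], by rw [e]⟩)
    exact this ⟨h, hI, hne, rfl⟩
  by_contra hcon
  apply hp
  rw [← hnpar p hcon, h0]
  simp

/-- The ideal is generated by its Gröbner basis, in the form of an elimination principle: a
linear map that vanishes on all `a g b`, for paths `a`, `b` and `g ∈ G`, vanishes on the ideal. -/
theorem linearMap_eq_zero [WellFoundedLT (QPath Q)] (hG : IsReducedGroebnerBasis I G)
    (hadm : IsAdmissibleOrder Q) {M : Type*} [AddCommGroup M] [Module k M]
    (D : PathAlgebra k Q →ₗ[k] M)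
    (hD : ∀ g ∈ G, ∀ a b : QPath Q, D (of a * g * of b) = 0) {f : PathAlgebra k Q}
    (hf : f ∈ I) : D f = 0 := by
  have key : ∀ p : QPath Q, ∀ f ∈ I, ∀ hf : f ≠ 0, tip f hf = p → D f = 0 := by
    intro p
    induction p using WellFoundedLT.induction with
    | ind p ih =>
      rintro f hfI hf0 rfl
      obtain ⟨_, ⟨g, hg, hg0, rfl⟩, a, b, c, hc, hp⟩ :=
        hG.exists_tip_divides ⟨f, hfI, hf0, rfl⟩
      obtain ⟨h0, ht⟩ := exists_tip_mul hadm hg0 hc hp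
      set m : PathAlgebra k Q := of a * g * of b with hm
      have hmI : m ∈ I := I.mul_mem_right _ (I.mul_mem_left _ (hG.subset hg))
      have hcm : coeff m (tip f hf0) ≠ 0 := by
        rw [← ht]
        exact coeff_tip_ne_zero h0
      set l : k := coeff f (tip f hf0) * (coeff m (tip f hf0))⁻¹ with hl
      have hDf : D f = D (f - l • m) := by rw [map_sub, map_smul, hD g hg a b, smul_zero, sub_zero]
      rw [hDf]
      by_cases hz : f - l • m = 0
      · rw [hz, map_zero]
      · refine ih (tip (f - l • m) hz) ?_ _ (I.sub_mem hfI ?_) hz rfl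
        · have hne := coeff_tip_ne_zero hz
          refine lt_of_le_of_ne ?_ ?_
          · by_cases h1 : coeff f (tip (f - l • m) hz) = 0
            · rw [← ht]
              refine le_tip h0 fun h2 => hne ?_
              rw [map_sub, map_smul, Finsupp.sub_apply, Finsupp.smul_apply, h1, h2]
              simp
            · exact le_tip hf0 h1
          · intro he
            apply hne
            rw [he, map_sub, map_smul, Finsupp.sub_apply, Finsupp.smul_apply, smul_eq_mul, hl,
              inv_mul_cancel_right₀ hcm, sub_self]
        · rw [← one_mul m, ← smul_mul_assoc]
          exact I.mul_mem_left _ hmI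
  by_cases h0 : f = 0
  · rw [h0, map_zero]
  · exact key _ f hf h0 rfl

end IsReducedGroebnerBasis

section Length

variable {k : Type*} [Field k] {Q : Type*} [Quiver Q] [LinearOrder (QPath Q)] [Fintype Q]
  {I : Ideal (PathAlgebra k Q)}

theorem two_le_length_of_mem_tipSet
    (hI : ∀ f ∈ I, ∀ p ∈ (PathAlgebra.coeff f).support, 2 ≤ p.length) {p : QPath Q}
    (hp : p ∈ tipSet (I : Set (PathAlgebra k Q))) : 2 ≤ p.length := by
  obtain ⟨f, hf, hf0, rfl⟩ := hp
  exact hI f hf _ (Finsupp.mem_support_iff.2 (coeff_tip_ne_zero hf0))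

theorem mem_nonTip_of_length
    (hI : ∀ f ∈ I, ∀ p ∈ (PathAlgebra.coeff f).support, 2 ≤ p.length) {p : QPath Q}
    (hp : p.length < 2) : p ∈ nonTip (I : Set (PathAlgebra k Q)) :=
  fun h => absurd (two_le_length_of_mem_tipSet hI h) (by omega)

end Length

/-! ### The quotient algebra and its monomial basis -/

section Quotient

variable {k : Type*} [Field k] {Q : Type*} [Quiver Q] [Fintype Q]
  (I : Ideal (PathAlgebra k Q)) [I.IsTwoSided]

theorem PathAlgebra.induction_on {P : PathAlgebra k Q → Prop} (f : PathAlgebra k Q)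
    (zero : P 0) (of : ∀ p, P (of p)) (add : ∀ f g, P f → P g → P (f + g))
    (smul : ∀ (c : k) f, P f → P (c • f)) : P f := by
  refine Finsupp.induction_linear (motive := P) f zero add fun p c => ?_
  have : (Finsupp.single p c : QPath Q →₀ k) = c • (PathAlgebra.of p : PathAlgebra k Q) := by
    apply coeff.injective
    rw [map_smul, coeff_of]
    change Finsupp.single p c = c • Finsupp.single p (1 : k)
    simp
  exact this ▸ smul c _ (of p)

theorem cls_mul_some {p q r : QPath Q} (h : QPath.mul? p q = some r) :
    cls I p * cls I q = cls I r := by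
  rw [cls, cls, ← map_mul, of_mul_of_some h]

theorem cls_mul_none {p q : QPath Q} (h : q.target ≠ p.source) : cls I p * cls I q = 0 := by
  rw [cls, cls, ← map_mul, of_mul_of_none h, map_zero]

theorem cls_mul_mk {a b c : Q} (p : Quiver.Path b c) (q : Quiver.Path a b) :
    cls I ⟨b, c, p⟩ * cls I ⟨a, b, q⟩ = cls I ⟨a, c, q.comp p⟩ :=
  cls_mul_some I (by simp)

theorem cls_vertex_target_mul (p : QPath Q) : cls I (.vertex p.target) * cls I p = cls I p :=
  cls_mul_some I p.vertex_target_mul?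

theorem cls_mul_vertex_source (p : QPath Q) : cls I p * cls I (.vertex p.source) = cls I p :=
  cls_mul_some I p.mul?_vertex_source

theorem cls_vertex_mul_self (e : Q) :
    cls I (.vertex e) * cls I (.vertex e) = cls I (.vertex e) :=
  cls_vertex_target_mul I (.vertex e)

theorem cls_vertex_mul_ne {e f : Q} (h : e ≠ f) : cls I (.vertex e) * cls I (.vertex f) = 0 :=
  cls_mul_none I (Ne.symm h)

theorem sum_cls_vertex : ∑ e : Q, cls I (.vertex e) = 1 := by
  rw [← map_one (Ideal.Quotient.mkₐ k I), one_def, map_sum]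

/-- The subspace `t(p) A s(p)` of the elements of `A` parallel to the path `p`. -/
def parallelTo (p : QPath Q) : Submodule k (PathAlgebra k Q ⧸ I) where
  carrier := {a | cls I (.vertex p.target) * a * cls I (.vertex p.source) = a}
  add_mem' {a b} ha hb := by
    simp only [Set.mem_ofPred_eq] at ha hb ⊢
    rw [mul_add, add_mul, ha, hb]
  zero_mem' := by simp
  smul_mem' c a ha := by
    simp only [Set.mem_ofPred_eq] at ha ⊢
    rw [mul_smul_comm, smul_mul_assoc, ha]

theorem mem_parallelTo {p : QPath Q} {a : PathAlgebra k Q ⧸ I} :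
    a ∈ parallelTo I p ↔ cls I (.vertex p.target) * a * cls I (.vertex p.source) = a := Iff.rfl

variable {I}

theorem vertex_mul_of_mem_parallelTo {p : QPath Q} {a : PathAlgebra k Q ⧸ I}
    (h : a ∈ parallelTo I p) : cls I (.vertex p.target) * a = a := by
  rw [mem_parallelTo] at h
  rw [← h, ← mul_assoc, ← mul_assoc, cls_vertex_mul_self]

theorem mul_vertex_of_mem_parallelTo {p : QPath Q} {a : PathAlgebra k Q ⧸ I}
    (h : a ∈ parallelTo I p) : a * cls I (.vertex p.source) = a := by
  rw [mem_parallelTo] at h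
  rw [← h, mul_assoc, cls_vertex_mul_self]

theorem mem_parallelTo_of {p : QPath Q} {a : PathAlgebra k Q ⧸ I}
    (h : cls I (.vertex p.target) * a = a) (h' : a * cls I (.vertex p.source) = a) :
    a ∈ parallelTo I p := by
  rw [mem_parallelTo, h, h']

theorem cls_mem_parallelTo {p q : QPath Q} (hs : p.source = q.source) (ht : p.target = q.target) :
    cls I q ∈ parallelTo I p := by
  rw [mem_parallelTo, hs, ht, cls_vertex_target_mul, cls_mul_vertex_source]

theorem parallelTo_congr {p q : QPath Q} (hs : p.source = q.source) (ht : p.target = q.target) :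
    parallelTo I p = parallelTo I q := by
  ext a
  rw [mem_parallelTo, mem_parallelTo, hs, ht]

variable [LinearOrder (QPath Q)] [WellFoundedLT (QPath Q)]

theorem monomialBasis_apply (b : nonTip (I : Set (PathAlgebra k Q))) :
    monomialBasis I b = cls I b.1 :=
  Module.Basis.mk_apply _ _ _

theorem repr_cls (b : nonTip (I : Set (PathAlgebra k Q))) :
    (monomialBasis I).repr (cls I b.1) = Finsupp.single b 1 := by
  rw [← monomialBasis_apply, Module.Basis.repr_self]

open Classical in
/-- Multiplication by vertices on both sides is the projection to the span of the basis elements with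
these ends. -/
theorem repr_vertex_mul_vertex (e f : Q) (a : PathAlgebra k Q ⧸ I)
    (b : nonTip (I : Set (PathAlgebra k Q))) :
    (monomialBasis I).repr (cls I (.vertex e) * a * cls I (.vertex f)) b =
      if b.1.target = e ∧ b.1.source = f then (monomialBasis I).repr a b else 0 := by
  have : (Finsupp.lapply b ∘ₗ (monomialBasis I).repr.toLinearMap ∘ₗ
      LinearMap.mulRight k (cls I (.vertex f)) ∘ₗ LinearMap.mulLeft k (cls I (.vertex e))) =
      (if b.1.target = e ∧ b.1.source = f then (1 : k) else 0) •
        (Finsupp.lapply b ∘ₗ (monomialBasis I).repr.toLinearMap) := by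
    refine (monomialBasis I).ext fun c => ?_
    simp only [LinearMap.coe_comp, Function.comp_apply, LinearMap.mulLeft_apply,
      LinearMap.mulRight_apply, LinearEquiv.coe_coe, Finsupp.lapply_apply, LinearMap.smul_apply,
      monomialBasis_apply, smul_eq_mul]
    by_cases ht : c.1.target = e
    · subst ht
      rw [cls_vertex_target_mul]
      by_cases hs : c.1.source = f
      · subst hs
        rw [cls_mul_vertex_source, repr_cls]
        by_cases hb : c = b
        · subst hb
          simp
        · simp [hb]
      · rw [cls_mul_none I (Ne.symm hs), repr_cls]
        by_cases hb : c = b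
        · subst hb
          simp [hs]
        · simp [hb]
    · rw [cls_mul_none I ht, repr_cls]
      by_cases hb : c = b
      · subst hb
        simp [ht]
      · simp [hb]
  have h := congrArg (fun F => F a) this
  simp only [LinearMap.coe_comp, Function.comp_apply, LinearMap.mulLeft_apply,
      LinearMap.mulRight_apply, LinearEquiv.coe_coe, Finsupp.lapply_apply, LinearMap.smul_apply,
      smul_eq_mul] at h
  rw [h]
  split_ifs <;> simp

theorem parallel_of_repr_ne_zero {p : QPath Q} {a : PathAlgebra k Q ⧸ I}
    (h : a ∈ parallelTo I p) {b : nonTip (I : Set (PathAlgebra k Q))}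
    (hb : (monomialBasis I).repr a b ≠ 0) : p.source = b.1.source ∧ p.target = b.1.target := by
  classical
  rw [mem_parallelTo] at h
  rw [← h, repr_vertex_mul_vertex] at hb
  by_contra hcon
  exact hb (if_neg fun h => hcon ⟨h.2.symm, h.1.symm⟩)

end Quotient

/-! ### Elements of `k(X // 𝓑)` as families of elements of `A` -/

section Family

variable {k : Type*} [Field k] {Q : Type*} [Quiver Q] [Fintype Q] [LinearOrder (QPath Q)]
  [WellFoundedLT (QPath Q)] (I : Ideal (PathAlgebra k Q)) [I.IsTwoSided] (X : Set (QPath Q))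

open Classical in
/-- The family of elements of `A` given by an element of `k(X // 𝓑)`: its value at the path `x` is
`∑ λᵢ bᵢ` if the part of the given element with first component `x` is `∑ λᵢ (x, bᵢ)`. -/
def family : ParallelSpace k X (basisPaths I) →ₗ[k] (QPath Q → PathAlgebra k Q ⧸ I) :=
  Finsupp.linearCombination k fun x => Pi.single x.1.1 (cls I x.1.2)

variable {X}

open Classical in
theorem repr_family (ξ : ParallelSpace k X (basisPaths I)) (p : QPath Q)
    (b : nonTip (I : Set (PathAlgebra k Q))) :
    (monomialBasis I).repr (family I X ξ p) b =
      if h : (p, b.1) ∈ parallel X (basisPaths I) then ξ ⟨(p, b.1), h⟩ else 0 := by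
  induction ξ using Finsupp.induction_linear with
  | zero => simp
  | add f g hf hg =>
    rw [map_add, Pi.add_apply, map_add, Finsupp.add_apply, hf, hg]
    split_ifs <;> simp
  | single x c =>
    obtain ⟨⟨y, d⟩, hx⟩ := x
    simp only [family, Finsupp.linearCombination_single, Pi.smul_apply, map_smul,
      Finsupp.smul_apply, Pi.single_apply]
    by_cases hp : p = y
    · subst hp
      rw [if_pos rfl, repr_cls ⟨d, hx.2.1⟩]
      by_cases hb : b = ⟨d, hx.2.1⟩
      · subst hb
        simp [hx]
      · have hd : d ≠ b.1 := fun h => hb (Subtype.ext h.symm)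
        rw [Finsupp.single_eq_of_ne hb]
        split_ifs with h
        · rw [Finsupp.single_eq_of_ne (by simpa using hd.symm), smul_zero]
        · simp
    · rw [if_neg hp]
      split_ifs with h
      · rw [Finsupp.single_eq_of_ne (by simpa using fun h => absurd h hp)]
        simp
      · simp

theorem family_injective : Function.Injective (family I X) := by
  classical
  intro ξ ζ h
  ext ⟨⟨p, b⟩, hx⟩
  have := congrArg (fun F => (monomialBasis I).repr (F p) ⟨b, hx.2.1⟩) h
  simpa [repr_family, hx] using this

theorem family_mem_parallelTo (ξ : ParallelSpace k X (basisPaths I)) (p : QPath Q) :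
    family I X ξ p ∈ parallelTo I p := by
  classical
  induction ξ using Finsupp.induction_linear with
  | zero =>
    rw [map_zero]
    exact Submodule.zero_mem _
  | add f g hf hg =>
    rw [map_add]
    exact Submodule.add_mem _ hf hg
  | single x c =>
    obtain ⟨⟨y, d⟩, hx⟩ := x
    simp only [family, Finsupp.linearCombination_single, Pi.smul_apply, Pi.single_apply]
    refine Submodule.smul_mem _ _ ?_
    split_ifs with h
    · subst h
      exact cls_mem_parallelTo hx.2.2.1 hx.2.2.2
    · exact Submodule.zero_mem _

theorem family_of_notMem (ξ : ParallelSpace k X (basisPaths I)) {p : QPath Q} (hp : p ∉ X) :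
    family I X ξ p = 0 := by
  classical
  apply (monomialBasis I).repr.injective
  ext b
  rw [repr_family, dif_neg fun h => hp h.1]
  simp

open Classical in
theorem pairing_apply (x : QPath Q) (a : PathAlgebra k Q ⧸ I) (y : parallel X (basisPaths I)) :
    pairing I X x a y =
      if y.1.1 = x then (monomialBasis I).repr a ⟨y.1.2, y.2.2.1⟩ else 0 := by
  obtain ⟨⟨p, d⟩, hy⟩ := y
  rw [pairing, Finsupp.sum_apply]
  by_cases hp : p = x
  · subst hp
    rw [if_pos rfl, Finsupp.sum, Finset.sum_eq_single ⟨d, hy.2.1⟩]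
    · simp [hy]
    · intro b _ hb
      have hd : d ≠ b.1 := fun h => hb (Subtype.ext h.symm)
      split_ifs with h
      · rw [Finsupp.single_eq_of_ne (by simpa using hd)]
      · simp
    · intro h
      rw [Finsupp.notMem_support_iff.1 h]
      split_ifs <;> simp
  · rw [if_neg hp]
    refine Finset.sum_eq_zero fun b _ => ?_
    dsimp only
    split_ifs with h
    · rw [Finsupp.single_eq_of_ne (by simpa using fun h => absurd h hp)]
    · simp

theorem family_pairing_self {x : QPath Q} (hx : x ∈ X) {a : PathAlgebra k Q ⧸ I}
    (ha : a ∈ parallelTo I x) : family I X (pairing I X x a) x = a := by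
  classical
  apply (monomialBasis I).repr.injective
  ext b
  rw [repr_family]
  split_ifs with h
  · rw [pairing_apply, if_pos rfl]
  · by_contra hb
    exact h ⟨hx, b.2, parallel_of_repr_ne_zero ha (Ne.symm hb)⟩

theorem family_pairing_of_ne {x y : QPath Q} (h : y ≠ x) (a : PathAlgebra k Q ⧸ I) :
    family I X (pairing I X x a) y = 0 := by
  classical
  apply (monomialBasis I).repr.injective
  ext b
  rw [repr_family]
  split_ifs with h'
  · rw [pairing_apply, if_neg h]
    simp
  · simp

theorem exists_family_eq (hX : X.Finite) (θ : QPath Q → PathAlgebra k Q ⧸ I)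
    (hθ : ∀ p ∈ X, θ p ∈ parallelTo I p) :
    ∃ ξ : ParallelSpace k X (basisPaths I), ∀ p ∈ X, family I X ξ p = θ p := by
  refine ⟨∑ x ∈ hX.toFinset, pairing I X x (θ x), fun p hp => ?_⟩
  rw [map_sum, Finset.sum_apply, Finset.sum_eq_single p]
  · exact family_pairing_self I hp (hθ p hp)
  · intro y _ hy
    exact family_pairing_of_ne I hy.symm _
  · intro h
    exact absurd (hX.mem_toFinset.2 hp) h

end Family

/-! ### Derivations of the path algebra with values in `A` -/

section Derivation

variable {k : Type*} [Field k] {Q : Type*} [Quiver Q] [Fintype Q]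
  {I : Ideal (PathAlgebra k Q)} [I.IsTwoSided]

/-- The value `∑ᵢ a₁ ⋯ aᵢ₋₁ θ(aᵢ) aᵢ₊₁ ⋯ aₙ` at a path `a₁ ⋯ aₙ` of the derivation that is given by
`θ` on arrows and by zero on vertices. -/
def derivPath (θ : QPath Q → PathAlgebra k Q ⧸ I) :
    ∀ {a b : Q}, Quiver.Path a b → PathAlgebra k Q ⧸ I
  | _, _, .nil => 0
  | _, _, .cons p x => cls I (.arrow x) * derivPath θ p + θ (.arrow x) * cls I ⟨_, _, p⟩

theorem derivPath_nil (θ : QPath Q → PathAlgebra k Q ⧸ I) (a : Q) :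
    derivPath θ (.nil : Quiver.Path a a) = 0 := by
  rw [derivPath]

theorem derivPath_cons (θ : QPath Q → PathAlgebra k Q ⧸ I) {a b c : Q} (p : Quiver.Path a b)
    (x : b ⟶ c) : derivPath θ (p.cons x) =
      cls I (.arrow x) * derivPath θ p + θ (.arrow x) * cls I ⟨_, _, p⟩ := by
  rw [derivPath]

theorem derivPath_add (θ η : QPath Q → PathAlgebra k Q ⧸ I) {a b : Q} (p : Quiver.Path a b) :
    derivPath (θ + η) p = derivPath θ p + derivPath η p := by
  induction p with
  | nil => simp [derivPath]
  | cons p x ih =>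
    simp only [derivPath, ih, Pi.add_apply, mul_add, add_mul]
    abel

theorem derivPath_smul (c : k) (θ : QPath Q → PathAlgebra k Q ⧸ I) {a b : Q}
    (p : Quiver.Path a b) : derivPath (c • θ) p = c • derivPath θ p := by
  induction p with
  | nil => simp [derivPath]
  | cons p x ih =>
    simp only [derivPath, ih, Pi.smul_apply, smul_add, mul_smul_comm, smul_mul_assoc]

variable (I) in
/-- The linear map `kQ → A` that is given by `derivPath` on paths, linearly in the values on
arrows. -/
def pathDeriv : (QPath Q → PathAlgebra k Q ⧸ I) →ₗ[k] PathAlgebra k Q →ₗ[k] PathAlgebra k Q ⧸ I where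
  toFun θ := Finsupp.linearCombination k (fun p : QPath Q => derivPath θ p.path) ∘ₗ
    coeff.toLinearMap
  map_add' θ η := linearMap_ext fun p => by simp [coeff_of, derivPath_add]
  map_smul' c θ := linearMap_ext fun p => by simp [coeff_of, derivPath_smul]

theorem pathDeriv_of (θ : QPath Q → PathAlgebra k Q ⧸ I) (p : QPath Q) :
    pathDeriv I θ (of p) = derivPath θ p.path := by
  simp [pathDeriv, coeff_of]

theorem pathDeriv_vertex (θ : QPath Q → PathAlgebra k Q ⧸ I) (e : Q) :
    pathDeriv I θ (of (.vertex e)) = 0 := by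
  rw [pathDeriv_of]
  exact derivPath_nil θ e

theorem cls_cons {a b c : Q} (p : Quiver.Path a b) (x : b ⟶ c) :
    cls I (.arrow x) * cls I ⟨a, b, p⟩ = cls I ⟨a, c, p.cons x⟩ :=
  cls_mul_mk I x.toPath p

theorem derivPath_mem_parallelTo {θ : QPath Q → PathAlgebra k Q ⧸ I}
    (hθ : ∀ (a b : Q) (x : a ⟶ b), θ (.arrow x) ∈ parallelTo I (.arrow x)) {a b : Q}
    (p : Quiver.Path a b) : derivPath θ p ∈ parallelTo I ⟨a, b, p⟩ := by
  induction p with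
  | nil =>
    rw [derivPath_nil]
    exact (parallelTo I ⟨a, a, .nil⟩).zero_mem
  | @cons b c p x ih =>
    refine mem_parallelTo_of ?_ ?_
    · have h1 : cls I (.vertex c) * cls I (.arrow x) = cls I (.arrow x) :=
        cls_vertex_target_mul I (.arrow x)
      have h2 : cls I (.vertex c) * θ (.arrow x) = θ (.arrow x) :=
        vertex_mul_of_mem_parallelTo (p := .arrow x) (hθ _ _ x)
      change cls I (.vertex c) * derivPath θ (p.cons x) = derivPath θ (p.cons x)
      rw [derivPath_cons, mul_add, ← mul_assoc, ← mul_assoc, h1, h2]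
    · have h1 : derivPath θ p * cls I (.vertex a) = derivPath θ p :=
        mul_vertex_of_mem_parallelTo (p := ⟨a, b, p⟩) ih
      have h2 : cls I ⟨a, b, p⟩ * cls I (.vertex a) = cls I ⟨a, b, p⟩ :=
        cls_mul_vertex_source I ⟨a, b, p⟩
      change derivPath θ (p.cons x) * cls I (.vertex a) = derivPath θ (p.cons x)
      rw [derivPath_cons, add_mul, mul_assoc, mul_assoc, h1, h2]

theorem pathDeriv_of_mem_parallelTo {θ : QPath Q → PathAlgebra k Q ⧸ I}
    (hθ : ∀ (a b : Q) (x : a ⟶ b), θ (.arrow x) ∈ parallelTo I (.arrow x)) (p : QPath Q) :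
    pathDeriv I θ (of p) ∈ parallelTo I p := by
  rw [pathDeriv_of]
  exact derivPath_mem_parallelTo hθ p.path

theorem derivPath_comp {θ : QPath Q → PathAlgebra k Q ⧸ I}
    (hθ : ∀ (a b : Q) (x : a ⟶ b), θ (.arrow x) ∈ parallelTo I (.arrow x)) {a b c : Q}
    (p : Quiver.Path a b) (q : Quiver.Path b c) :
    derivPath θ (p.comp q) = cls I ⟨b, c, q⟩ * derivPath θ p + derivPath θ q * cls I ⟨a, b, p⟩ := by
  induction q with
  | nil =>
    have h1 : cls I (.vertex b) * derivPath θ p = derivPath θ p :=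
      vertex_mul_of_mem_parallelTo (p := ⟨a, b, p⟩) (derivPath_mem_parallelTo hθ p)
    rw [Quiver.Path.comp_nil, derivPath_nil, zero_mul, add_zero]
    exact h1.symm
  | cons q x ih =>
    rw [Quiver.Path.comp_cons, derivPath_cons, derivPath_cons, ih, ← cls_cons q x,
      ← cls_mul_mk I q p]
    simp only [mul_add, add_mul, mul_assoc, add_assoc]

/-- The Leibniz rule. -/
theorem pathDeriv_mul {θ : QPath Q → PathAlgebra k Q ⧸ I}
    (hθ : ∀ (a b : Q) (x : a ⟶ b), θ (.arrow x) ∈ parallelTo I (.arrow x))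
    (f g : PathAlgebra k Q) :
    pathDeriv I θ (f * g) = Ideal.Quotient.mkₐ k I f * pathDeriv I θ g +
      pathDeriv I θ f * Ideal.Quotient.mkₐ k I g := by
  induction f using PathAlgebra.induction_on with
  | zero => simp
  | add f₁ f₂ h₁ h₂ =>
    rw [add_mul, map_add, map_add, map_add, h₁, h₂, add_mul, add_mul]
    abel
  | smul c f h =>
    rw [smul_mul_assoc, map_smul, map_smul, map_smul, h, smul_add, smul_mul_assoc, smul_mul_assoc]
  | of p =>
    induction g using PathAlgebra.induction_on with
    | zero => simp
    | add f₁ f₂ h₁ h₂ =>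
      rw [mul_add, map_add, map_add, map_add, h₁, h₂, mul_add, mul_add]
      abel
    | smul c f h =>
      rw [mul_smul_comm, map_smul, map_smul, map_smul, h, smul_add, mul_smul_comm, mul_smul_comm]
    | of q =>
      by_cases h : q.target = p.source
      · obtain ⟨b, c, p⟩ := p
        obtain ⟨a, b', q⟩ := q
        obtain rfl : b' = b := h
        rw [of_mul_of_some (QPath.mul?_mk p q), pathDeriv_of, pathDeriv_of, pathDeriv_of]
        exact derivPath_comp hθ q p
      · rw [of_mul_of_none h, map_zero]
        have h1 := vertex_mul_of_mem_parallelTo (p := q) (pathDeriv_of_mem_parallelTo hθ q)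
        have h2 := mul_vertex_of_mem_parallelTo (p := p) (pathDeriv_of_mem_parallelTo hθ p)
        have h3 : cls I p * cls I (.vertex q.target) = 0 := cls_mul_none I h
        have h4 : cls I (.vertex p.source) * cls I q = 0 := cls_mul_none I h
        rw [← h1, ← h2, mul_assoc _ _ (Ideal.Quotient.mkₐ k I (of q)), h4, ← mul_assoc, h3]
        simp

/-- A derivation that is inner on vertices and arrows is inner. -/
theorem pathDeriv_eq_inner {θ : QPath Q → PathAlgebra k Q ⧸ I} {z : PathAlgebra k Q ⧸ I}
    (hz : ∀ e : Q, cls I (.vertex e) * z = z * cls I (.vertex e))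
    (hθ : ∀ (a b : Q) (x : a ⟶ b), θ (.arrow x) = cls I (.arrow x) * z - z * cls I (.arrow x))
    (f : PathAlgebra k Q) :
    pathDeriv I θ f = Ideal.Quotient.mkₐ k I f * z - z * Ideal.Quotient.mkₐ k I f := by
  induction f using PathAlgebra.induction_on with
  | zero => simp
  | add f₁ f₂ h₁ h₂ =>
    rw [map_add, map_add, h₁, h₂, add_mul, mul_add]
    abel
  | smul c f h => rw [map_smul, map_smul, h, smul_sub, smul_mul_assoc, mul_smul_comm]
  | of p =>
    obtain ⟨a, b, p⟩ := p
    rw [pathDeriv_of]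
    change derivPath θ p = cls I ⟨a, b, p⟩ * z - z * cls I ⟨a, b, p⟩
    induction p with
    | nil =>
      rw [derivPath_nil]
      exact (sub_eq_zero.2 (hz a)).symm
    | cons p x ih =>
      rw [derivPath_cons, ih, hθ, ← cls_cons p x]
      noncomm_ring

/-- A derivation that vanishes on a reduced Gröbner basis vanishes on the ideal. -/
theorem pathDeriv_eq_zero_of_mem [LinearOrder (QPath Q)] [WellFoundedLT (QPath Q)]
    {G : Set (PathAlgebra k Q)} (hG : IsReducedGroebnerBasis I G) (hadm : IsAdmissibleOrder Q)
    {θ : QPath Q → PathAlgebra k Q ⧸ I}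
    (hθ : ∀ (a b : Q) (x : a ⟶ b), θ (.arrow x) ∈ parallelTo I (.arrow x))
    (h : ∀ g ∈ G, pathDeriv I θ g = 0) {f : PathAlgebra k Q} (hf : f ∈ I) :
    pathDeriv I θ f = 0 := by
  refine hG.linearMap_eq_zero hadm (pathDeriv I θ) (fun g hg a b => ?_) hf
  have hg0 : Ideal.Quotient.mkₐ k I g = 0 := Ideal.Quotient.eq_zero_iff_mem.2 (hG.subset hg)
  rw [pathDeriv_mul hθ, pathDeriv_mul hθ, h g hg, map_mul, hg0]
  simp

end Derivation

/-! ### The maps `ψ₀` and `ψ₁` in terms of families -/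

section Psi

variable {k : Type*} [Field k] {Q : Type*} [Quiver Q] [Fintype Q] [LinearOrder (QPath Q)]
  [WellFoundedLT (QPath Q)] (I : Ideal (PathAlgebra k Q)) [I.IsTwoSided]

theorem QPath.arrow_injective {a b : Q} : Function.Injective (QPath.arrow : (a ⟶ b) → QPath Q) := by
  intro x y h
  simp only [QPath.arrow, QPath.mk.injEq, heq_eq_eq, true_and] at h
  exact eq_of_heq (Quiver.Path.hom_heq_of_cons_eq_cons h)

open Classical in
theorem mk_substPath (α γ : QPath Q) {a b : Q} (p : Quiver.Path a b) :
    Ideal.Quotient.mkₐ k I (substPath α γ p) = derivPath (Pi.single α (cls I γ)) p := by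
  induction p with
  | nil => rw [substPath, derivPath_nil, map_zero]
  | cons p x ih =>
    rw [substPath, derivPath_cons, map_add, map_mul, ih, Pi.single_apply]
    split_ifs
    · rw [map_mul]
    · rw [map_zero, zero_mul]

theorem family_psi1 {G : Finset (PathAlgebra k Q)}
    (hG : IsReducedGroebnerBasis I (G : Set (PathAlgebra k Q)))
    (ξ : ParallelSpace k (pathsOfLength Q 1) (basisPaths I)) {g : PathAlgebra k Q} (hg : g ∈ G) :
    family I (tipSet (G : Set (PathAlgebra k Q))) (psi1 I G ξ) (tip g (hG.ne_zero hg)) =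
      pathDeriv I (family I (pathsOfLength Q 1) ξ) g := by
  classical
  induction ξ using Finsupp.induction_linear with
  | zero => simp
  | add f h hf hh => simp only [map_add, Pi.add_apply, LinearMap.add_apply, hf, hh]
  | single x c =>
    simp only [psi1, family, Finsupp.linearCombination_single, map_smul, LinearMap.smul_apply]
    rw [Pi.smul_apply]
    congr 1
    rw [← family, map_sum, Finset.sum_apply, Finset.sum_eq_single g]
    · rw [dif_pos (hG.ne_zero hg)]
      conv_rhs => rw [eq_sum_coeff g]
      rw [map_sum, map_sum, Finset.sum_apply]
      refine Finset.sum_congr rfl fun p hp => ?_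
      have hx : ∀ (a b : Q) (y : a ⟶ b), (Pi.single x.1.1 (cls I x.1.2) :
          QPath Q → PathAlgebra k Q ⧸ I) (.arrow y) ∈ parallelTo I (.arrow y) := by
        intro a b y
        rw [Pi.single_apply]
        split_ifs with h
        · exact h ▸ cls_mem_parallelTo x.2.2.2.1 x.2.2.2.2
        · exact Submodule.zero_mem _
      rw [map_smul, map_smul, Pi.smul_apply, mk_substPath, pathDeriv_of, family_pairing_self]
      · exact ⟨g, hg, hG.ne_zero hg, rfl⟩
      · have hpar := hG.parallel_tip hg (Finsupp.mem_support_iff.1 hp)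
        rw [← parallelTo_congr hpar.1 hpar.2]
        exact derivPath_mem_parallelTo hx p.path
    · intro h hh hne
      rw [dif_pos (hG.ne_zero hh), map_sum, Finset.sum_apply]
      refine Finset.sum_eq_zero fun p _ => ?_
      rw [map_smul, Pi.smul_apply, family_pairing_of_ne, smul_zero]
      exact fun he => hne (hG.eq_of_tip_eq hh hg _ _ he.symm)
    · exact fun h => absurd hg h

variable [∀ a b : Q, Fintype (a ⟶ b)]

theorem family_psi0 (ξ : ParallelSpace k (pathsOfLength Q 0) (basisPaths I)) {a b : Q}
    (y : a ⟶ b) :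
    family I (pathsOfLength Q 1) (psi0 I ξ) (.arrow y) =
      cls I (.arrow y) * family I (pathsOfLength Q 0) ξ (.vertex a) -
        family I (pathsOfLength Q 0) ξ (.vertex b) * cls I (.arrow y) := by
  classical
  induction ξ using Finsupp.induction_linear with
  | zero => simp
  | add f h hf hh =>
    simp only [map_add, Pi.add_apply, hf, hh, mul_add, add_mul]
    abel
  | single x c =>
    obtain ⟨⟨e, γ⟩, hx⟩ := x
    obtain ⟨he, hγ, hs, ht⟩ := id hx
    have he' := QPath.exists_vertex_of_length_zero he
    generalize hv : e.source = v at *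
    subst he'
    have hs' : v = γ.source := hs
    have ht' : v = γ.target := ht
    simp only [psi0, family, Finsupp.linearCombination_single]
    rw [map_smul, Pi.smul_apply, Pi.smul_apply, Pi.smul_apply, mul_smul_comm, smul_mul_assoc,
      ← smul_sub]
    congr 1
    rw [← family, map_sub, Pi.sub_apply]
    congr 1
    · rw [map_sum, Finset.sum_apply, Pi.single_apply]
      by_cases h : a = v
      · subst h
        rw [if_pos rfl, Finset.sum_eq_single b, map_sum, Finset.sum_apply]
        · refine (Finset.sum_eq_single y (fun z _ hz => family_pairing_of_ne I
            (fun h => hz (QPath.arrow_injective h).symm) _)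
            (fun h => absurd (Finset.mem_univ _) h)).trans ?_
          rw [map_mul]
          refine family_pairing_self I (X := pathsOfLength Q 1) (x := .arrow y) rfl ?_
          obtain ⟨c, d, γ⟩ := γ
          obtain rfl : a = c := hs'
          obtain rfl : a = d := ht'
          change cls I (.arrow y) * cls I _ ∈ _
          rw [QPath.arrow, cls_mul_mk]
          exact cls_mem_parallelTo rfl rfl
        · intro d _ hd
          rw [map_sum, Finset.sum_apply]
          refine Finset.sum_eq_zero fun z _ => ?_
          exact family_pairing_of_ne I (fun h => hd (congrArg QPath.target h).symm) _
        · simp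
      · rw [if_neg fun h' => h (congrArg QPath.source h'), mul_zero]
        refine Finset.sum_eq_zero fun d _ => ?_
        rw [map_sum, Finset.sum_apply]
        refine Finset.sum_eq_zero fun z _ => ?_
        exact family_pairing_of_ne I (fun h' => h (congrArg QPath.source h')) _
    · rw [map_sum, Finset.sum_apply, Pi.single_apply]
      by_cases h : b = v
      · subst h
        rw [if_pos rfl, Finset.sum_eq_single a, map_sum, Finset.sum_apply]
        · refine (Finset.sum_eq_single y (fun z _ hz => family_pairing_of_ne I
            (fun h => hz (QPath.arrow_injective h).symm) _)
            (fun h => absurd (Finset.mem_univ _) h)).trans ?_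
          rw [map_mul]
          refine family_pairing_self I (X := pathsOfLength Q 1) (x := .arrow y) rfl ?_
          obtain ⟨c, d, γ⟩ := γ
          obtain rfl : b = c := hs'
          obtain rfl : b = d := ht'
          change cls I _ * cls I (.arrow y) ∈ _
          rw [QPath.arrow, cls_mul_mk]
          exact cls_mem_parallelTo rfl rfl
        · intro d _ hd
          rw [map_sum, Finset.sum_apply]
          refine Finset.sum_eq_zero fun z _ => ?_
          exact family_pairing_of_ne I (fun h => hd (congrArg QPath.source h).symm) _
        · simp
      · rw [if_neg fun h' => h (congrArg QPath.source h'), zero_mul]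
        refine Finset.sum_eq_zero fun d _ => ?_
        rw [map_sum, Finset.sum_apply]
        refine Finset.sum_eq_zero fun z _ => ?_
        exact family_pairing_of_ne I (fun h' => h (congrArg QPath.target h')) _

/-- The element of `A` with components `x_e ∈ e A e` given by an element of `k(Q₀ // 𝓑)`. -/
def diagonal : ParallelSpace k (pathsOfLength Q 0) (basisPaths I) →ₗ[k] PathAlgebra k Q ⧸ I :=
  ∑ e : Q, LinearMap.proj (QPath.vertex e) ∘ₗ family I (pathsOfLength Q 0)

theorem diagonal_apply (ξ : ParallelSpace k (pathsOfLength Q 0) (basisPaths I)) :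
    diagonal I ξ = ∑ e : Q, family I (pathsOfLength Q 0) ξ (.vertex e) := by
  simp [diagonal]

theorem vertex_mul_diagonal (ξ : ParallelSpace k (pathsOfLength Q 0) (basisPaths I)) (e : Q) :
    cls I (.vertex e) * diagonal I ξ = family I (pathsOfLength Q 0) ξ (.vertex e) := by
  rw [diagonal_apply, Finset.mul_sum, Finset.sum_eq_single e]
  · exact vertex_mul_of_mem_parallelTo (p := .vertex e)
      (family_mem_parallelTo I ξ (.vertex e))
  · intro f _ hf
    rw [← vertex_mul_of_mem_parallelTo (p := .vertex f)
      (family_mem_parallelTo I ξ (.vertex f)), ← mul_assoc]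
    exact mul_eq_zero_of_left (cls_vertex_mul_ne I hf.symm) _
  · simp

theorem diagonal_mul_vertex (ξ : ParallelSpace k (pathsOfLength Q 0) (basisPaths I)) (e : Q) :
    diagonal I ξ * cls I (.vertex e) = family I (pathsOfLength Q 0) ξ (.vertex e) := by
  rw [diagonal_apply, Finset.sum_mul, Finset.sum_eq_single e]
  · exact mul_vertex_of_mem_parallelTo (p := .vertex e)
      (family_mem_parallelTo I ξ (.vertex e))
  · intro f _ hf
    rw [← mul_vertex_of_mem_parallelTo (p := .vertex f)
      (family_mem_parallelTo I ξ (.vertex f)), mul_assoc]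
    exact mul_eq_zero_of_right _ (cls_vertex_mul_ne I hf)
  · simp

theorem family_psi0_eq_inner (ξ : ParallelSpace k (pathsOfLength Q 0) (basisPaths I)) {a b : Q}
    (y : a ⟶ b) :
    family I (pathsOfLength Q 1) (psi0 I ξ) (.arrow y) =
      cls I (.arrow y) * diagonal I ξ - diagonal I ξ * cls I (.arrow y) := by
  rw [family_psi0, ← vertex_mul_diagonal, ← diagonal_mul_vertex, ← mul_assoc, mul_assoc _ _
    (cls I (.arrow y))]
  congr 2
  · exact cls_mul_vertex_source I (.arrow y)
  · exact cls_vertex_target_mul I (.arrow y)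

theorem pathDeriv_psi0 (ξ : ParallelSpace k (pathsOfLength Q 0) (basisPaths I))
    (f : PathAlgebra k Q) :
    pathDeriv I (family I (pathsOfLength Q 1) (psi0 I ξ)) f =
      Ideal.Quotient.mkₐ k I f * diagonal I ξ - diagonal I ξ * Ideal.Quotient.mkₐ k I f :=
  pathDeriv_eq_inner (fun e => by rw [vertex_mul_diagonal, diagonal_mul_vertex])
    (fun _ _ y => family_psi0_eq_inner I ξ y) f

/-- `ψ₁ ψ₀ = 0`: the derivations given by the image of `ψ₀` are inner, so they vanish on the
ideal. -/
theorem psi1_comp_psi0 {G : Finset (PathAlgebra k Q)}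
    (hG : IsReducedGroebnerBasis I (G : Set (PathAlgebra k Q))) :
    psi1 I G ∘ₗ psi0 I = 0 := by
  ext1 x
  ext1
  apply family_injective I
  funext p
  simp only [LinearMap.comp_apply, LinearMap.zero_apply, map_zero, Pi.zero_apply]
  by_cases hp : p ∈ tipSet (G : Set (PathAlgebra k Q))
  · obtain ⟨g, hg, hg0, rfl⟩ := hp
    rw [family_psi1 I hG _ hg, pathDeriv_psi0]
    have h0 : Ideal.Quotient.mkₐ k I g = 0 := Ideal.Quotient.eq_zero_iff_mem.2 (hG.subset hg)
    simp [h0]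
  · exact family_of_notMem I _ hp

end Psi

/-! ### Normal forms -/

section NormalForm

variable {k : Type*} [Field k] {Q : Type*} [Quiver Q] [Fintype Q] [LinearOrder (QPath Q)]
  [WellFoundedLT (QPath Q)] (I : Ideal (PathAlgebra k Q)) [I.IsTwoSided]

/-- The linear section of the projection `kQ → A` with image the span of `𝓑`. -/
def normalForm : PathAlgebra k Q ⧸ I →ₗ[k] PathAlgebra k Q :=
  (monomialBasis I).constr k fun b => of b.1

theorem normalForm_cls {b : QPath Q} (hb : b ∈ nonTip (I : Set (PathAlgebra k Q))) :
    normalForm I (cls I b) = of b := by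
  have := (monomialBasis I).constr_basis k (fun b => (of b.1 : PathAlgebra k Q)) ⟨b, hb⟩
  rwa [monomialBasis_apply] at this

theorem normalForm_eq_sum (a : PathAlgebra k Q ⧸ I) :
    normalForm I a = ((monomialBasis I).repr a).sum fun b c => c • of b.1 := by
  rw [normalForm, Module.Basis.constr_apply]

theorem mk_normalForm (a : PathAlgebra k Q ⧸ I) :
    Ideal.Quotient.mkₐ k I (normalForm I a) = a := by
  have : (Ideal.Quotient.mkₐ k I).toLinearMap ∘ₗ normalForm I = LinearMap.id :=
    (monomialBasis I).ext fun b => by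
      rw [LinearMap.comp_apply, monomialBasis_apply, normalForm_cls I b.2]
      rfl
  exact congrArg (fun F => F a) this

theorem normalForm_mk_sub_mem (f : PathAlgebra k Q) :
    normalForm I (Ideal.Quotient.mkₐ k I f) - f ∈ I := by
  rw [← Ideal.Quotient.eq_zero_iff_mem]
  change Ideal.Quotient.mkₐ k I _ = 0
  rw [map_sub, mk_normalForm, sub_self]

variable {I}

theorem normalForm_mk {f : PathAlgebra k Q}
    (hf : f ∈ Submodule.span k ((of : _ → PathAlgebra k Q) '' nonTip (I : Set (PathAlgebra k Q)))) :
    normalForm I (Ideal.Quotient.mkₐ k I f) = f := by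
  have h : Set.EqOn (normalForm I ∘ₗ (Ideal.Quotient.mkₐ k I).toLinearMap)
      (LinearMap.id : PathAlgebra k Q →ₗ[k] PathAlgebra k Q)
      ((of : _ → PathAlgebra k Q) '' nonTip (I : Set (PathAlgebra k Q))) := by
    rintro _ ⟨b, hb, rfl⟩
    exact normalForm_cls I hb
  exact LinearMap.eqOn_span h hf

/-- The normal form of `Tip(g)` is `Tip(g) - g`, because the Gröbner basis is reduced. -/
theorem normalForm_tip {G : Set (PathAlgebra k Q)} (hG : IsReducedGroebnerBasis I G)
    {g : PathAlgebra k Q} (hg : g ∈ G) :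
    normalForm I (cls I (tip g (hG.ne_zero hg))) = of (tip g (hG.ne_zero hg)) - g := by
  have h0 : Ideal.Quotient.mkₐ k I g = 0 := Ideal.Quotient.eq_zero_iff_mem.2 (hG.subset hg)
  have h1 : cls I (tip g (hG.ne_zero hg)) =
      Ideal.Quotient.mkₐ k I (of (tip g (hG.ne_zero hg)) - g) := by
    rw [map_sub, h0, sub_zero]
  rw [h1]
  apply normalForm_mk
  rw [← neg_sub]
  exact Submodule.neg_mem _ (hG.reduced g hg _)

end NormalForm

/-! ### Hochschild cohomology in degrees zero and one -/

section Subquotient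

variable {k : Type*} [Field k] {V W : Type*} [AddCommGroup V] [Module k V] [AddCommGroup W]
  [Module k W]

/-- A linear map that induces a bijection of subquotients. -/
theorem nonempty_subquotient_equiv (Z B : Submodule k V) (Z' B' : Submodule k W) (T : V →ₗ[k] W)
    (hZ : ∀ x ∈ Z, T x ∈ Z') (hB : ∀ x ∈ Z, T x ∈ B' ↔ x ∈ B)
    (hs : ∀ y ∈ Z', ∃ x ∈ Z, T x - y ∈ B') :
    Nonempty (Subquotient Z B ≃ₗ[k] Subquotient Z' B') := by
  let F : Z →ₗ[k] Z' ⧸ B'.submoduleOf Z' := Submodule.mkQ _ ∘ₗ T.restrict hZ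
  have hF : Function.Surjective F := by
    intro y
    obtain ⟨⟨y, hy⟩, rfl⟩ := Submodule.mkQ_surjective _ y
    obtain ⟨x, hx, h⟩ := hs y hy
    exact ⟨⟨x, hx⟩, (Submodule.Quotient.eq _).2 h⟩
  have hk : LinearMap.ker F = B.submoduleOf Z := by
    ext x
    rw [LinearMap.mem_ker]
    exact (Submodule.Quotient.mk_eq_zero _).trans (hB x.1 x.2)
  exact ⟨(Submodule.quotEquivOfEq _ _ hk.symm).trans (LinearMap.quotKerEquivOfSurjective F hF)⟩

end Subquotient

section Low

variable {k : Type*} [Field k] {A : Type*} [Ring A] [Algebra k A]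

theorem hochschildD_zero_apply (f : HochschildCochain k A 0) (a : Fin 1 → A) :
    hochschildD k A 0 f a = a 0 * f ![] - f ![] * a 0 := by
  have e : ∀ x : Fin 0 → A, x = ![] := fun x => Subsingleton.elim _ _
  simp only [hochschildD, LinearMap.add_apply, add_apply, Finset.univ_eq_empty,
    Finset.sum_empty, add_zero, LinearMap.smul_apply, smul_apply]
  change a 0 * f (Fin.tail a) + (-1 : k) ^ (0 + 1) • (f (Fin.init a) * a (Fin.last 0)) = _
  rw [e (Fin.tail a), e (Fin.init a)]
  simp [sub_eq_add_neg]

theorem hochschildD_one_apply (f : HochschildCochain k A 1) (a : Fin 2 → A) :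
    hochschildD k A 1 f a = a 0 * f ![a 1] - f ![a 0 * a 1] + f ![a 0] * a 1 := by
  simp only [hochschildD, LinearMap.add_apply, add_apply, Finset.univ_unique,
    Finset.sum_singleton, LinearMap.smul_apply, smul_apply]
  change a 0 * f (Fin.tail a) + (-1 : k) ^ (0 + 1) •
    (f (Fin.contractNth (Fin.castSucc (0 : Fin 1)) (· * ·) a)) +
      (-1 : k) ^ (1 + 1) • (f (Fin.init a) * a (Fin.last 1)) = _
  have e1 : Fin.tail a = ![a 1] := by
    funext i
    fin_cases i
    rfl
  have e2 : Fin.contractNth (Fin.castSucc (0 : Fin 1)) (· * ·) a = ![a 0 * a 1] := by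
    funext i
    fin_cases i
    rfl
  have e3 : Fin.init a = ![a 0] := by
    funext i
    fin_cases i
    rfl
  rw [e1, e2, e3]
  simp [sub_eq_add_neg]

theorem mem_ker_hochschildD_zero {f : HochschildCochain k A 0} :
    f ∈ LinearMap.ker (hochschildD k A 0) ↔ ∀ a : A, a * f ![] = f ![] * a := by
  rw [LinearMap.mem_ker]
  constructor
  · intro h a
    have := congrArg (fun F => F ![a]) h
    rw [hochschildD_zero_apply] at this
    exact sub_eq_zero.1 this
  · intro h
    ext a
    rw [hochschildD_zero_apply]
    exact sub_eq_zero.2 (h _)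

theorem mem_ker_hochschildD_one {f : HochschildCochain k A 1} :
    f ∈ LinearMap.ker (hochschildD k A 1) ↔
      ∀ a b : A, f ![a * b] = a * f ![b] + f ![a] * b := by
  rw [LinearMap.mem_ker]
  constructor
  · intro h a b
    have := congrArg (fun F => F ![a, b]) h
    rw [hochschildD_one_apply] at this
    change a * f ![b] - f ![a * b] + f ![a] * b = 0 at this
    rw [eq_comm, ← sub_eq_zero, ← this]
    abel
  · intro h
    ext a
    rw [hochschildD_one_apply, h]
    change _ = (0 : A)
    abel

theorem mem_hochschildB_one {f : HochschildCochain k A 1} :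
    f ∈ hochschildB k A 1 ↔ ∃ z : A, ∀ a : A, f ![a] = a * z - z * a := by
  constructor
  · rintro ⟨g, rfl⟩
    exact ⟨g ![], fun a => hochschildD_zero_apply g ![a]⟩
  · rintro ⟨z, hz⟩
    refine ⟨MultilinearMap.constOfIsEmpty k (fun _ => A) z, ?_⟩
    ext a
    rw [hochschildD_zero_apply]
    have : a = ![a 0] := by
      funext i
      fin_cases i
      rfl
    rw [this]
    exact (hz _).symm

end Low

/-! ### Hochschild cohomology and the maps `ψ₀`, `ψ₁` -/

section Comparison

variable {k : Type*} [Field k] {Q : Type*} [Quiver Q] [Fintype Q] [LinearOrder (QPath Q)]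
  [WellFoundedLT (QPath Q)] (I : Ideal (PathAlgebra k Q)) [I.IsTwoSided]

theorem finite_pathsOfLength_zero : (pathsOfLength Q 0).Finite :=
  (Set.finite_range (QPath.vertex : Q → QPath Q)).subset fun p hp =>
    ⟨p.source, (QPath.exists_vertex_of_length_zero hp).symm⟩

theorem finite_pathsOfLength_one [∀ a b : Q, Fintype (a ⟶ b)] : (pathsOfLength Q 1).Finite :=
  (Set.finite_range fun x : Σ a b : Q, (a ⟶ b) => QPath.arrow x.2.2).subset fun p hp => by
    obtain ⟨a, b, x, rfl⟩ := QPath.exists_arrow_of_length_one hp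
    exact ⟨⟨a, b, x⟩, rfl⟩

theorem family_ext {X : Set (QPath Q)} {ξ ζ : ParallelSpace k X (basisPaths I)}
    (h : ∀ p ∈ X, family I X ξ p = family I X ζ p) : ξ = ζ := by
  apply family_injective I
  funext p
  by_cases hp : p ∈ X
  · exact h p hp
  · rw [family_of_notMem I _ hp, family_of_notMem I _ hp]

theorem family_ext_arrow {ξ ζ : ParallelSpace k (pathsOfLength Q 1) (basisPaths I)}
    (h : ∀ (a b : Q) (x : a ⟶ b), family I (pathsOfLength Q 1) ξ (.arrow x) =
      family I (pathsOfLength Q 1) ζ (.arrow x)) : ξ = ζ :=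
  family_ext I fun p hp => by
    obtain ⟨a, b, x, rfl⟩ := QPath.exists_arrow_of_length_one hp
    exact h a b x

variable {I}

theorem pathDeriv_arrow {θ : QPath Q → PathAlgebra k Q ⧸ I} {a b : Q} (x : a ⟶ b)
    (h : θ (.arrow x) ∈ parallelTo I (.arrow x)) : pathDeriv I θ (of (.arrow x)) = θ (.arrow x) := by
  rw [pathDeriv_of]
  change derivPath θ (Quiver.Path.nil.cons x) = _
  rw [derivPath_cons, derivPath_nil, mul_zero, zero_add]
  exact mul_vertex_of_mem_parallelTo (p := .arrow x) h

/-- A linear map from `kQ` to `A` that satisfies the Leibniz rule and vanishes on vertices is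
determined by its values on arrows. -/
theorem eq_pathDeriv {θ : QPath Q → PathAlgebra k Q ⧸ I}
    {D : PathAlgebra k Q →ₗ[k] PathAlgebra k Q ⧸ I}
    (hD : ∀ f g, D (f * g) = Ideal.Quotient.mkₐ k I f * D g + D f * Ideal.Quotient.mkₐ k I g)
    (hv : ∀ e : Q, D (of (.vertex e)) = 0)
    (ha : ∀ (a b : Q) (x : a ⟶ b), D (of (.arrow x)) = θ (.arrow x)) : D = pathDeriv I θ := by
  refine linearMap_ext fun p => ?_
  obtain ⟨a, b, p⟩ := p
  rw [pathDeriv_of]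
  change D (of ⟨a, b, p⟩) = derivPath θ p
  induction p with
  | nil =>
    rw [derivPath_nil]
    exact hv a
  | @cons b c p x ih =>
    have h : (of (.arrow x) * of ⟨a, b, p⟩ : PathAlgebra k Q) = of ⟨a, c, p.cons x⟩ :=
      of_mul_of_some (QPath.mul?_mk x.toPath p)
    rw [derivPath_cons, ← h, hD, ih, ha]

variable (I) [∀ a b : Q, Fintype (a ⟶ b)]

/-- An element of `A` that commutes with all vertices is diagonal. -/
theorem exists_diagonal_eq {z : PathAlgebra k Q ⧸ I}
    (hz : ∀ e : Q, cls I (.vertex e) * z = z * cls I (.vertex e)) : ∃ ζ, diagonal I ζ = z := by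
  have hpar : ∀ p : QPath Q, p ∈ pathsOfLength Q 0 →
      cls I (.vertex p.source) * z ∈ parallelTo I p := by
    intro p hp
    rw [QPath.exists_vertex_of_length_zero hp]
    refine mem_parallelTo_of ?_ ?_
    · rw [← mul_assoc]
      exact congrArg (· * z) (cls_vertex_mul_self I p.source)
    · rw [hz, mul_assoc]
      exact congrArg (z * ·) (cls_vertex_mul_self I p.source)
  obtain ⟨ζ, hζ⟩ := exists_family_eq I finite_pathsOfLength_zero
    (fun p => cls I (.vertex p.source) * z) hpar
  refine ⟨ζ, ?_⟩
  rw [diagonal_apply, Finset.sum_congr rfl fun e _ => hζ (.vertex e) rfl]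
  change ∑ e : Q, cls I (.vertex e) * z = z
  rw [← Finset.sum_mul, sum_cls_vertex, one_mul]

theorem diagonal_injective : Function.Injective (diagonal I) := by
  intro ξ ζ h
  refine family_ext I fun p hp => ?_
  rw [QPath.exists_vertex_of_length_zero hp, ← vertex_mul_diagonal, h, vertex_mul_diagonal]

theorem psi0_eq_zero_iff (ξ : ParallelSpace k (pathsOfLength Q 0) (basisPaths I)) :
    psi0 I ξ = 0 ↔ ∀ a, a * diagonal I ξ = diagonal I ξ * a := by
  constructor
  · intro h a
    have := pathDeriv_psi0 I ξ (normalForm I a)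
    rw [h, mk_normalForm] at this
    simp only [map_zero, LinearMap.zero_apply] at this
    exact sub_eq_zero.1 this.symm
  · intro h
    refine family_ext_arrow I fun a b x => ?_
    rw [family_psi0_eq_inner, h, sub_self, map_zero, Pi.zero_apply]

/-- `HH⁰(A)`, the centre of `A`, is isomorphic to the kernel of `ψ₀`. -/
theorem nonempty_HH_zero_equiv :
    Nonempty (HH k (PathAlgebra k Q ⧸ I) 0 ≃ₗ[k] LinearMap.ker (psi0 I)) := by
  let A := PathAlgebra k Q ⧸ I
  let L : LinearMap.ker (psi0 I) →ₗ[k] LinearMap.ker (hochschildD k A 0) :=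
    LinearMap.codRestrict _
      ((MultilinearMap.constLinearEquivOfIsEmpty (R := k) (S := k) (M₁ := fun _ : Fin 0 => A)
        (M₂ := A)).toLinearMap ∘ₗ diagonal I ∘ₗ (LinearMap.ker (psi0 I)).subtype)
      (fun ξ => mem_ker_hochschildD_zero.2 ((psi0_eq_zero_iff I ξ.1).1 ξ.2))
  have hL : Function.Bijective L := by
    constructor
    · intro ξ ζ h
      have h1 := congrArg (fun F => F.1 ![]) h
      exact Subtype.ext (diagonal_injective I h1)
    · rintro ⟨f, hf⟩
      have hz := mem_ker_hochschildD_zero.1 hf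
      obtain ⟨ζ, hζ⟩ := exists_diagonal_eq I fun e => hz (cls I (.vertex e))
      refine ⟨⟨ζ, (psi0_eq_zero_iff I ζ).2 (by rwa [hζ])⟩, ?_⟩
      apply Subtype.ext
      ext a
      have : a = ![] := Subsingleton.elim _ _
      subst this
      exact hζ
  have hb : (hochschildB k A 0).submoduleOf (LinearMap.ker (hochschildD k A 0)) = ⊥ := by
    rw [hochschildB, Submodule.submoduleOf, Submodule.comap_bot, Submodule.ker_subtype]
  exact ⟨(Submodule.quotEquivOfEqBot _ hb).trans (LinearEquiv.ofBijective L hL).symm⟩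

/-- The Hochschild `1`-cochain `a ↦ D(nf(a))`, where `D` is the derivation `kQ → A` given by an
element of `k(Q₁ // 𝓑)` and `nf` is the normal form.  If `D` vanishes on `I` it is the derivation
of `A` induced by `D`. -/
def derivationCochain : ParallelSpace k (pathsOfLength Q 1) (basisPaths I) →ₗ[k]
    HochschildCochain k (PathAlgebra k Q ⧸ I) 1 :=
  (MultilinearMap.ofSubsingletonₗ k k (PathAlgebra k Q ⧸ I) (PathAlgebra k Q ⧸ I)
    (0 : Fin 1)).toLinearMap ∘ₗ LinearMap.lcomp k _ (normalForm I) ∘ₗ pathDeriv I ∘ₗ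
    family I (pathsOfLength Q 1)

theorem derivationCochain_apply (ξ : ParallelSpace k (pathsOfLength Q 1) (basisPaths I))
    (a : PathAlgebra k Q ⧸ I) : derivationCochain I ξ ![a] =
      pathDeriv I (family I (pathsOfLength Q 1) ξ) (normalForm I a) := rfl

variable {G : Finset (PathAlgebra k Q)}
  (hG : IsReducedGroebnerBasis I (G : Set (PathAlgebra k Q)))

include hG in
theorem psi1_eq_zero_iff (ξ : ParallelSpace k (pathsOfLength Q 1) (basisPaths I)) :
    psi1 I G ξ = 0 ↔ ∀ g ∈ G, pathDeriv I (family I (pathsOfLength Q 1) ξ) g = 0 := by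
  constructor
  · intro h g hg
    rw [← family_psi1 I hG ξ hg, h, map_zero, Pi.zero_apply]
  · intro h
    refine family_ext I fun p hp => ?_
    obtain ⟨g, hg, hg0, rfl⟩ := hp
    rw [family_psi1 I hG ξ hg, h g hg, map_zero, Pi.zero_apply]

include hG in
theorem derivationCochain_mk (hadm : IsAdmissibleOrder Q)
    {ξ : ParallelSpace k (pathsOfLength Q 1) (basisPaths I)} (hξ : psi1 I G ξ = 0)
    (f : PathAlgebra k Q) : derivationCochain I ξ ![Ideal.Quotient.mkₐ k I f] =
      pathDeriv I (family I (pathsOfLength Q 1) ξ) f := by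
  rw [derivationCochain_apply, ← sub_eq_zero, ← map_sub]
  exact pathDeriv_eq_zero_of_mem hG hadm (fun a b x => family_mem_parallelTo I ξ (.arrow x))
    ((psi1_eq_zero_iff I hG ξ).1 hξ) (normalForm_mk_sub_mem I f)

include hG in
theorem derivationCochain_mem_ker (hadm : IsAdmissibleOrder Q)
    {ξ : ParallelSpace k (pathsOfLength Q 1) (basisPaths I)} (hξ : psi1 I G ξ = 0) :
    derivationCochain I ξ ∈ LinearMap.ker (hochschildD k (PathAlgebra k Q ⧸ I) 1) := by
  refine mem_ker_hochschildD_one.2 fun a b => ?_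
  obtain ⟨f, rfl⟩ := Ideal.Quotient.mkₐ_surjective k I a
  obtain ⟨g, rfl⟩ := Ideal.Quotient.mkₐ_surjective k I b
  rw [← map_mul, derivationCochain_mk I hG hadm hξ, derivationCochain_mk I hG hadm hξ,
    derivationCochain_mk I hG hadm hξ]
  exact pathDeriv_mul (fun a b x => family_mem_parallelTo I ξ (.arrow x)) f g

include hG in
theorem derivationCochain_mem_hochschildB (hadm : IsAdmissibleOrder Q)
    {ξ : ParallelSpace k (pathsOfLength Q 1) (basisPaths I)} (hξ : psi1 I G ξ = 0) :
    derivationCochain I ξ ∈ hochschildB k (PathAlgebra k Q ⧸ I) 1 ↔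
      ξ ∈ LinearMap.range (psi0 I) := by
  rw [mem_hochschildB_one]
  constructor
  · rintro ⟨z, hz⟩
    have hz' : ∀ f, pathDeriv I (family I (pathsOfLength Q 1) ξ) f =
        Ideal.Quotient.mkₐ k I f * z - z * Ideal.Quotient.mkₐ k I f := fun f => by
      rw [← hz, derivationCochain_mk I hG hadm hξ]
    obtain ⟨ζ, rfl⟩ := exists_diagonal_eq I (z := z) fun e =>
      sub_eq_zero.1 ((hz' _).symm.trans (pathDeriv_vertex _ e))
    refine ⟨ζ, family_ext_arrow I fun a b x => ?_⟩
    rw [family_psi0_eq_inner, ← pathDeriv_arrow x (family_mem_parallelTo I ξ (.arrow x)), hz']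
  · rintro ⟨ζ, rfl⟩
    refine ⟨diagonal I ζ, fun a => ?_⟩
    rw [derivationCochain_apply, pathDeriv_psi0, mk_normalForm]

include hG in
/-- Every derivation of `A` differs by an inner derivation from one that vanishes on vertices, and
such a derivation is given by an element of the kernel of `ψ₁`. -/
theorem exists_derivationCochain_sub_mem
    {f : HochschildCochain k (PathAlgebra k Q ⧸ I) 1}
    (hf : f ∈ LinearMap.ker (hochschildD k (PathAlgebra k Q ⧸ I) 1)) :
    ∃ ξ, psi1 I G ξ = 0 ∧ derivationCochain I ξ - f ∈ hochschildB k (PathAlgebra k Q ⧸ I) 1 := by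
  have hd := mem_ker_hochschildD_one.1 hf
  let δ : PathAlgebra k Q ⧸ I →ₗ[k] PathAlgebra k Q ⧸ I :=
    (MultilinearMap.ofSubsingletonₗ k k (PathAlgebra k Q ⧸ I) (PathAlgebra k Q ⧸ I)
      (0 : Fin 1)).symm f
  have hδf : ∀ a, δ a = f ![a] := fun a => by
    change f _ = f _
    congr 1
    funext i
    fin_cases i
    rfl
  have hδ : ∀ a b, δ (a * b) = a * δ b + δ a * b := fun a b => by rw [hδf, hδf, hδf, hd]
  -- The inner derivation of `z = ∑ₑ e δ(e)` agrees with `δ` on vertices.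
  set z : PathAlgebra k Q ⧸ I := ∑ e : Q, cls I (.vertex e) * δ (cls I (.vertex e)) with hz
  have hz1 : ∀ e : Q, cls I (.vertex e) * z = cls I (.vertex e) * δ (cls I (.vertex e)) := by
    intro e
    rw [hz, Finset.mul_sum, Finset.sum_eq_single e]
    · rw [← mul_assoc, cls_vertex_mul_self]
    · intro b _ hb
      rw [← mul_assoc, cls_vertex_mul_ne I hb.symm, zero_mul]
    · simp
  have hz2 : ∀ e : Q, z * cls I (.vertex e) =
      cls I (.vertex e) * δ (cls I (.vertex e)) - δ (cls I (.vertex e)) := by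
    classical
    intro e
    have h1 : ∀ d : Q, cls I (.vertex d) * δ (cls I (.vertex d)) * cls I (.vertex e) =
        (if d = e then cls I (.vertex e) * δ (cls I (.vertex e)) else 0) -
          cls I (.vertex d) * δ (cls I (.vertex e)) := by
      intro d
      have h2 := hδ (cls I (.vertex d)) (cls I (.vertex e))
      rw [mul_assoc, eq_sub_of_add_eq' h2.symm, mul_sub, ← mul_assoc, cls_vertex_mul_self]
      congr 1
      split_ifs with h
      · rw [h, cls_vertex_mul_self]
      · rw [cls_vertex_mul_ne I h, map_zero, mul_zero]
    rw [hz, Finset.sum_mul, Finset.sum_congr rfl fun d _ => h1 d, Finset.sum_sub_distrib,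
      ← Finset.sum_mul, sum_cls_vertex, one_mul, Finset.sum_ite_eq' Finset.univ e,
      if_pos (Finset.mem_univ e)]
  let δ' : PathAlgebra k Q ⧸ I →ₗ[k] PathAlgebra k Q ⧸ I :=
    δ - (LinearMap.mulRight k z - LinearMap.mulLeft k z)
  have hδ'a : ∀ a, δ' a = δ a - (a * z - z * a) := fun a => rfl
  have hδ' : ∀ a b, δ' (a * b) = a * δ' b + δ' a * b := fun a b => by
    simp only [hδ'a, hδ]
    noncomm_ring
  have hv : ∀ e : Q, δ' (cls I (.vertex e)) = 0 := fun e => by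
    rw [hδ'a, hz1, hz2]
    abel
  have hpar : ∀ p ∈ pathsOfLength Q 1, δ' (cls I p) ∈ parallelTo I p := fun p _ => by
    refine mem_parallelTo_of ?_ ?_
    · have h := hδ' (cls I (.vertex p.target)) (cls I p)
      rw [cls_vertex_target_mul, hv, zero_mul, add_zero] at h
      exact h.symm
    · have h := hδ' (cls I p) (cls I (.vertex p.source))
      rw [cls_mul_vertex_source, hv, mul_zero, zero_add] at h
      exact h.symm
  obtain ⟨ξ, hξ⟩ := exists_family_eq I finite_pathsOfLength_one (fun p => δ' (cls I p)) hpar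
  have hD : δ' ∘ₗ (Ideal.Quotient.mkₐ k I).toLinearMap =
      pathDeriv I (family I (pathsOfLength Q 1) ξ) := by
    refine eq_pathDeriv (fun f g => ?_) hv fun a b x => (hξ (.arrow x) rfl).symm
    change δ' (Ideal.Quotient.mkₐ k I (f * g)) = _
    rw [map_mul, hδ']
    rfl
  refine ⟨ξ, (psi1_eq_zero_iff I hG ξ).2 fun g hg => ?_, mem_hochschildB_one.2 ⟨-z, fun a => ?_⟩⟩
  · have h0 : Ideal.Quotient.mkₐ k I g = 0 := Ideal.Quotient.eq_zero_iff_mem.2 (hG.subset hg)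
    rw [← hD]
    change δ' (Ideal.Quotient.mkₐ k I g) = 0
    rw [h0, map_zero]
  · change derivationCochain I ξ ![a] - f ![a] = _
    rw [derivationCochain_apply, ← hD]
    change δ' (Ideal.Quotient.mkₐ k I (normalForm I a)) - f ![a] = _
    rw [mk_normalForm, hδ'a, hδf]
    noncomm_ring

include hG in
/-- `HH¹(A)`, the derivations of `A` modulo the inner ones, is isomorphic to `Ker ψ₁ / Im ψ₀`. -/
theorem nonempty_HH_one_equiv (hadm : IsAdmissibleOrder Q) :
    Nonempty (HH k (PathAlgebra k Q ⧸ I) 1 ≃ₗ[k]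
      Subquotient (LinearMap.ker (psi1 I G)) (LinearMap.range (psi0 I))) := by
  obtain ⟨e⟩ := nonempty_subquotient_equiv (LinearMap.ker (psi1 I G)) (LinearMap.range (psi0 I))
    (LinearMap.ker (hochschildD k (PathAlgebra k Q ⧸ I) 1)) (hochschildB k (PathAlgebra k Q ⧸ I) 1)
    (derivationCochain I) (fun _ h => derivationCochain_mem_ker I hG hadm h)
    (fun _ h => derivationCochain_mem_hochschildB I hG hadm h)
    (fun _ h => exists_derivationCochain_sub_mem I hG h)
  exact ⟨e.symm⟩

end Comparison

/-! ### Cells of low degree -/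

section Cells

variable {k : Type*} [Field k] {Q : Type*} [Quiver Q] [Fintype Q] [LinearOrder (QPath Q)]
  {I : Ideal (PathAlgebra k Q)} [I.IsTwoSided]

/-- The cell of degree zero at a vertex. -/
def Cell.zero (I : Ideal (PathAlgebra k Q)) [I.IsTwoSided] (e : Q) : Cell I 0 where
  v _ := e
  w := ![]
  target_eq r := r.elim0
  source_eq r := r.elim0
  mem r := r.elim0
  pos r := r.elim0

/-- The cell `[p]`. -/
def Cell.one (p : QPath Q) (hp : p ∈ nonTip (I : Set (PathAlgebra k Q))) (h : 0 < p.length) :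
    Cell I 1 where
  v := ![p.target, p.source]
  w := ![p]
  target_eq r := by fin_cases r; rfl
  source_eq r := by fin_cases r; rfl
  mem r := by fin_cases r; exact hp
  pos r := by fin_cases r; exact h

/-- The cell `[p|q]`. -/
def Cell.two (p q : QPath Q) (hm : q.target = p.source)
    (hp : p ∈ nonTip (I : Set (PathAlgebra k Q))) (hq : q ∈ nonTip (I : Set (PathAlgebra k Q)))
    (h : 0 < p.length) (h' : 0 < q.length) : Cell I 2 where
  v := ![p.target, p.source, q.source]
  w := ![p, q]
  target_eq r := by fin_cases r; exacts [rfl, hm]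
  source_eq r := by fin_cases r; exacts [rfl, rfl]
  mem r := by fin_cases r; exacts [hp, hq]
  pos r := by fin_cases r; exacts [h, h']

/-- The cell `[p|q|r]`. -/
def Cell.three (p q r : QPath Q) (hm : q.target = p.source) (hm' : r.target = q.source)
    (hp : p ∈ nonTip (I : Set (PathAlgebra k Q))) (hq : q ∈ nonTip (I : Set (PathAlgebra k Q)))
    (hr : r ∈ nonTip (I : Set (PathAlgebra k Q)))
    (h : 0 < p.length) (h' : 0 < q.length) (h'' : 0 < r.length) : Cell I 3 where
  v := ![p.target, p.source, q.source, r.source]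
  w := ![p, q, r]
  target_eq r := by fin_cases r; exacts [rfl, hm, hm']
  source_eq r := by fin_cases r; exacts [rfl, rfl, rfl]
  mem r := by fin_cases r; exacts [hp, hq, hr]
  pos r := by fin_cases r; exacts [h, h', h'']

/-- A cell of positive degree is determined by its entries. -/
theorem Cell.ext_w {n : ℕ} {c c' : Cell I (n + 1)} (h : c.w = c'.w) : c = c' := by
  refine Cell.ext ?_ h
  funext i
  refine Fin.lastCases ?_ (fun i => ?_) i
  · have h1 := c.source_eq (Fin.last n)
    have h2 := c'.source_eq (Fin.last n)
    rw [Fin.succ_last] at h1 h2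
    rw [← h1, ← h2, h]
  · rw [← c.target_eq, ← c'.target_eq, h]

theorem Cell.ext_one {c c' : Cell I 1} (h : c.w 0 = c'.w 0) : c = c' := by
  apply Cell.ext_w
  funext i
  fin_cases i
  exact h

theorem Cell.ext_two {c c' : Cell I 2} (h : c.w 0 = c'.w 0) (h' : c.w 1 = c'.w 1) : c = c' := by
  apply Cell.ext_w
  funext i
  fin_cases i
  exacts [h, h']

theorem Cell.match_two (c : Cell I 2) : (c.w 1).target = (c.w 0).source :=
  (c.target_eq 1).trans (c.source_eq 0).symm

theorem Cell.total_two (c : Cell I 2) {z : QPath Q} (h : QPath.mul? (c.w 0) (c.w 1) = some z) :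
    c.total = of z := by
  have h0 : c.v 0 = z.target := (c.target_eq 0).symm.trans (QPath.target_mul? h).symm
  simp only [Cell.total, List.ofFn_succ, List.ofFn_zero, List.prod_cons, List.prod_nil, mul_one]
  change of (.vertex (c.v 0)) * (of (c.w 0) * of (c.w 1)) = of z
  rw [h0, of_mul_of_some h, of_mul_of_some z.vertex_target_mul?]

theorem Cell.total_one (c : Cell I 1) : c.total = of (c.w 0) := by
  have h0 : c.v 0 = (c.w 0).target := (c.target_eq 0).symm
  simp only [Cell.total, List.ofFn_succ, List.ofFn_zero, List.prod_cons, List.prod_nil, mul_one]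
  rw [h0, of_mul_of_some (c.w 0).vertex_target_mul?]

theorem Cell.total_zero (c : Cell I 0) : c.total = of (.vertex (c.v 0)) := by
  simp [Cell.total]

end Cells

/-! ### Critical cells of low degree -/

section Critical

variable {k : Type*} [Field k] {Q : Type*} [Quiver Q] [Fintype Q] [LinearOrder (QPath Q)]
  {I : Ideal (PathAlgebra k Q)} [I.IsTwoSided] {G : Set (PathAlgebra k Q)}
  (hG : IsReducedGroebnerBasis I G) (hadm : IsAdmissibleOrder Q)
  (hI : ∀ f ∈ I, ∀ p ∈ (PathAlgebra.coeff f).support, 2 ≤ p.length)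

include hG hadm

theorem nonTip_of_dvd {p q : QPath Q} (hq : q ∈ nonTip (I : Set (PathAlgebra k Q)))
    (h : p.Divides q) : p ∈ nonTip (I : Set (PathAlgebra k Q)) :=
  fun hp => hq (tipSet_of_divides hadm hp h)

theorem ufEdge_vertex_iff {e : Q} {p : QPath Q} (he : p.target = e)
    (hp : p ∈ nonTip (I : Set (PathAlgebra k Q))) : UfEdge G (.vertex e) p ↔ p.length = 1 := by
  subst he
  constructor
  · rintro ⟨_, _, ⟨_, h, _⟩ | ⟨z, hz, hz', _⟩⟩
    · exact h
    · rw [QPath.vertex_target_mul?] at hz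
      cases hz
      exact absurd ((hG.mem_tipIdeal_iff hadm).1 hz') hp
  · intro h
    exact ⟨Or.inl rfl, Or.inr (Or.inl h), Or.inl ⟨rfl, h, p.vertex_target_mul?⟩⟩

/-- The product of the ends of an arrow of the Ufnarovskii graph that does not start at a vertex of
the quiver is a tip of an element of the ideal. -/
theorem not_ufEdge_of_nonTip {p q z : QPath Q} (hp : 0 < p.length)
    (h : QPath.mul? p q = some z) (hz : z ∈ nonTip (I : Set (PathAlgebra k Q))) :
    ¬ UfEdge G p q := by
  rintro ⟨_, _, ⟨h0, _⟩ | ⟨z', hz', ht, _⟩⟩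
  · omega
  · rw [h] at hz'
    cases hz'
    exact hz ((hG.mem_tipIdeal_iff hadm).1 ht)

/-- For an arrow `p` of the quiver, `p → q` is an arrow of the Ufnarovskii graph if and only if
`p q` is a tip of an element of `G`. -/
theorem ufEdge_arrow_iff {p q : QPath Q} (hp : p.length = 1)
    (hq : q ∈ nonTip (I : Set (PathAlgebra k Q))) :
    UfEdge G p q ↔ ∃ z ∈ tipSet G, QPath.mul? p q = some z := by
  constructor
  · rintro ⟨_, _, ⟨h0, _⟩ | ⟨z, hz, ht, hmin⟩⟩
    · omega
    · obtain ⟨t, htG, a, b, c, hc, hcz⟩ :=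
        hG.exists_tip_divides ((hG.mem_tipIdeal_iff hadm).1 ht)
      have hb : b.length = 0 := by
        by_contra hb
        refine hmin c b hcz (by omega) ((hG.mem_tipIdeal_iff hadm).2 ?_)
        exact tipSet_of_divides hadm (hG.tipSet_subset htG) (QPath.divides_of_mul?_left hc)
      obtain ⟨tb, htb, hatb⟩ := QPath.assoc_right hc hcz
      have ha : a.length = 0 := by
        by_contra ha
        obtain ⟨d, hd, hd'⟩ := QPath.left_factor_of_le hz hatb (by omega)
        exact hq (tipSet_of_divides hadm (tipSet_of_divides hadm (hG.tipSet_subset htG)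
          (QPath.divides_of_mul?_right htb)) (QPath.divides_of_mul?_left hd'))
      have : t = z := by
        rw [QPath.exists_vertex_of_length_zero hb, QPath.mul?_vertex] at hcz
        rw [QPath.exists_vertex_of_length_zero ha, QPath.vertex_mul?] at hc
        split_ifs at hcz hc
        cases hcz
        cases hc
        rfl
      exact ⟨z, this ▸ htG, hz⟩
  · rintro ⟨z, hz, hm⟩
    refine ⟨Or.inr (Or.inl hp), Or.inr (Or.inr ⟨z, hz, p, by omega, hm⟩), Or.inr ⟨z, hm,
      (hG.mem_tipIdeal_iff hadm).2 (hG.tipSet_subset hz), fun a r har hr ha => ?_⟩⟩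
    have := QPath.length_mul? har
    exact hG.nonTip_of_divides hz (QPath.divides_of_mul?_right har) (by omega)
      ((hG.mem_tipIdeal_iff hadm).1 ha)

theorem isChain_one_iff {n : ℕ} (c : Cell I (n + 1)) :
    c.IsChain I G 1 ↔ (c.w 0).length = 1 := by
  have h := ufEdge_vertex_iff hG hadm (c.target_eq 0) (c.mem 0)
  constructor
  · intro hc
    exact h.1 (hc.1 (by omega) one_pos)
  · intro hl
    exact ⟨fun _ _ => h.2 hl, fun r _ hr => by omega⟩

theorem isChain_two_iff {n : ℕ} (c : Cell I (n + 2)) :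
    c.IsChain I G 2 ↔ (c.w 0).length = 1 ∧ UfEdge G (c.w 0) (c.w 1) := by
  have h := ufEdge_vertex_iff hG hadm (c.target_eq 0) (c.mem 0)
  constructor
  · intro hc
    exact ⟨h.1 (hc.1 (by omega) two_pos), hc.2 0 (by omega) (by omega)⟩
  · intro hl
    refine ⟨fun _ _ => h.2 hl.1, fun r _ hr => ?_⟩
    obtain rfl : r = 0 := by omega
    exact hl.2

theorem isChain_three_iff {n : ℕ} (c : Cell I (n + 3)) :
    c.IsChain I G 3 ↔ (c.w 0).length = 1 ∧ UfEdge G (c.w 0) (c.w 1) ∧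
      UfEdge G (c.w 1) (c.w 2) := by
  have h := ufEdge_vertex_iff hG hadm (c.target_eq 0) (c.mem 0)
  constructor
  · intro hc
    exact ⟨h.1 (hc.1 (by omega) three_pos), hc.2 0 (by omega) (by omega),
      hc.2 1 (by omega) (by omega)⟩
  · intro hl
    refine ⟨fun _ _ => h.2 hl.1, fun r _ hr => ?_⟩
    obtain rfl | rfl : r = 0 ∨ r = 1 := by omega
    exacts [hl.2.1, hl.2.2]

theorem inV_zero_iff {n : ℕ} (c : Cell I (n + 1)) : c.InV I G 0 ↔ (c.w 0).length ≠ 1 := by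
  rw [Cell.InV, isChain_one_iff hG hadm]
  exact ⟨fun h => h.2.2, fun h => ⟨by omega, ⟨fun _ h => absurd h (by omega),
    fun r _ h => absurd h (by omega)⟩, h⟩⟩

theorem inV_one_iff {n : ℕ} (c : Cell I (n + 2)) :
    c.InV I G 1 ↔ (c.w 0).length = 1 ∧ ¬ UfEdge G (c.w 0) (c.w 1) := by
  rw [Cell.InV, isChain_one_iff hG hadm, isChain_two_iff hG hadm]
  have : 1 < n + 2 := by omega
  tauto

theorem inV_two_iff {n : ℕ} (c : Cell I (n + 3)) :
    c.InV I G 2 ↔ (c.w 0).length = 1 ∧ UfEdge G (c.w 0) (c.w 1) ∧ ¬ UfEdge G (c.w 1) (c.w 2) := by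
  rw [Cell.InV, isChain_two_iff hG hadm, isChain_three_iff hG hadm]
  have : 2 < n + 3 := by omega
  tauto

theorem anickMatching_one_iff (c : Cell I 2) (c' : Cell I 1) :
    anickMatching I G 1 c c' ↔
      (c.w 0).length = 1 ∧ QPath.mul? (c.w 0) (c.w 1) = some (c'.w 0) := by
  constructor
  · rintro ⟨m, h1, h2, b, hb, hw⟩
    fin_cases m
    refine ⟨((inV_one_iff hG hadm c).1 h1).1, ?_⟩
    rw [hw]
    exact hb
  · rintro ⟨h1, h2⟩
    have hl := QPath.length_mul? h2
    have := c.pos 1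
    refine ⟨0, (inV_one_iff hG hadm c).2 ⟨h1, ?_⟩, (inV_zero_iff hG hadm c').2 (by omega), c'.w 0,
      h2, ?_⟩
    · exact not_ufEdge_of_nonTip hG hadm (by omega) h2 (c'.mem 0)
    · funext i
      fin_cases i
      rfl

/-- Every path in `𝓑` of length at least two is matched, with its factorization that splits off the
last arrow. -/
theorem exists_anickMatching_one (c' : Cell I 1) (h : (c'.w 0).length ≠ 1) :
    ∃ c, anickMatching I G 1 c c' := by
  have hpos := c'.pos 0
  obtain ⟨p, q, hpq, hl⟩ := QPath.exists_split (c'.w 0) 1 (by omega)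
  have hl' := QPath.length_mul? hpq
  exact ⟨Cell.two p q (QPath.mul?_match hpq)
    (nonTip_of_dvd hG hadm (c'.mem 0) (QPath.divides_of_mul?_right hpq))
    (nonTip_of_dvd hG hadm (c'.mem 0) (QPath.divides_of_mul?_left hpq)) (by omega) (by omega),
    (anickMatching_one_iff hG hadm _ _).2 ⟨hl, hpq⟩⟩

theorem anickMatching_one_unique {c d : Cell I 2} {c' : Cell I 1}
    (h : anickMatching I G 1 c c') (h' : anickMatching I G 1 d c') : c = d := by
  rw [anickMatching_one_iff hG hadm] at h h'
  have := QPath.mul?_unique h.2 h'.2 (h.1.trans h'.1.symm)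
  exact Cell.ext_two this.1 this.2

omit hG hadm in
theorem isCritical_zero (c : Cell I 0) : IsCritical (anickMatching I G) 0 c := by
  rintro c' ⟨m, _⟩
  exact m.elim0

theorem isCritical_one_iff (c : Cell I 1) :
    IsCritical (anickMatching I G) 1 c ↔ (c.w 0).length = 1 := by
  constructor
  · intro h
    by_contra hl
    obtain ⟨c', hc'⟩ := exists_anickMatching_one hG hadm c hl
    exact h.1 c' hc'
  · intro h
    refine ⟨fun c' hc' => ?_, fun c' ⟨m, _⟩ => m.elim0⟩
    rw [anickMatching_one_iff hG hadm] at hc'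
    have := QPath.length_mul? hc'.2
    have := c'.pos 1
    omega

theorem isCritical_two_iff (c : Cell I 2) :
    IsCritical (anickMatching I G) 2 c ↔
      (c.w 0).length = 1 ∧ ∃ z ∈ tipSet G, QPath.mul? (c.w 0) (c.w 1) = some z := by
  have hp0 := c.pos 0
  have hp1 := c.pos 1
  constructor
  · rintro ⟨h2, h1⟩
    -- A first entry of length at least two could be split.
    have hl : (c.w 0).length = 1 := by
      by_contra hl
      obtain ⟨p, q, hpq, hlp⟩ := QPath.exists_split (c.w 0) 1 (by omega)
      have hl' := QPath.length_mul? hpq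
      refine h2 (Cell.three p q (c.w 1) (QPath.mul?_match hpq)
        (c.match_two.trans (QPath.source_mul? hpq))
        (nonTip_of_dvd hG hadm (c.mem 0) (QPath.divides_of_mul?_right hpq))
        (nonTip_of_dvd hG hadm (c.mem 0) (QPath.divides_of_mul?_left hpq)) (c.mem 1)
        (by omega) (by omega) hp1) ⟨0, (inV_one_iff hG hadm _).2 ⟨hlp, ?_⟩,
          (inV_zero_iff hG hadm c).2 hl, c.w 0, hpq, ?_⟩
      · exact not_ufEdge_of_nonTip hG hadm (p := p) (q := q) (by omega) hpq (c.mem 0)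
      · funext i
        fin_cases i <;> rfl
    obtain ⟨z, hz⟩ := QPath.exists_mul? c.match_two
    have hlz := QPath.length_mul? hz
    -- If the product of the entries were in `𝓑`, the entries could be merged.
    have hzt : z ∈ tipSet (I : Set (PathAlgebra k Q)) := by
      by_contra hzn
      exact h1 (Cell.one z hzn (by omega)) ((anickMatching_one_iff hG hadm _ _).2 ⟨hl, hz⟩)
    refine ⟨hl, ?_⟩
    by_contra hno
    have hE : ¬ UfEdge G (c.w 0) (c.w 1) :=
      fun h => hno ((ufEdge_arrow_iff hG hadm hl (c.mem 1)).1 h)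
    -- Otherwise a proper left factor of the product is a tip, and the second entry could be split.
    obtain ⟨t, htG, a, b, d, hd, hdz⟩ := hG.exists_tip_divides hzt
    obtain ⟨tb, htb, hatb⟩ := QPath.assoc_right hd hdz
    have ha : a.length = 0 := by
      by_contra ha
      obtain ⟨e, he, he'⟩ := QPath.left_factor_of_le hz hatb (by omega)
      exact c.mem 1 (tipSet_of_divides hadm (tipSet_of_divides hadm (hG.tipSet_subset htG)
        (QPath.divides_of_mul?_right htb)) (QPath.divides_of_mul?_left he'))
    have had : t = d := by
      rw [QPath.exists_vertex_of_length_zero ha, QPath.vertex_mul?] at hd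
      split_ifs at hd
      cases hd
      rfl
    subst had
    have hbl : 0 < b.length := by
      by_contra hb
      rw [QPath.exists_vertex_of_length_zero (p := b) (by omega), QPath.mul?_vertex] at hdz
      split_ifs at hdz
      cases hdz
      exact hno ⟨_, htG, hz⟩
    have ht1 : 2 ≤ t.length := by
      by_contra htl
      have h3 := QPath.length_mul? hdz
      obtain ⟨e, he, he'⟩ := QPath.left_factor_of_le hdz hz (by omega)
      exact c.mem 0 (tipSet_of_divides hadm (hG.tipSet_subset htG)
        (QPath.divides_of_mul?_right he))
    obtain ⟨y, hy, hyb⟩ := QPath.left_factor_of_le hz hdz (by omega)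
    have hly := QPath.length_mul? hy
    have hyn := nonTip_of_dvd hG hadm (c.mem 1) (QPath.divides_of_mul?_right hyb)
    refine h2 (Cell.three (c.w 0) y b (QPath.mul?_match hy) (QPath.mul?_match hyb) (c.mem 0) hyn
      (nonTip_of_dvd hG hadm (c.mem 1) (QPath.divides_of_mul?_left hyb)) (by omega) (by omega)
      hbl) ⟨1, (inV_two_iff hG hadm _).2 ⟨hl, ?_, ?_⟩, (inV_one_iff hG hadm c).2 ⟨hl, hE⟩, c.w 1,
        hyb, ?_⟩
    · exact (ufEdge_arrow_iff hG hadm hl hyn).2 ⟨t, htG, hy⟩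
    · exact not_ufEdge_of_nonTip hG hadm (p := y) (q := b) (by omega) hyb (c.mem 1)
    · funext i
      fin_cases i <;> rfl
  · rintro ⟨hl, z, hzG, hz⟩
    have hE : UfEdge G (c.w 0) (c.w 1) :=
      (ufEdge_arrow_iff hG hadm hl (c.mem 1)).2 ⟨z, hzG, hz⟩
    refine ⟨?_, fun c' hc' => ?_⟩
    · rintro c' ⟨m, h1, h2, -⟩
      fin_cases m
      · exact (inV_zero_iff hG hadm c).1 h2 hl
      · exact ((inV_one_iff hG hadm c).1 h2).2 hE
    · rw [anickMatching_one_iff hG hadm, hz] at hc'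
      exact c'.mem 0 (Option.some.inj hc'.2 ▸ hG.tipSet_subset hzG)

variable (I G) in
omit hG hadm in
/-- The critical cells of degree zero are the vertices. -/
def criticalZeroEquiv : AnickCell I G 0 ≃ pathsOfLength Q 0 := by
  refine Equiv.ofBijective (fun c => ⟨.vertex (c.1.v 0), rfl⟩) ⟨fun c d h => ?_, fun p => ?_⟩
  · have h1 : c.1.v 0 = d.1.v 0 := congrArg (fun x => x.1.source) h
    refine Subtype.ext (Cell.ext ?_ (funext fun r => r.elim0))
    funext i
    fin_cases i
    exact h1
  · refine ⟨⟨Cell.zero I p.1.source, isCritical_zero _⟩, Subtype.ext ?_⟩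
    exact (QPath.exists_vertex_of_length_zero p.2).symm

include hI in
/-- The critical cells of degree one are the arrows. -/
theorem exists_criticalOneEquiv : ∃ κ : AnickCell I G 1 ≃ pathsOfLength Q 1,
    ∀ c, (κ c).1 = c.1.w 0 := by
  refine ⟨Equiv.ofBijective
    (fun c => ⟨c.1.w 0, (isCritical_one_iff hG hadm c.1).1 c.2⟩) ⟨fun c d h => ?_, fun p => ?_⟩,
    fun _ => rfl⟩
  · exact Subtype.ext (Cell.ext_one (congrArg Subtype.val h))
  · have hp : p.1.length = 1 := p.2
    exact ⟨⟨Cell.one p.1 (mem_nonTip_of_length hI (by omega)) (by omega),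
      (isCritical_one_iff hG hadm _).2 hp⟩, rfl⟩

include hI in
/-- The critical cells of degree two are the tips of the Gröbner basis. -/
theorem exists_criticalTwoEquiv : ∃ κ : AnickCell I G 2 ≃ tipSet G,
    ∀ c, QPath.mul? (c.1.w 0) (c.1.w 1) = some (κ c).1 := by
  have h := fun c : AnickCell I G 2 => (isCritical_two_iff hG hadm c.1).1 c.2
  choose h1 z hz hm using h
  refine ⟨Equiv.ofBijective (fun c => ⟨z c, hz c⟩) ⟨fun c d hcd => ?_, fun t => ?_⟩, hm⟩
  · have hcd' : z c = z d := congrArg Subtype.val hcd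
    have := QPath.mul?_unique (hm c) (hcd' ▸ hm d) ((h1 c).trans (h1 d).symm)
    exact Subtype.ext (Cell.ext_two this.1 this.2)
  · have hl := two_le_length_of_mem_tipSet hI (hG.tipSet_subset t.2)
    obtain ⟨p, q, hpq, hlp⟩ := QPath.exists_split t.1 1 (by omega)
    have hl' := QPath.length_mul? hpq
    let c : Cell I 2 := Cell.two p q (QPath.mul?_match hpq)
      (hG.nonTip_of_divides t.2 (QPath.divides_of_mul?_right hpq) (by omega))
      (hG.nonTip_of_divides t.2 (QPath.divides_of_mul?_left hpq) (by omega)) (by omega) (by omega)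
    have hc : IsCritical (anickMatching I G) 2 c :=
      (isCritical_two_iff hG hadm c).2 ⟨hlp, t.1, t.2, hpq⟩
    refine ⟨⟨c, hc⟩, Subtype.ext ?_⟩
    have := hm ⟨c, hc⟩
    exact Option.some.inj (this.symm.trans hpq)

end Critical

/-! ### Summing the weights of zigzag paths -/

section MorseSum

variable {R : Type*} [Ring R] {ι : ℕ → Type*} {C : ∀ n, ι n → Type*}
  [∀ n i, AddCommGroup (C n i)] [∀ n i, Module R (C n i)]
  (d : ∀ n (i : ι (n + 1)) (j : ι n), C (n + 1) i →ₗ[R] C n j)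
  (M : ∀ n, ι (n + 1) → ι n → Prop) {N : Type*} [AddCommGroup N] [Module R N] {n : ℕ}
  (g : ∀ j : Critical M n, C n j.1 →ₗ[R] N)

theorem sum_linearMap_comp {X Y α : Type*} [AddCommGroup X] [AddCommGroup Y] [Module R X]
    [Module R Y] (t : Finset α) (F : α → (Y →ₗ[R] N)) (f : X →ₗ[R] Y) :
    (∑ i ∈ t, F i) ∘ₗ f = ∑ i ∈ t, F i ∘ₗ f := by
  ext x
  simp

theorem inverseOrZero_apply {X Y : Type*} [AddCommGroup X] [AddCommGroup Y] [Module R X]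
    [Module R Y] {f : X →ₗ[R] Y} (hf : Function.Bijective f) (x : X) :
    inverseOrZero f (f x) = x := by
  rw [inverseOrZero, dif_pos hf]
  exact (LinearEquiv.ofBijective f hf).symm_apply_apply x

theorem IsCritical.not_matched {n : ℕ} {i : ι n} (h : IsCritical M n i) (i' : ι (n + 1)) :
    ¬ M n i' i := by
  cases n with
  | zero => exact h i'
  | succ n => exact h.1 i'

/-- There are finitely many zigzag paths from the vertex `c` to critical vertices, and the sum of
their weights, followed by the maps `g` on the critical summands, is `s`. -/
def HasZigZagSum (c : ι (n + 1)) (s : C (n + 1) c →ₗ[R] N) : Prop :=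
  Finite (Σ j : Critical M n, ZigZag d M n c j.1) ∧
    ∑ᶠ p : (Σ j : Critical M n, ZigZag d M n c j.1), g p.1 ∘ₗ p.2.weight = s

/-- What can follow the first thick arrow of a zigzag path, if this arrow ends at `u`: nothing if
`u` is critical, or a dotted arrow and another zigzag path. -/
def ZigZagTail (u : ι n) : Type _ :=
  {j : Critical M n // j.1 = u} ⊕
    Σ i' : {i' : ι (n + 1) // M n i' u}, Σ j : Critical M n, ZigZag d M n i'.1 j.1

/-- A zigzag path is its first thick arrow followed by a tail. -/
def zigZagEquiv (c : ι (n + 1)) :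
    (Σ u : {u : ι n // IsThick d M n c u}, ZigZagTail d M u.1) ≃
      Σ j : Critical M n, ZigZag d M n c j.1 where
  toFun
    | ⟨u, .inl j⟩ => ⟨j.1, .thick c j.1.1 (j.2.symm ▸ u.2)⟩
    | ⟨u, .inr ⟨i', j, p⟩⟩ => ⟨j, .cons c u.1 i'.1 j.1 u.2 i'.2 p⟩
  invFun
    | ⟨j, .thick _ _ h⟩ => ⟨⟨j.1, h⟩, .inl ⟨j, rfl⟩⟩
    | ⟨j, .cons _ u i' _ h hm p⟩ => ⟨⟨u, h⟩, .inr ⟨⟨i', hm⟩, j, p⟩⟩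
  left_inv
    | ⟨⟨_, _⟩, .inl ⟨_, rfl⟩⟩ => rfl
    | ⟨⟨_, _⟩, .inr ⟨_, _, _⟩⟩ => rfl
  right_inv := by
    rintro ⟨⟨j, hj⟩, p⟩
    cases p <;> rfl

/-- The weight of a tail, followed by the map `g` on the critical summand at its end. -/
def ZigZagTail.weight {u : ι n} : ZigZagTail d M u → (C n u →ₗ[R] N)
  | .inl ⟨j, h⟩ => Eq.rec (motive := fun u _ => C n u →ₗ[R] N) (g j) h
  | .inr ⟨i', j, p⟩ => (g j ∘ₗ p.weight) ∘ₗ (-(inverseOrZero (d n i'.1 u)))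

theorem weight_zigZagEquiv (c : ι (n + 1)) :
    ∀ x : Σ u : {u : ι n // IsThick d M n c u}, ZigZagTail d M u.1,
      g (zigZagEquiv d M c x).1 ∘ₗ (zigZagEquiv d M c x).2.weight =
        ZigZagTail.weight d M g x.2 ∘ₗ d n c x.1.1
  | ⟨⟨_, _⟩, .inl ⟨_, rfl⟩⟩ => rfl
  | ⟨⟨_, _⟩, .inr ⟨_, _, _⟩⟩ => rfl

variable {d M g}

/-- The sum of the weights of all zigzag paths from `c`, by recursion: after the first thick arrow
`c → u` the path ends if `u` is critical, and otherwise goes back along the unique arrow of the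
matching that ends at `u`. -/
theorem hasZigZagSum_of_tails {c : ι (n + 1)} (hfin : {u : ι n | d n c u ≠ 0}.Finite)
    (S : ∀ u : ι n, C n u →ₗ[R] N)
    (hS : ∀ u, IsThick d M n c u → (∃ hu : IsCritical M n u, S u = g ⟨u, hu⟩) ∨
      ∃ i' s, M n i' u ∧ (∀ i'', M n i'' u → i'' = i') ∧ HasZigZagSum d M g i' s ∧
        S u = s ∘ₗ (-(inverseOrZero (d n i' u)))) (s : C (n + 1) c →ₗ[R] N)
    (hs : ∀ F : ι n → (C (n + 1) c →ₗ[R] N), (∀ u, M n c u → F u = 0) →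
      (∀ u, ¬ M n c u → F u = S u ∘ₗ d n c u) → ∑ᶠ u, F u = s) :
    HasZigZagSum d M g c s := by
  classical
  have hT : Finite {u : ι n // IsThick d M n c u} := (hfin.subset fun u h => h.1).to_subtype
  have hempty : ∀ u, (∃ i', M n i' u) → IsEmpty {j : Critical M n // j.1 = u} := by
    rintro u ⟨i', h⟩
    exact ⟨fun j => (j.2 ▸ IsCritical.not_matched M j.1.2 i') h⟩
  have htail : ∀ u : {u : ι n // IsThick d M n c u}, Finite (ZigZagTail d M u.1) ∧
      ∑ᶠ t : ZigZagTail d M u.1, ZigZagTail.weight d M g t = S u.1 := by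
    rintro ⟨u, hu⟩
    rcases hS u hu with ⟨hc, he⟩ | ⟨i', s', hm, huniq, ⟨hf, hsum⟩, he⟩
    · have h1 : IsEmpty (Σ i' : {i' : ι (n + 1) // M n i' u},
          Σ j : Critical M n, ZigZag d M n i'.1 j.1) :=
        ⟨fun x => IsCritical.not_matched M hc x.1.1 x.1.2⟩
      let h2 : Unique (ZigZagTail d M u) :=
        { default := .inl ⟨⟨u, hc⟩, rfl⟩
          uniq := by
            rintro (⟨j, rfl⟩ | x)
            · rfl
            · exact h1.elim x }
      refine ⟨inferInstance, ?_⟩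
      rw [finsum_unique, he]
      rfl
    · have h1 := hempty u ⟨i', hm⟩
      let e : (Σ j : Critical M n, ZigZag d M n i' j.1) ≃ ZigZagTail d M u :=
        { toFun := fun p => .inr ⟨⟨i', hm⟩, p⟩
          invFun := fun
            | .inl j => h1.elim j
            | .inr x => huniq x.1.1 x.1.2 ▸ x.2
          left_inv := fun p => rfl
          right_inv := by
            rintro (j | ⟨⟨i'', hm'⟩, p⟩)
            · exact h1.elim j
            · obtain rfl := huniq i'' hm'
              rfl }
      refine ⟨Finite.of_equiv _ e, ?_⟩
      have := Fintype.ofFinite (Σ j : Critical M n, ZigZag d M n i' j.1)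
      rw [← finsum_comp_equiv e, he, ← hsum, finsum_eq_sum_of_fintype, finsum_eq_sum_of_fintype,
        sum_linearMap_comp]
      rfl
  have hfin' : ∀ u : {u : ι n // IsThick d M n c u}, Finite (ZigZagTail d M u.1) :=
    fun u => (htail u).1
  refine ⟨Finite.of_equiv _ (zigZagEquiv d M c), ?_⟩
  have := Fintype.ofFinite {u : ι n // IsThick d M n c u}
  have := fun u : {u : ι n // IsThick d M n c u} => Fintype.ofFinite (ZigZagTail d M u.1)
  rw [← finsum_comp_equiv (zigZagEquiv d M c),
    finsum_congr fun x => weight_zigZagEquiv d M g c x, finsum_eq_sum_of_fintype,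
    Fintype.sum_sigma,
    Finset.sum_congr rfl fun u _ => (sum_linearMap_comp _ _ _).symm.trans
      (congrArg (· ∘ₗ d n c u.1) ((finsum_eq_sum_of_fintype _).symm.trans (htail u).2)),
    ← finsum_eq_sum_of_fintype]
  rw [← hs (fun u => if IsThick d M n c u then S u ∘ₗ d n c u else 0)
    (fun u hu => if_neg fun h => h.2 hu) (fun u hu => ?_)]
  · rw [← finsum_mem_univ fun u => if IsThick d M n c u then S u ∘ₗ d n c u else 0]
    rw [finsum_subtype_eq_finsum_cond (p := fun u => IsThick d M n c u)
      (f := fun u => S u ∘ₗ d n c u)]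
    refine finsum_congr fun u => ?_
    split_ifs with h <;> simp [h]
  · by_cases h : d n c u = 0
    · simp [h]
    · exact if_pos ⟨h, hu⟩

/-- The Morse differential on a critical summand, followed by `f`, is the sum of the weights. -/
theorem HasZigZagSum.apply_morseD {f : MorseModule C M n →ₗ[R] N} {c : Critical M (n + 1)}
    {s : C (n + 1) c.1 →ₗ[R] N} [DecidableEq (Critical M n)] [DecidableEq (Critical M (n + 1))]
    (h : HasZigZagSum d M (fun j => f ∘ₗ DirectSum.lof R (Critical M n) (fun j => C n j.1) j)
      c.1 s) (x : C (n + 1) c.1) :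
    f (morseD d M n (DirectSum.lof R (Critical M (n + 1)) (fun j => C (n + 1) j.1) c x)) = s x := by
  obtain ⟨hfin, rfl⟩ := h
  have := Fintype.ofFinite (Σ j : Critical M n, ZigZag d M n c.1 j.1)
  rw [morseD]
  have e := DirectSum.toModule_lof R (ι := Critical M (n + 1)) (M := fun j => C (n + 1) j.1)
    (N := MorseModule C M n) (φ := fun i =>
    ∑ᶠ p : (Σ j : Critical M n, ZigZag d M n i.1 j.1),
      DirectSum.lof R (Critical M n) (fun j => C n j.1) p.1 ∘ₗ p.2.weight) c x
  refine (congrArg f ?_).trans ((congrArg f e).trans ?_)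
  · congr!
  · rw [finsum_eq_sum_of_fintype, finsum_eq_sum_of_fintype, LinearMap.sum_apply, map_sum,
      LinearMap.sum_apply]
    rfl

end MorseSum

/-! ### Cochains of the Anick resolution -/

section Summand

variable {k : Type*} [Field k] {A : Type*} [Ring A] [Algebra k A]

theorem Env.tmul_mul_tmul (a b a' b' : A) :
    Env.tmul k a b * Env.tmul k a' b' = Env.tmul k (a * a') (b' * b) :=
  Algebra.TensorProduct.tmul_mul_tmul a a' (MulOpposite.op b) (MulOpposite.op b')

theorem Env.smul_one_smul (x : k) (a : A) : (x • (1 : Env k A)) • a = x • a := by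
  have h : x • (1 : Env k A) = Env.tmul k (x • (1 : A)) 1 :=
    (TensorProduct.smul_tmul' x (1 : A) (1 : Aᵐᵒᵖ))
  rw [h, Env.tmul_smul]
  simp

end Summand

section Cochain

variable {k : Type*} [Field k] {Q : Type*} [Quiver Q] [Fintype Q]
  {I : Ideal (PathAlgebra k Q)} [I.IsTwoSided] [LinearOrder (QPath Q)]

namespace Cell

variable {n : ℕ}

theorem idem_mul_idem (c : Cell I n) : c.idem * c.idem = c.idem := by
  rw [idem, Env.tmul_mul_tmul, cls_vertex_mul_self, cls_vertex_mul_self]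

theorem mul_idem {c : Cell I n} (y : c.Summand) : y.1 * c.idem = y.1 := by
  obtain ⟨y, hy⟩ := y
  obtain ⟨z, rfl⟩ := Submodule.mem_span_singleton.1 hy
  change z * c.idem * c.idem = z * c.idem
  rw [mul_assoc, idem_mul_idem]

theorem smul_gen {c : Cell I n} (y : c.Summand) : y.1 • c.gen = y :=
  Subtype.ext (mul_idem y)

theorem idem_smul (c : Cell I n) (a : PathAlgebra k Q ⧸ I) :
    c.idem • a = cls I (.vertex (c.v 0)) * a * cls I (.vertex (c.v (Fin.last n))) :=
  Env.tmul_smul _ _ _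

theorem idem_smul_of_mem {c : Cell I n} {p : QPath Q} {a : PathAlgebra k Q ⧸ I}
    (ht : c.v 0 = p.target) (hs : c.v (Fin.last n) = p.source) (h : a ∈ parallelTo I p) :
    c.idem • a = a := by
  rw [idem_smul, ht, hs]
  exact h

/-- The linear map on the summand of a cell that sends the generator to `t a s`, where `t` and `s`
are the vertices at the ends of the cell. -/
def actMap (c : Cell I n) (a : PathAlgebra k Q ⧸ I) :
    c.Summand →ₗ[Env k (PathAlgebra k Q ⧸ I)] (PathAlgebra k Q ⧸ I) :=
  LinearMap.toSpanSingleton (Env k (PathAlgebra k Q ⧸ I)) (PathAlgebra k Q ⧸ I) a ∘ₗ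
    Submodule.subtype _

theorem actMap_apply (c : Cell I n) (a : PathAlgebra k Q ⧸ I) (y : c.Summand) :
    c.actMap a y = y.1 • a := rfl

theorem actMap_gen (c : Cell I n) (a : PathAlgebra k Q ⧸ I) : c.actMap a c.gen = c.idem • a := rfl

theorem hom_ext {c : Cell I n} {N : Type*} [AddCommGroup N]
    [Module (Env k (PathAlgebra k Q ⧸ I)) N]
    {f g : c.Summand →ₗ[Env k (PathAlgebra k Q ⧸ I)] N} (h : f c.gen = g c.gen) : f = g := by
  ext1 y
  rw [← smul_gen y, map_smul, map_smul, h]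

theorem idem_smul_apply_gen {c : Cell I n}
    (f : c.Summand →ₗ[Env k (PathAlgebra k Q ⧸ I)] (PathAlgebra k Q ⧸ I)) :
    c.idem • f c.gen = f c.gen := by
  rw [← map_smul]
  exact congrArg f (smul_gen c.gen)

end Cell

variable [WellFoundedLT (QPath Q)] {G : Set (PathAlgebra k Q)} {n : ℕ}

theorem anickCochain_ext {f g : AnickCochain I G n}
    (h : ∀ c, f (anickGen I G n c) = g (anickGen I G n c)) : f = g := by
  classical
  exact DirectSum.linearMap_ext _ fun c => Cell.hom_ext (h c)

theorem apply_anickGen (f : AnickCochain I G n) (c : AnickCell I G n) :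
    c.1.idem • f (anickGen I G n c) = f (anickGen I G n c) := by
  classical
  exact Cell.idem_smul_apply_gen (c := c.1) (f ∘ₗ DirectSum.lof _ (AnickCell I G n)
    (fun c => c.1.Summand) c)

variable (I G) in
open Classical in
/-- The cochain that sends the generators of the Anick resolution to given elements, multiplied by
the vertices at the ends of the cells. -/
def cochainOf (a : AnickCell I G n → PathAlgebra k Q ⧸ I) : AnickCochain I G n :=
  DirectSum.toModule _ _ _ fun c => c.1.actMap (a c)

theorem cochainOf_anickGen (a : AnickCell I G n → PathAlgebra k Q ⧸ I) (c : AnickCell I G n) :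
    cochainOf I G a (anickGen I G n c) = c.1.idem • a c := by
  classical
  rw [cochainOf, anickGen, DirectSum.toModule_lof, Cell.actMap_gen]

/-- If the critical cells of degree `n` correspond to the elements of a finite set `X` of paths,
the `n`-cochains correspond to the elements of `k(X // 𝓑)`. -/
theorem exists_cochainEquiv {X : Set (QPath Q)} (hX : X.Finite) (κ : AnickCell I G n ≃ X)
    (hs : ∀ c, c.1.v (Fin.last n) = (κ c).1.source) (ht : ∀ c, c.1.v 0 = (κ c).1.target) :
    ∃ Φ : AnickCochain I G n ≃ₗ[k] ParallelSpace k X (basisPaths I),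
      ∀ f c, family I X (Φ f) (κ c).1 = f (anickGen I G n c) := by
  have hidem : ∀ ξ c, (c : AnickCell I G n).1.idem • family I X ξ (κ c).1 =
      family I X ξ (κ c).1 := fun ξ c =>
    Cell.idem_smul_of_mem (ht c) (hs c) (family_mem_parallelTo I ξ _)
  let U : ParallelSpace k X (basisPaths I) →ₗ[k] AnickCochain I G n :=
    { toFun := fun ξ => cochainOf I G fun c => family I X ξ (κ c).1
      map_add' := fun ξ ζ => anickCochain_ext fun c => by
        rw [LinearMap.add_apply]
        simp only [cochainOf_anickGen, hidem]
        rw [map_add, Pi.add_apply]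
      map_smul' := fun x ξ => anickCochain_ext fun c => by
        rw [LinearMap.smul_apply]
        simp only [cochainOf_anickGen, hidem]
        rw [map_smul, Pi.smul_apply, RingHom.id_apply] }
  have hU : ∀ ξ c, U ξ (anickGen I G n c) = family I X ξ (κ c).1 := fun ξ c =>
    (cochainOf_anickGen _ c).trans (hidem ξ c)
  have hbij : Function.Bijective U := by
    constructor
    · intro ξ ζ h
      refine family_ext I fun p hp => ?_
      obtain ⟨c, hc⟩ := κ.surjective ⟨p, hp⟩
      have : p = (κ c).1 := by rw [hc]
      rw [this, ← hU, ← hU, h]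
    · intro f
      classical
      obtain ⟨ξ, hξ⟩ := exists_family_eq I hX
        (fun p => if h : p ∈ X then f (anickGen I G n (κ.symm ⟨p, h⟩)) else 0) fun p hp => by
          have h := apply_anickGen f (κ.symm ⟨p, hp⟩)
          rw [Cell.idem_smul, hs, ht, Equiv.apply_symm_apply] at h
          rw [dif_pos hp]
          exact h
      refine ⟨ξ, anickCochain_ext fun c => ?_⟩
      rw [hU, hξ _ (κ c).2, dif_pos (κ c).2]
      simp
  refine ⟨(LinearEquiv.ofBijective U hbij).symm, fun f c => ?_⟩
  obtain ⟨ξ, rfl⟩ := hbij.2 f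
  rw [hU]
  exact congrArg (fun ζ => family I X ζ (κ c).1)
    ((LinearEquiv.ofBijective U hbij).symm_apply_apply ξ)

end Cochain

/-! ### The differential of the Anick resolution in low degrees -/

section Differential

variable {k : Type*} [Field k] {Q : Type*} [Quiver Q] [Fintype Q]
  {I : Ideal (PathAlgebra k Q)} [I.IsTwoSided] [LinearOrder (QPath Q)] [WellFoundedLT (QPath Q)]

theorem actMap_comp_barD {n : ℕ} (c : Cell I (n + 1)) {u : Cell I n} {a : PathAlgebra k Q ⧸ I}
    (ha : u.idem • a = a) : u.actMap a ∘ₗ barD I n c u = c.actMap (barCoeff I n c u • a) := by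
  refine Cell.hom_ext ?_
  change (c.idem * barCoeff I n c u * u.idem) • a = c.idem • barCoeff I n c u • a
  rw [mul_smul, mul_smul, ha]

theorem barD_eq_zero {n : ℕ} {c : Cell I (n + 1)} {u : Cell I n} (h : barCoeff I n c u = 0) :
    barD I n c u = 0 := by
  refine LinearMap.ext fun y => Subtype.ext ?_
  change y.1 * barCoeff I n c u * u.idem = 0
  rw [h, mul_zero, zero_mul]

theorem finsum_actMap {n : ℕ} (c : Cell I n) {α : Type*} (a : α → PathAlgebra k Q ⧸ I)
    (ha : (Function.support a).Finite) : ∑ᶠ i, c.actMap (a i) = c.actMap (∑ᶠ i, a i) := by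
  let F : PathAlgebra k Q ⧸ I →+
      (c.Summand →ₗ[Env k (PathAlgebra k Q ⧸ I)] (PathAlgebra k Q ⧸ I)) :=
    { toFun := c.actMap
      map_zero' := LinearMap.ext fun y => smul_zero y.1
      map_add' := fun a b => LinearMap.ext fun y => smul_add y.1 a b }
  exact (F.map_finsum ha).symm

theorem Cell.eq_zero_iff {c : Cell I 0} {e : Q} : c = Cell.zero I e ↔ c.v 0 = e := by
  constructor
  · rintro rfl
    rfl
  · rintro rfl
    refine Cell.ext (funext fun i => ?_) (funext fun r => r.elim0)
    fin_cases i
    rfl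

open Classical in
theorem barCoeff_zero (c : Cell I 1) (u : Cell I 0) :
    barCoeff I 0 c u =
      (if u = Cell.zero I (c.v 1) then Env.tmul k (cls I (c.w 0)) 1 else 0) -
        (if u = Cell.zero I (c.v 0) then Env.tmul k 1 (cls I (c.w 0)) else 0) := by
  have h1 : (u.v = Fin.tail c.v ∧ u.w = Fin.tail c.w) ↔ u = Cell.zero I (c.v 1) := by
    rw [Cell.eq_zero_iff]
    refine ⟨fun h => congrFun h.1 0, fun h => ⟨funext fun i => ?_, funext fun r => r.elim0⟩⟩
    fin_cases i
    exact h
  have h2 : (u.v = Fin.init c.v ∧ u.w = Fin.init c.w) ↔ u = Cell.zero I (c.v 0) := by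
    rw [Cell.eq_zero_iff]
    refine ⟨fun h => congrFun h.1 0, fun h => ⟨funext fun i => ?_, funext fun r => r.elim0⟩⟩
    fin_cases i
    exact h
  rw [barCoeff]
  simp only [h1, h2, Finset.univ_eq_empty, Finset.sum_empty, add_zero, zero_add, pow_one,
    neg_smul, one_smul, ← sub_eq_add_neg]
  rfl

open Classical in
theorem barCoeff_one (c : Cell I 2) (u : Cell I 1) :
    barCoeff I 1 c u =
      (if u.w 0 = c.w 1 then Env.tmul k (cls I (c.w 0)) 1 else 0) -
        (monomialBasis I).repr (cls I (c.w 0) * cls I (c.w 1)) ⟨u.w 0, u.mem 0⟩ •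
          (1 : Env k (PathAlgebra k Q ⧸ I)) +
        (if u.w 0 = c.w 0 then Env.tmul k 1 (cls I (c.w 1)) else 0) := by
  have hv0 := u.target_eq 0
  have hv1 := u.source_eq 0
  have h1 : (u.v = Fin.tail c.v ∧ u.w = Fin.tail c.w) ↔ u.w 0 = c.w 1 := by
    refine ⟨fun h => congrFun h.2 0, fun h => ⟨funext fun i => ?_, funext fun i => ?_⟩⟩
    · fin_cases i
      · exact hv0.symm.trans ((congrArg QPath.target h).trans (c.target_eq 1))
      · exact hv1.symm.trans ((congrArg QPath.source h).trans (c.source_eq 1))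
    · fin_cases i
      exact h
  have h2 : (u.v = Fin.init c.v ∧ u.w = Fin.init c.w) ↔ u.w 0 = c.w 0 := by
    refine ⟨fun h => congrFun h.2 0, fun h => ⟨funext fun i => ?_, funext fun i => ?_⟩⟩
    · fin_cases i
      · exact hv0.symm.trans ((congrArg QPath.target h).trans (c.target_eq 0))
      · exact hv1.symm.trans ((congrArg QPath.source h).trans (c.source_eq 0))
    · fin_cases i
      exact h
  have h3 : ∀ b : QPath Q, u.w = Fin.contractNth (Fin.castSucc (0 : Fin 1)) (fun _ _ => b) c.w ↔
      u.w 0 = b := by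
    refine fun b => ⟨fun h => congrFun h 0, fun h => funext fun i => ?_⟩
    fin_cases i
    exact h
  rw [barCoeff]
  simp only [h1, h2, Finset.univ_unique, Finset.sum_singleton, Fin.default_eq_zero, h3]
  rw [Finsupp.sum, Finset.sum_eq_single ⟨u.w 0, u.mem 0⟩, if_pos rfl]
  · simp [sub_eq_add_neg]
  · intro b _ hb
    exact if_neg fun h => hb (Subtype.ext h.symm)
  · intro h
    rw [Finsupp.notMem_support_iff.1 h, zero_smul, ite_self]

end Differential

section DifferentialSums

variable {k : Type*} [Field k] {Q : Type*} [Quiver Q] [Fintype Q]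
  {I : Ideal (PathAlgebra k Q)} [I.IsTwoSided] [LinearOrder (QPath Q)] [WellFoundedLT (QPath Q)]

theorem Cell.w_injective : Function.Injective fun u : Cell I 1 => u.w 0 :=
  fun _ _ h => Cell.ext_one h

/-- The cells that occur in the differential of `[w₁|w₂]`. -/
theorem barCoeff_one_ne_zero {c : Cell I 2} {u : Cell I 1} (h : barCoeff I 1 c u ≠ 0) :
    u.w 0 = c.w 1 ∨ u.w 0 = c.w 0 ∨
      (monomialBasis I).repr (cls I (c.w 0) * cls I (c.w 1)) ⟨u.w 0, u.mem 0⟩ ≠ 0 := by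
  classical
  by_contra! hcon
  apply h
  rw [barCoeff_one, if_neg hcon.1, if_neg hcon.2.1, hcon.2.2, zero_smul, sub_zero, add_zero]

theorem finite_barCoeff_one (c : Cell I 2) : {u : Cell I 1 | barCoeff I 1 c u ≠ 0}.Finite := by
  have hfin : ({c.w 1, c.w 0} ∪ Subtype.val '' (((monomialBasis I).repr
      (cls I (c.w 0) * cls I (c.w 1))).support : Set (nonTip (I : Set (PathAlgebra k Q))))).Finite :=
    (Set.toFinite _).union ((Finset.finite_toSet _).image _)
  refine (hfin.preimage (f := fun u : Cell I 1 => u.w 0) Cell.w_injective.injOn).subset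
    fun u hu => ?_
  rcases barCoeff_one_ne_zero hu with h | h | h
  · exact Or.inl (Or.inl h)
  · exact Or.inl (Or.inr h)
  · exact Or.inr ⟨⟨u.w 0, u.mem 0⟩, Finsupp.mem_support_iff.2 h, rfl⟩

theorem barCoeff_one_smul (c : Cell I 2) (α : QPath Q → PathAlgebra k Q ⧸ I) (u : Cell I 1)
    [DecidableEq (QPath Q)] :
    barCoeff I 1 c u • α (u.w 0) =
      (if u.w 0 = c.w 1 then cls I (c.w 0) * α (c.w 1) else 0) -
        (monomialBasis I).repr (cls I (c.w 0) * cls I (c.w 1)) ⟨u.w 0, u.mem 0⟩ • α (u.w 0) +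
      (if u.w 0 = c.w 0 then α (c.w 0) * cls I (c.w 1) else 0) := by
  rw [barCoeff_one, add_smul, sub_smul, Env.smul_one_smul]
  congr 1
  · congr 1
    split_ifs with h
    · rw [h, Env.tmul_smul, mul_one]
    · rw [zero_smul]
  · split_ifs with h
    · rw [h, Env.tmul_smul, one_mul]
    · rw [zero_smul]

/-- The cells of degree one are the elements of `𝓑` of positive length, so a family that vanishes on
the vertices can be summed over either. -/
theorem finsum_repr_smul (a : PathAlgebra k Q ⧸ I) (α : QPath Q → PathAlgebra k Q ⧸ I)
    (hα : ∀ e : Q, α (.vertex e) = 0) :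
    (Function.support fun u : Cell I 1 =>
        (monomialBasis I).repr a ⟨u.w 0, u.mem 0⟩ • α (u.w 0)).Finite ∧
      ∑ᶠ u : Cell I 1, (monomialBasis I).repr a ⟨u.w 0, u.mem 0⟩ • α (u.w 0) =
        ((monomialBasis I).repr a).sum fun b x => x • α b.1 := by
  let φ : Cell I 1 → nonTip (I : Set (PathAlgebra k Q)) := fun u => ⟨u.w 0, u.mem 0⟩
  have hφ : Function.Injective φ := fun u v h => Cell.w_injective (congrArg Subtype.val h)
  let F : nonTip (I : Set (PathAlgebra k Q)) → PathAlgebra k Q ⧸ I :=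
    fun b => (monomialBasis I).repr a b • α b.1
  have hF : Function.support F ⊆ ((monomialBasis I).repr a).support := fun b hb =>
    Finsupp.mem_support_iff.2 fun h => hb (by simp only [F, h, zero_smul])
  have hrange : Function.support F ⊆ Set.range φ := fun b hb => by
    have hl : 0 < b.1.length := by
      by_contra hl
      apply hb
      have := QPath.exists_vertex_of_length_zero (p := b.1) (by omega)
      simp only [F]
      rw [this, hα, smul_zero]
    exact ⟨Cell.one b.1 b.2 hl, rfl⟩
  refine ⟨(((Finset.finite_toSet _).subset hF).preimage hφ.injOn).subset fun u hu => hu, ?_⟩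
  change ∑ᶠ u, F (φ u) = _
  rw [← finsum_mem_range hφ, finsum_mem_def, Set.indicator_eq_self.2 hrange,
    finsum_eq_sum_of_support_subset F hF]
  rfl

/-- The differential of `[w₁|w₂]` applied to a family indexed by the cells of degree one. -/
theorem finsum_barCoeff_one (c : Cell I 2) (α : QPath Q → PathAlgebra k Q ⧸ I)
    (hα : ∀ e : Q, α (.vertex e) = 0) :
    ∑ᶠ u : Cell I 1, barCoeff I 1 c u • α (u.w 0) =
      cls I (c.w 0) * α (c.w 1) -
        ((monomialBasis I).repr (cls I (c.w 0) * cls I (c.w 1))).sum (fun b x => x • α b.1) +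
      α (c.w 0) * cls I (c.w 1) := by
  classical
  have hsingle : ∀ (p : QPath Q) (hp : p ∈ nonTip (I : Set (PathAlgebra k Q))) (hl : 0 < p.length)
      (a : PathAlgebra k Q ⧸ I),
      (Function.support fun u : Cell I 1 => if u.w 0 = p then a else 0).Finite ∧
        ∑ᶠ u : Cell I 1, (if u.w 0 = p then a else 0) = a := by
    intro p hp hl a
    have hne : ∀ u : Cell I 1, u ≠ Cell.one p hp hl → (if u.w 0 = p then a else 0) = 0 :=
      fun u hu => if_neg fun h => hu (Cell.ext_one h)
    refine ⟨(Set.finite_singleton (Cell.one p hp hl)).subset fun u hu => ?_, ?_⟩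
    · by_contra h
      exact hu (hne u h)
    · rw [finsum_eq_single _ (Cell.one p hp hl) hne]
      exact if_pos rfl
  obtain ⟨f1, s1⟩ := hsingle (c.w 1) (c.mem 1) (c.pos 1) (cls I (c.w 0) * α (c.w 1))
  obtain ⟨f2, s2⟩ := hsingle (c.w 0) (c.mem 0) (c.pos 0) (α (c.w 0) * cls I (c.w 1))
  obtain ⟨f3, s3⟩ := finsum_repr_smul (cls I (c.w 0) * cls I (c.w 1)) α hα
  rw [finsum_congr fun u => barCoeff_one_smul c α u, finsum_add_distrib _ f2,
    finsum_sub_distrib f1 f3, s1, s2, s3]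
  exact (f1.union f3).subset (Function.support_sub _ _)

theorem sum_repr_pathDeriv (a : PathAlgebra k Q ⧸ I) (θ : QPath Q → PathAlgebra k Q ⧸ I) :
    ((monomialBasis I).repr a).sum (fun b x => x • pathDeriv I θ (of b.1)) =
      pathDeriv I θ (normalForm I a) := by
  rw [normalForm_eq_sum, Finsupp.sum, Finsupp.sum, map_sum]
  exact Finset.sum_congr rfl fun b _ => (map_smul _ _ _).symm

variable {G : Set (PathAlgebra k Q)}

open Classical in
/-- The restriction of a cochain to the summand of a critical cell. -/
def AnickCochain.onSummand {n : ℕ} (f : AnickCochain I G n) (j : AnickCell I G n) :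
    j.1.Summand →ₗ[Env k (PathAlgebra k Q ⧸ I)] (PathAlgebra k Q ⧸ I) :=
  f ∘ₗ DirectSum.lof (Env k (PathAlgebra k Q ⧸ I)) (AnickCell I G n) (fun c => c.1.Summand) j

theorem AnickCochain.onSummand_gen {n : ℕ} (f : AnickCochain I G n) (j : AnickCell I G n) :
    AnickCochain.onSummand f j j.1.gen = f (anickGen I G n j) := rfl

/-- The value of a coboundary at a generator, from the sum of the weights of the zigzag paths. -/
theorem anickDelta_anickGen {n : ℕ} {f : AnickCochain I G n} {c : AnickCell I G (n + 1)}
    {s : c.1.Summand →ₗ[Env k (PathAlgebra k Q ⧸ I)] (PathAlgebra k Q ⧸ I)}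
    (h : HasZigZagSum (barD I) (anickMatching I G) (AnickCochain.onSummand f) c.1 s) :
    anickDelta I G n f (anickGen I G (n + 1) c) = s c.1.gen := by
  classical
  exact HasZigZagSum.apply_morseD (f := f) h c.1.gen

/-- The coboundary in degree zero. -/
theorem anickDelta_zero_apply (f : AnickCochain I G 0)
    (x : QPath Q → PathAlgebra k Q ⧸ I)
    (hx : ∀ c : AnickCell I G 0, f (anickGen I G 0 c) = x (.vertex (c.1.v 0)))
    (c : AnickCell I G 1) :
    anickDelta I G 0 f (anickGen I G 1 c) =
      cls I (c.1.w 0) * x (.vertex (c.1.w 0).source) -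
        x (.vertex (c.1.w 0).target) * cls I (c.1.w 0) := by
  classical
  have hcrit : ∀ u : Cell I 0, IsCritical (anickMatching I G) 0 u := isCritical_zero
  have hxu : ∀ u : Cell I 0, u.idem • x (.vertex (u.v 0)) = x (.vertex (u.v 0)) := fun u => by
    rw [← hx ⟨u, hcrit u⟩]
    exact apply_anickGen f ⟨u, hcrit u⟩
  have hfin : Finite (Cell I 0) :=
    Finite.of_injective (fun u : Cell I 0 => u.v 0) fun u v h =>
      (Cell.eq_zero_iff.2 h).trans (Cell.eq_zero_iff.2 rfl).symm
  set b : PathAlgebra k Q ⧸ I := cls I (c.1.w 0) * x (.vertex (c.1.w 0).source) -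
        x (.vertex (c.1.w 0).target) * cls I (c.1.w 0) with hb
  have hs : (c.1.w 0).source = c.1.v 1 := c.1.source_eq 0
  have ht : (c.1.w 0).target = c.1.v 0 := c.1.target_eq 0
  have hsum : ∑ᶠ u : Cell I 0, barCoeff I 0 c.1 u • x (.vertex (u.v 0)) = b := by
    have h1 : ∀ u : Cell I 0, barCoeff I 0 c.1 u • x (.vertex (u.v 0)) =
        (if u = Cell.zero I (c.1.v 1) then cls I (c.1.w 0) * x (.vertex (c.1.w 0).source) else 0) -
        (if u = Cell.zero I (c.1.v 0) then x (.vertex (c.1.w 0).target) * cls I (c.1.w 0)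
          else 0) := by
      intro u
      rw [barCoeff_zero, sub_smul]
      congr 1
      · split_ifs with h
        · rw [Env.tmul_smul, mul_one, Cell.eq_zero_iff.1 h, hs]
        · rw [zero_smul]
      · split_ifs with h
        · rw [Env.tmul_smul, one_mul, Cell.eq_zero_iff.1 h, ht]
        · rw [zero_smul]
    rw [finsum_congr h1, finsum_sub_distrib (Set.toFinite _) (Set.toFinite _),
      finsum_eq_single _ (Cell.zero I (c.1.v 1)) fun u hu => if_neg hu,
      finsum_eq_single _ (Cell.zero I (c.1.v 0)) fun u hu => if_neg hu, if_pos rfl, if_pos rfl]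
  have key : HasZigZagSum (barD I) (anickMatching I G) (AnickCochain.onSummand f)
      c.1 (c.1.actMap b) := by
    refine hasZigZagSum_of_tails (Set.toFinite _)
      (fun u => u.actMap (x (.vertex (u.v 0)))) (fun u _ => Or.inl ⟨hcrit u, ?_⟩) _
      fun F _ hF => ?_
    · refine Cell.hom_ext ?_
      rw [Cell.actMap_gen, hxu]
      exact (hx ⟨u, hcrit u⟩).symm
    · rw [finsum_congr fun u => (hF u (IsCritical.not_matched _ (hcrit u) c.1)).trans
        (actMap_comp_barD c.1 (hxu u)), finsum_actMap _ _ (Set.toFinite _), hsum]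
  rw [anickDelta_anickGen key, Cell.actMap_gen]
  have hpar : ∀ e : Q, x (.vertex e) ∈ parallelTo I (.vertex e) := fun e => by
    have := hxu (Cell.zero I e)
    rwa [Cell.idem_smul] at this
  refine Cell.idem_smul_of_mem (p := c.1.w 0) ht.symm hs.symm (Submodule.sub_mem _ ?_ ?_)
  · refine mem_parallelTo_of ?_ ?_
    · rw [← mul_assoc, cls_vertex_target_mul]
    · rw [mul_assoc]
      exact congrArg _ (mul_vertex_of_mem_parallelTo (p := .vertex _) (hpar _))
  · refine mem_parallelTo_of ?_ ?_
    · rw [← mul_assoc]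
      exact congrArg (· * cls I (c.1.w 0))
        (vertex_mul_of_mem_parallelTo (p := .vertex _) (hpar _))
    · rw [mul_assoc, cls_mul_vertex_source]

section DegreeOne

variable (hG : IsReducedGroebnerBasis I G) (hadm : IsAdmissibleOrder Q)
  {f : AnickCochain I G 1} {θ : QPath Q → PathAlgebra k Q ⧸ I}
  (hθ : ∀ (a b : Q) (x : a ⟶ b), θ (.arrow x) ∈ parallelTo I (.arrow x))
  (hf : ∀ c : AnickCell I G 1, f (anickGen I G 1 c) = θ (c.1.w 0))

include hθ in
theorem idem_smul_pathDeriv {n : ℕ} {c : Cell I n} {p : QPath Q} (ht : c.v 0 = p.target)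
    (hs : c.v (Fin.last n) = p.source) :
    c.idem • pathDeriv I θ (of p) = pathDeriv I θ (of p) :=
  Cell.idem_smul_of_mem ht hs (pathDeriv_of_mem_parallelTo hθ p)

include hθ in
theorem idem_smul_pathDeriv_one (u : Cell I 1) :
    u.idem • pathDeriv I θ (of (u.w 0)) = pathDeriv I θ (of (u.w 0)) :=
  idem_smul_pathDeriv hθ (u.target_eq 0).symm (u.source_eq 0).symm

include hG hadm in
/-- The component of the differential along an arrow `[a|p] → [a p]` of the matching is minus the
identity of the generators. -/
theorem barCoeff_of_matching {c : Cell I 2} {u : Cell I 1} (h : anickMatching I G 1 c u) :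
    barCoeff I 1 c u = -1 := by
  classical
  obtain ⟨hl, hm⟩ := (anickMatching_one_iff hG hadm c u).1 h
  have hlen := QPath.length_mul? hm
  have hp0 := c.pos 0
  have hp1 := c.pos 1
  have h1 : u.w 0 ≠ c.w 1 := fun h => by
    have := congrArg QPath.length h
    omega
  have h2 : u.w 0 ≠ c.w 0 := fun h => by
    have := congrArg QPath.length h
    omega
  rw [barCoeff_one, if_neg h1, if_neg h2, cls_mul_some I hm, repr_cls ⟨u.w 0, u.mem 0⟩,
    Finsupp.single_eq_same]
  simp

include hG hadm in
theorem idem_eq_of_matching {c : Cell I 2} {u : Cell I 1} (h : anickMatching I G 1 c u) :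
    c.idem = u.idem := by
  obtain ⟨hl, hm⟩ := (anickMatching_one_iff hG hadm c u).1 h
  have h1 : c.v 0 = u.v 0 :=
    (c.target_eq 0).symm.trans ((QPath.target_mul? hm).symm.trans (u.target_eq 0))
  have h2 : c.v (Fin.last 2) = u.v (Fin.last 1) :=
    (c.source_eq 1).symm.trans ((QPath.source_mul? hm).symm.trans (u.source_eq 0))
  rw [Cell.idem, Cell.idem, h1, h2]

include hG hadm in
theorem barD_of_matching {c : Cell I 2} {u : Cell I 1} (h : anickMatching I G 1 c u)
    (y : c.Summand) : (barD I 1 c u y).1 = -y.1 := by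
  change y.1 * barCoeff I 1 c u * u.idem = _
  rw [barCoeff_of_matching hG hadm h, ← idem_eq_of_matching hG hadm h, mul_neg, mul_one, neg_mul,
    Cell.mul_idem]

include hG hadm in
theorem barD_bijective_of_matching {c : Cell I 2} {u : Cell I 1} (h : anickMatching I G 1 c u) :
    Function.Bijective (barD I 1 c u) := by
  constructor
  · intro y z hyz
    have := congrArg Subtype.val hyz
    rw [barD_of_matching hG hadm h, barD_of_matching hG hadm h] at this
    exact Subtype.ext (neg_injective this)
  · intro y
    refine ⟨⟨-y.1, ?_⟩, Subtype.ext ?_⟩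
    · rw [idem_eq_of_matching hG hadm h]
      exact Submodule.neg_mem _ y.2
    · rw [barD_of_matching hG hadm h]
      exact neg_neg _

include hG hadm in
/-- The differential sends the generator of the one cell to minus the generator of the other, so the
weight of the dotted arrow sends generator to generator. -/
theorem actMap_eq_of_matching {c : Cell I 2} {u : Cell I 1} (h : anickMatching I G 1 c u)
    (a : PathAlgebra k Q ⧸ I) :
    u.actMap a = c.actMap a ∘ₗ (-(inverseOrZero (barD I 1 c u))) := by
  ext1 y
  obtain ⟨z, rfl⟩ := (barD_bijective_of_matching hG hadm h).2 y
  rw [LinearMap.comp_apply, LinearMap.neg_apply,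
    inverseOrZero_apply (barD_bijective_of_matching hG hadm h), map_neg, Cell.actMap_apply,
    Cell.actMap_apply, barD_of_matching hG hadm h, neg_smul]

include hG hadm hθ hf in
/-- The hypothesis of `hasZigZagSum_of_tails` at a cell `u` of degree one, if the zigzag paths from its
matching partner are known: what follows `u = [a₁ ⋯ aₙ]` contributes `D(a₁ ⋯ aₙ)`. -/
theorem tail_alternative (u : Cell I 1)
    (ih : ∀ c, anickMatching I G 1 c u → HasZigZagSum (barD I) (anickMatching I G)
      (AnickCochain.onSummand f) c (c.actMap (pathDeriv I θ (of (u.w 0))))) :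
    (∃ hu : IsCritical (anickMatching I G) 1 u, u.actMap (pathDeriv I θ (of (u.w 0))) =
        AnickCochain.onSummand f ⟨u, hu⟩) ∨
      ∃ c s, anickMatching I G 1 c u ∧ (∀ c', anickMatching I G 1 c' u → c' = c) ∧
        HasZigZagSum (barD I) (anickMatching I G) (AnickCochain.onSummand f) c s ∧
        u.actMap (pathDeriv I θ (of (u.w 0))) = s ∘ₗ (-(inverseOrZero (barD I 1 c u))) := by
  by_cases hl : (u.w 0).length = 1
  · have hu : IsCritical (anickMatching I G) 1 u := (isCritical_one_iff hG hadm u).2 hl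
    refine Or.inl ⟨hu, Cell.hom_ext ?_⟩
    rw [Cell.actMap_gen, idem_smul_pathDeriv_one hθ, AnickCochain.onSummand_gen, hf]
    obtain ⟨a, b, x, hx⟩ := QPath.exists_arrow_of_length_one hl
    change pathDeriv I θ (of (u.w 0)) = θ (u.w 0)
    rw [hx, pathDeriv_arrow x (hθ a b x)]
  · obtain ⟨c, hc⟩ := exists_anickMatching_one hG hadm u hl
    exact Or.inr ⟨c, _, hc, fun c' hc' => anickMatching_one_unique hG hadm hc' hc, ih c hc,
      actMap_eq_of_matching hG hadm hc _⟩

include hG hadm hθ hf in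
/-- The sum of the weights of the zigzag paths from `[a|p]`, for an arrow `a` and a path `a p` in
`𝓑`, is `∑ᵢ a₁ ⋯ aᵢ₋₁ [aᵢ] aᵢ₊₁ ⋯ aₙ` if `a p = a₁ ⋯ aₙ`. -/
theorem hasZigZagSum_of_matching (m : ℕ) : ∀ (c : Cell I 2) (u : Cell I 1),
    anickMatching I G 1 c u → (u.w 0).length = m →
    HasZigZagSum (barD I) (anickMatching I G) (AnickCochain.onSummand f) c
      (c.actMap (pathDeriv I θ (of (u.w 0)))) := by
  classical
  induction m using Nat.strong_induction_on with
  | _ m ih =>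
    intro c u hcu hm
    obtain ⟨hl, hmul⟩ := (anickMatching_one_iff hG hadm c u).1 hcu
    have hlen := QPath.length_mul? hmul
    have hp1 := c.pos 1
    have huniq : ∀ v, anickMatching I G 1 c v ↔ v = u := fun v => by
      refine ⟨fun h => Cell.ext_one ?_, fun h => h ▸ hcu⟩
      rw [anickMatching_one_iff hG hadm, hmul] at h
      exact (Option.some.inj h.2).symm
    refine hasZigZagSum_of_tails ((finite_barCoeff_one c).subset fun v hv hb =>
      hv (barD_eq_zero hb)) (fun v => v.actMap (pathDeriv I θ (of (v.w 0))))
      (fun v hv => tail_alternative hG hadm hθ hf v fun c' hc' =>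
        ih (v.w 0).length ?_ c' v hc' rfl) _ fun F hF0 hF => ?_
    · have hb : barCoeff I 1 c v ≠ 0 := fun h => hv.1 (barD_eq_zero h)
      rcases barCoeff_one_ne_zero hb with h | h | h
      · rw [h]
        omega
      · rw [h]
        omega
      · rw [cls_mul_some I hmul, repr_cls ⟨u.w 0, u.mem 0⟩, Finsupp.single_apply_ne_zero] at h
        exact absurd ((huniq v).2 (Cell.ext_one (congrArg Subtype.val h.1))) hv.2
    · -- Leaving out the matched cell means to replace `D` by zero at the path `a p`.
      let α : QPath Q → PathAlgebra k Q ⧸ I := fun p =>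
        if p = u.w 0 then 0 else pathDeriv I θ (of p)
      have hα : ∀ e : Q, α (.vertex e) = 0 := fun e => by
        simp only [α]
        split_ifs
        · rfl
        · exact pathDeriv_vertex θ e
      have hF' : ∀ v, F v = c.actMap (barCoeff I 1 c v • α (v.w 0)) := by
        intro v
        by_cases hv : v = u
        · subst hv
          rw [hF0 v hcu]
          simp only [α, if_true, smul_zero]
          exact LinearMap.ext fun y => (smul_zero y.1).symm
        · rw [hF v fun h => hv ((huniq v).1 h),
            actMap_comp_barD c (idem_smul_pathDeriv_one hθ v)]
          simp only [α, if_neg fun h => hv (Cell.ext_one h)]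
      have h0 : c.w 0 ≠ u.w 0 := fun h => by
        have := congrArg QPath.length h
        omega
      have h1 : c.w 1 ≠ u.w 0 := fun h => by
        have := congrArg QPath.length h
        omega
      have hsum : (Finsupp.single (⟨u.w 0, u.mem 0⟩ : nonTip (I : Set (PathAlgebra k Q)))
          (1 : k)).sum (fun b x => x • α b.1) = 0 := by
        rw [Finsupp.sum_single_index (by rw [zero_smul])]
        simp [α]
      rw [finsum_congr hF', finsum_actMap c _ ((finite_barCoeff_one c).subset fun v hv hb =>
        hv (by simp only [hb, zero_smul])), finsum_barCoeff_one c α hα, cls_mul_some I hmul,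
        repr_cls ⟨u.w 0, u.mem 0⟩, hsum]
      simp only [α, if_neg h0, if_neg h1, sub_zero]
      rw [← of_mul_of_some hmul, pathDeriv_mul hθ]

include hG hadm hθ hf in
/-- The coboundary in degree one: the value at the generator of `Tip(g)` is `D(g)`, where `D` is the
derivation of the path algebra given by the values of the cochain on the arrows. -/
theorem anickDelta_one_apply {g : PathAlgebra k Q} (hg : g ∈ G) (c : AnickCell I G 2)
    (hc : QPath.mul? (c.1.w 0) (c.1.w 1) = some (tip g (hG.ne_zero hg))) :
    anickDelta I G 1 f (anickGen I G 2 c) = pathDeriv I θ g := by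
  have key : HasZigZagSum (barD I) (anickMatching I G) (AnickCochain.onSummand f) c.1
      (c.1.actMap (pathDeriv I θ g)) := by
    refine hasZigZagSum_of_tails ((finite_barCoeff_one c.1).subset fun v hv hb =>
      hv (barD_eq_zero hb)) (fun v => v.actMap (pathDeriv I θ (of (v.w 0))))
      (fun v hv => tail_alternative hG hadm hθ hf v fun c' hc' =>
        hasZigZagSum_of_matching hG hadm hθ hf _ c' v hc' rfl) _ fun F _ hF => ?_
    rw [finsum_congr fun v => (hF v (c.2.2 v)).trans
      (actMap_comp_barD c.1 (idem_smul_pathDeriv_one hθ v)), finsum_actMap c.1 _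
      ((finite_barCoeff_one c.1).subset fun v hv hb => hv (by simp only [hb, zero_smul])),
      finsum_barCoeff_one c.1 (fun p => pathDeriv I θ (of p)) (pathDeriv_vertex θ),
      sum_repr_pathDeriv, cls_mul_some I hc, normalForm_tip hG hg, map_sub, ← of_mul_of_some hc,
      pathDeriv_mul hθ]
    congr 1
    abel
  have hpar : pathDeriv I θ g ∈ parallelTo I (tip g (hG.ne_zero hg)) := by
    have hsum : pathDeriv I θ g = ∑ p ∈ (coeff g).support, pathDeriv I θ (coeff g p • of p) := by
      conv_lhs => rw [eq_sum_coeff g]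
      rw [map_sum]
    rw [hsum]
    refine Submodule.sum_mem _ fun p hp => ?_
    have h := hG.parallel_tip hg (Finsupp.mem_support_iff.1 hp)
    rw [map_smul, ← parallelTo_congr h.1 h.2]
    exact Submodule.smul_mem _ _ (pathDeriv_of_mem_parallelTo hθ p)
  rw [anickDelta_anickGen key, Cell.actMap_gen]
  exact Cell.idem_smul_of_mem ((c.1.target_eq 0).symm.trans (QPath.target_mul? hc).symm)
    ((c.1.source_eq 1).symm.trans (QPath.source_mul? hc).symm) hpar

end DegreeOne

end DifferentialSums

end QuiverHH

end

open QuiverHH in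
theorem proposition3p5 {k : Type*} [Field k] {Q : Type*} [Quiver Q] [Fintype Q]
    [∀ a b : Q, Fintype (a ⟶ b)] [LinearOrder (QPath Q)] [WellFoundedLT (QPath Q)]
    (hadm : IsAdmissibleOrder Q)
    (I : Ideal (PathAlgebra k Q)) [I.IsTwoSided]
    (hI : ∀ f ∈ I, ∀ p ∈ (PathAlgebra.coeff f).support, 2 ≤ p.length)
    (G : Finset (PathAlgebra k Q))
    (hG : IsReducedGroebnerBasis I (G : Set (PathAlgebra k Q))) :
    psi1 I G ∘ₗ psi0 I = 0 ∧
    (∃ (κ₀ : AnickCell I (G : Set (PathAlgebra k Q)) 0 ≃ pathsOfLength Q 0)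
      (κ₁ : AnickCell I (G : Set (PathAlgebra k Q)) 1 ≃ pathsOfLength Q 1)
      (κ₂ : AnickCell I (G : Set (PathAlgebra k Q)) 2 ≃ tipSet (G : Set (PathAlgebra k Q)))
      (Φ₀ : AnickCochain I (G : Set (PathAlgebra k Q)) 0 ≃ₗ[k]
        ParallelSpace k (pathsOfLength Q 0) (basisPaths I))
      (Φ₁ : AnickCochain I (G : Set (PathAlgebra k Q)) 1 ≃ₗ[k]
        ParallelSpace k (pathsOfLength Q 1) (basisPaths I))
      (Φ₂ : AnickCochain I (G : Set (PathAlgebra k Q)) 2 ≃ₗ[k]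
        ParallelSpace k (tipSet (G : Set (PathAlgebra k Q))) (basisPaths I)),
      ((∀ c, c.1.total = PathAlgebra.of (κ₀ c).1) ∧
        (∀ c, c.1.total = PathAlgebra.of (κ₁ c).1) ∧
        (∀ c, c.1.total = PathAlgebra.of (κ₂ c).1)) ∧
      ((∀ f c b (h : ((κ₀ c).1, b.1) ∈ parallel (pathsOfLength Q 0) (basisPaths I)),
          Φ₀ f ⟨((κ₀ c).1, b.1), h⟩ = (monomialBasis I).repr (f (anickGen I G 0 c)) b) ∧
        (∀ f c b (h : ((κ₁ c).1, b.1) ∈ parallel (pathsOfLength Q 1) (basisPaths I)),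
          Φ₁ f ⟨((κ₁ c).1, b.1), h⟩ = (monomialBasis I).repr (f (anickGen I G 1 c)) b) ∧
        (∀ f c b (h : ((κ₂ c).1, b.1) ∈
            parallel (tipSet (G : Set (PathAlgebra k Q))) (basisPaths I)),
          Φ₂ f ⟨((κ₂ c).1, b.1), h⟩ = (monomialBasis I).repr (f (anickGen I G 2 c)) b)) ∧
      (∀ f, Φ₁ (anickDelta I G 0 f) = psi0 I (Φ₀ f)) ∧
      (∀ f, Φ₂ (anickDelta I G 1 f) = psi1 I G (Φ₁ f))) ∧
    Nonempty (HH k (PathAlgebra k Q ⧸ I) 0 ≃ₗ[k] LinearMap.ker (psi0 I)) ∧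
    Nonempty (HH k (PathAlgebra k Q ⧸ I) 1 ≃ₗ[k]
      Subquotient (LinearMap.ker (psi1 I G)) (LinearMap.range (psi0 I))) := by
  -- The tip of `g` is the maximum of its support, so `G` has finitely many tips.
  have hfin : (tipSet (G : Set (PathAlgebra k Q))).Finite := by
    refine ((G.finite_toSet).image fun g : PathAlgebra k Q =>
      (PathAlgebra.coeff g).support.max).preimage
      (f := fun p : QPath Q => (p : WithBot (QPath Q))) WithBot.coe_injective.injOn |>.subset ?_
    rintro _ ⟨g, hg, hg0, rfl⟩
    exact ⟨g, hg, (Finset.coe_max' _).symm⟩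
  refine ⟨psi1_comp_psi0 I hG, ?_, nonempty_HH_zero_equiv I, nonempty_HH_one_equiv I hG hadm⟩
  obtain ⟨κ₁, hκ₁⟩ := exists_criticalOneEquiv hG hadm hI
  obtain ⟨κ₂, hκ₂⟩ := exists_criticalTwoEquiv hG hadm hI
  have hκ₀ : ∀ c, (criticalZeroEquiv I (G : Set (PathAlgebra k Q)) c).1 = .vertex (c.1.v 0) :=
    fun c => rfl
  generalize criticalZeroEquiv I (G : Set (PathAlgebra k Q)) = κ₀ at hκ₀
  obtain ⟨Φ₀, hΦ₀⟩ := exists_cochainEquiv finite_pathsOfLength_zero κ₀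
    (fun c => by rw [hκ₀]; rfl) (fun c => by rw [hκ₀]; rfl)
  obtain ⟨Φ₁, hΦ₁⟩ := exists_cochainEquiv finite_pathsOfLength_one κ₁
    (fun c => by rw [hκ₁]; exact (c.1.source_eq 0).symm)
    (fun c => by rw [hκ₁]; exact (c.1.target_eq 0).symm)
  obtain ⟨Φ₂, hΦ₂⟩ := exists_cochainEquiv hfin κ₂
    (fun c => (c.1.source_eq 1).symm.trans (QPath.source_mul? (hκ₂ c)).symm)
    (fun c => (c.1.target_eq 0).symm.trans (QPath.target_mul? (hκ₂ c)).symm)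
  refine ⟨κ₀, κ₁, κ₂, Φ₀, Φ₁, Φ₂, ⟨fun c => ?_, fun c => ?_, fun c => ?_⟩,
    ⟨fun f c b h => ?_, fun f c b h => ?_, fun f c b h => ?_⟩, fun f => ?_, fun f => ?_⟩
  · rw [hκ₀]
    exact c.1.total_zero
  · rw [hκ₁]
    exact c.1.total_one
  · exact c.1.total_two (hκ₂ c)
  · rw [← hΦ₀, repr_family, dif_pos h]
  · rw [← hΦ₁, repr_family, dif_pos h]
  · rw [← hΦ₂, repr_family, dif_pos h]
  · refine family_ext_arrow I fun a b x => ?_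
    obtain ⟨c, hc⟩ := κ₁.surjective ⟨.arrow x, rfl⟩
    have hw : c.1.w 0 = .arrow x := by rw [← hκ₁, hc]
    have h := hΦ₁ (anickDelta I (G : Set (PathAlgebra k Q)) 0 f) c
    rw [hκ₁, anickDelta_zero_apply f (family I (pathsOfLength Q 0) (Φ₀ f))
      (fun c => by rw [← hΦ₀, hκ₀]) c, hw] at h
    rw [h, family_psi0]
    rfl
  · refine family_ext I fun p hp => ?_
    obtain ⟨c, hc⟩ := κ₂.surjective ⟨p, hp⟩
    obtain ⟨g, hg, hg0, rfl⟩ := hp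
    have hm := hκ₂ c
    rw [hc] at hm
    have h := hΦ₂ (anickDelta I (G : Set (PathAlgebra k Q)) 1 f) c
    rw [hc, anickDelta_one_apply hG hadm (θ := family I (pathsOfLength Q 1) (Φ₁ f))
      (fun a b x => family_mem_parallelTo I _ _) (fun c => by rw [← hΦ₁, hκ₁]) hg c hm] at h
    rw [h]
    exact (family_psi1 I hG (Φ₁ f) hg).symm
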